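/- Let $n\ge 1$, let $D\in\mathbb{R}^{n\times n}$ be symmetric positive definite, and let $b:\mathbb{R}^n\to\mathbb{R}^n$ be continuous, and continuously differentiable on an open set $\mathcal D$, with Jacobian matrix $A(x)=(\partial b_i/\partial x_j)$. Let $\Gamma\subset\mathcal D$ be a stable limit cycle of $\dot x=b(x)$: the orbit of a nonconstant periodic solution that is exponentially orbitally stable, i.e. there are $\delta,c>0$ and $C$ such that every solution $x$ on an interval $[0,T]$ with $\operatorname{dist}(x(0),\Gamma)<\delta$ satisfies $\operatorname{dist}(x(t),\Gamma)\le Ce^{-ct}\operatorname{dist}(x(0),\Gamma)$ for $0\le t\le T$. Let $$\varphi(x)=\inf_{T>0}\ \inf_{\xi(0)\in\Gamma,\ \xi(T)=x}\ \frac14\int_0^T(\dot\xi_s-b(\xi_s))^{\mathsf T}D^{-1}(\dot\xi_s-b(\xi_s))\,ds$$ (absolutely continuous paths $\xi:[0,T]\to\mathbb{R}^n$) be the stationary rate function (quasipotential) of the diffusions $dX_\epsilon=b(X_\epsilon)\,dt+(2\epsilon D)^{1/2}dB$ relative to $\Gamma$. Assume that $\varphi$ is $C^3$ on $\mathcal D$,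 and put $\gamma=b+D\nabla\varphi$. Let $x^*:[0,\infty)\to\mathbb{R}^n$ be a solution of $\dot x^*=b(x^*)$ with $x^*(0)\in\Gamma$, and write $[\Sigma^*(t)]^{-1}:=\nabla\nabla\varphi(x^*(t))$ (this is only notation; the matrix is singular). Then the following hold. 1. For all $t>0$, $$\frac{d[\Sigma^*]^{-1}}{dt}=-[\Sigma^*]^{-1}A(x^*)-A(x^*)^{\mathsf T}[\Sigma^*]^{-1}-2[\Sigma^*]^{-1}D[\Sigma^*]^{-1}.$$ 2. Let $\omega$ be a prefactor of the stationary WKB expansion: $\omega$ is $C^1$ and positive on $\mathcal D$, and for all small $\epsilon>0$ there are an invariant probability density $\pi_\epsilon$ (a probability density that solves $\nabla\cdot(b\pi_\epsilon-\epsilon D\nabla\pi_\epsilon)=0$ weakly, against all compactly supported $C^2$ test functions) and a number $\hat a(\epsilon)>0$ such that $\pi_\epsilon(x)=\hat a(\epsilon)\exp\left[-\frac1\epsilon\varphi(x)+\ln\omega(x)+O(\epsilon)\right]$ as $\epsilon\to0$, uniformly on compact subsets of $\mathcal D$. Then, with $\omega^*(t)=\omega(x^*(t))$, for all $t>0$,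 $$\frac{d\ln\omega^*}{dt}=-\nabla\cdot b(x^*)-\sum_{i,j}D_{ij}\,\big([\Sigma^*]^{-1}\big)_{ij}=-\nabla\cdot\gamma(x^*).$$ 3. For all $t\ge0$ the matrix $[\Sigma^*(t)]^{-1}$ is symmetric, zero is a simple eigenvalue of it with eigenspace spanned by the nonzero tangent vector $b(x^*(t))$, and all other eigenvalues are positive with eigenvectors in the hyperplane perpendicular to $\Gamma$. 4. $x^*$ is periodic, and for each period $T>0$ of $x^*$ there is a $T$-periodic moving frame along $x^*$, where a moving frame is a map $t\mapsto Q(t)=[e_1(t)\cdots e_n(t)]$, $t\ge0$, into the orthogonal matrices, differentiable for $t>0$, with $e_1=b(x^*)/\|b(x^*)\|$. For every moving frame $Q$, the matrix $K=Q^{\mathsf T}[\Sigma^*]^{-1}Q$ has zero first row and first column. Let $\tilde K,\tilde A,\tilde D,\tilde S$ be $K$, $Q^{\mathsf T}A(x^*)Q$, $Q^{\mathsf T}DQ$, $Q^{\mathsf T}\dot Q$ with the first row and first column deleted. Then $\tilde K$ and $\tilde D$ are positive definite for $t\ge0$, and for $t>0$ $$\frac{d\tilde K}{dt}=-\tilde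 K(\tilde A-\tilde S)-(\tilde A-\tilde S)^{\mathsf T}\tilde K-2\tilde K\tilde D\tilde K.$$ If $x^*$ and $Q$ are both $T$-periodic, then so are $\tilde K$, $\tilde A-\tilde S$ and $\tilde D$ (for $t>0$). -/

import Mathlib

open MeasureTheory Set
open scoped ENNReal

noncomputable section

namespace LimitCycle

/-- `x` solves `x' = b (x)` on the time set `I`. -/
def IsTrajectoryOn {n : ℕ} (b : EuclideanSpace ℝ (Fin n) → EuclideanSpace ℝ (Fin n))
    (x : ℝ → EuclideanSpace ℝ (Fin n)) (I : Set ℝ) : Prop :=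
  ∀ t ∈ I, HasDerivWithinAt x (b (x t)) I t

/-- `Γ` is the orbit of a nonconstant periodic solution of `x' = b (x)`. -/
def IsPeriodicOrbit {n : ℕ} (b : EuclideanSpace ℝ (Fin n) → EuclideanSpace ℝ (Fin n))
    (Γ : Set (EuclideanSpace ℝ (Fin n))) : Prop :=
  ∃ (p : ℝ → EuclideanSpace ℝ (Fin n)) (T : ℝ), 0 < T ∧ IsTrajectoryOn b p univ ∧
    (∀ t, p (t + T) = p t) ∧ (∃ t, p t ≠ p 0) ∧ Γ = range p

/-- Exponential orbital stability of `Γ`: solutions that start near `Γ` satisfy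
`dist (x (t), Γ) ≤ C e ^ (-c t) dist (x (0), Γ)` for as long as they exist. -/
def IsExponentiallyStable {n : ℕ}
    (b : EuclideanSpace ℝ (Fin n) → EuclideanSpace ℝ (Fin n))
    (Γ : Set (EuclideanSpace ℝ (Fin n))) : Prop :=
  ∃ δ C c : ℝ, 0 < δ ∧ 0 < c ∧
    ∀ (T : ℝ) (x : ℝ → EuclideanSpace ℝ (Fin n)), 0 ≤ T → IsTrajectoryOn b x (Icc 0 T) →
      Metric.infDist (x 0) Γ < δ →
      ∀ t ∈ Icc 0 T, Metric.infDist (x t) Γ ≤ C * Real.exp (-c * t) * Metric.infDist (x 0) Γ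

/-- A (linearly) stable limit cycle of `x' = b (x)`. -/
structure IsStableLimitCycle {n : ℕ}
    (b : EuclideanSpace ℝ (Fin n) → EuclideanSpace ℝ (Fin n))
    (Γ : Set (EuclideanSpace ℝ (Fin n))) : Prop where
  orbit : IsPeriodicOrbit b Γ
  stable : IsExponentiallyStable b Γ

/-- `ξ` is absolutely continuous on `[0, T]` with (almost everywhere) derivative `v`. -/
def IsACPath {n : ℕ} (T : ℝ) (ξ v : ℝ → EuclideanSpace ℝ (Fin n)) : Prop :=
  IntervalIntegrable v volume 0 T ∧ ∀ t ∈ Icc 0 T, ξ t = ξ 0 + ∫ s in (0 : ℝ)..t, v s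

/-- The Freidlin-Wentzell action `(1/4) ∫₀ᵀ (ξ' - b(ξ))ᵀ D⁻¹ (ξ' - b(ξ)) ds`, where `v = ξ'`. -/
def action {n : ℕ} (b : EuclideanSpace ℝ (Fin n) → EuclideanSpace ℝ (Fin n))
    (D : Matrix (Fin n) (Fin n) ℝ) (T : ℝ) (ξ v : ℝ → EuclideanSpace ℝ (Fin n)) : ℝ≥0∞ :=
  ∫⁻ s in Icc 0 T, ENNReal.ofReal
    ((1 / 4) * (WithLp.ofLp (v s - b (ξ s)) ⬝ᵥ
      Matrix.mulVec D⁻¹ (WithLp.ofLp (v s - b (ξ s)))))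

/-- The stationary rate function: the quasipotential relative to `Γ`, that is the infimum of the
action over all `T > 0` and all paths on `[0, T]` from a point of `Γ` to `x`. -/
def rateFunction {n : ℕ} (b : EuclideanSpace ℝ (Fin n) → EuclideanSpace ℝ (Fin n))
    (D : Matrix (Fin n) (Fin n) ℝ) (Γ : Set (EuclideanSpace ℝ (Fin n)))
    (x : EuclideanSpace ℝ (Fin n)) : ℝ :=
  (sInf {S : ℝ≥0∞ | ∃ (T : ℝ) (ξ v : ℝ → EuclideanSpace ℝ (Fin n)), 0 < T ∧ IsACPath T ξ v ∧
    ξ 0 ∈ Γ ∧ ξ T = x ∧ S = action b D T ξ v}).toReal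

/-- The Hessian matrix `∇∇φ (x)`. -/
def hessian {n : ℕ} (φ : EuclideanSpace ℝ (Fin n) → ℝ) (x : EuclideanSpace ℝ (Fin n)) :
    Matrix (Fin n) (Fin n) ℝ :=
  Matrix.of fun i j =>
    fderiv ℝ (fderiv ℝ φ) x (EuclideanSpace.single i 1) (EuclideanSpace.single j 1)

/-- The Jacobian matrix of `f` at `x`, with entries `∂ f_i / ∂ x_j`. -/
def jacobian {n : ℕ} (f : EuclideanSpace ℝ (Fin n) → EuclideanSpace ℝ (Fin n))
    (x : EuclideanSpace ℝ (Fin n)) : Matrix (Fin n) (Fin n) ℝ :=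
  Matrix.of fun i j => fderiv ℝ f x (EuclideanSpace.single j 1) i

/-- The divergence of `f` at `x`. -/
def divergence {n : ℕ} (f : EuclideanSpace ℝ (Fin n) → EuclideanSpace ℝ (Fin n))
    (x : EuclideanSpace ℝ (Fin n)) : ℝ :=
  ∑ i, fderiv ℝ f x (EuclideanSpace.single i 1) i

/-- The Frobenius product `∑ i j, M i j * N i j`. -/
def frobenius {n : ℕ} (M N : Matrix (Fin n) (Fin n) ℝ) : ℝ := ∑ i, ∑ j, M i j * N i j

/-- The field `γ = b + D ∇φ`. -/
def circulation {n : ℕ} (b : EuclideanSpace ℝ (Fin n) → EuclideanSpace ℝ (Fin n))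
    (D : Matrix (Fin n) (Fin n) ℝ) (φ : EuclideanSpace ℝ (Fin n) → ℝ)
    (x : EuclideanSpace ℝ (Fin n)) : EuclideanSpace ℝ (Fin n) :=
  b x + WithLp.toLp 2 (Matrix.mulVec D (WithLp.ofLp (gradient φ x)))

/-- `ρ` is an invariant probability density of `dX = b(X) dt + (2 ε D)^(1/2) dB`: a probability
density that solves `∇ · (b ρ - ε D ∇ρ) = 0` weakly. -/
structure IsInvariantDensity {n : ℕ}
    (b : EuclideanSpace ℝ (Fin n) → EuclideanSpace ℝ (Fin n))
    (D : Matrix (Fin n) (Fin n) ℝ) (ε : ℝ) (ρ : EuclideanSpace ℝ (Fin n) → ℝ) : Prop where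
  nonneg : ∀ x, 0 ≤ ρ x
  integrable : Integrable ρ
  mass : ∫ x, ρ x = 1
  stationary : ∀ ψ : EuclideanSpace ℝ (Fin n) → ℝ, ContDiff ℝ 2 ψ → HasCompactSupport ψ →
    ∫ x, ρ x * (fderiv ℝ ψ x (b x) + ε * frobenius D (hessian ψ x)) = 0

/-- For small `ε > 0`, `ρ ε` is an invariant probability density, and
`ρ ε x = a ε * exp (- φ x / ε + log (ω x) + O(ε))` uniformly on compact subsets of `𝒟`:
`ω` is the prefactor of the stationary WKB expansion with rate function `φ`. -/
structure IsStationaryWKB {n : ℕ}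
    (b : EuclideanSpace ℝ (Fin n) → EuclideanSpace ℝ (Fin n))
    (D : Matrix (Fin n) (Fin n) ℝ) (𝒟 : Set (EuclideanSpace ℝ (Fin n)))
    (φ ω : EuclideanSpace ℝ (Fin n) → ℝ) (ρ : ℝ → EuclideanSpace ℝ (Fin n) → ℝ)
    (a : ℝ → ℝ) : Prop where
  prefactor_pos : ∀ x ∈ 𝒟, 0 < ω x
  invariant : ∃ ε₀ > 0, ∀ ε, 0 < ε → ε < ε₀ → 0 < a ε ∧ IsInvariantDensity b D ε (ρ ε)
  expansion : ∀ K ⊆ 𝒟, IsCompact K → ∃ C ε₀ : ℝ, 0 < ε₀ ∧ ∀ ε, 0 < ε → ε < ε₀ → ∀ x ∈ K,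
    ∃ r : ℝ, |r| ≤ C * ε ∧ ρ ε x = a ε * Real.exp (-(φ x) / ε + Real.log (ω x) + r)

/-- `Q t` (for `t ≥ 0`) is an orthonormal frame, written in columns, whose first vector is the unit
tangent `b (x t) / ‖b (x t)‖`; for `t > 0` it is differentiable with derivative `Q' t`. -/
structure IsMovingFrame {m : ℕ}
    (b : EuclideanSpace ℝ (Fin (m + 1)) → EuclideanSpace ℝ (Fin (m + 1)))
    (x : ℝ → EuclideanSpace ℝ (Fin (m + 1)))
    (Q Q' : ℝ → Matrix (Fin (m + 1)) (Fin (m + 1)) ℝ) : Prop where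
  orthonormal : ∀ t, 0 ≤ t → (Q t).transpose * Q t = 1
  tangent : ∀ t, 0 ≤ t → ∀ i, Q t i 0 = b (x t) i / ‖b (x t)‖
  hasDeriv : ∀ t, 0 < t → ∀ i j, HasDerivAt (fun s => Q s i j) (Q' t i j) t

/-- The matrix `M` in the frame `Q`, restricted to the hyperplane normal to the first frame vector:
`Qᵀ M Q` with the first row and column deleted. -/
def normalPart {m : ℕ} (Q M : Matrix (Fin (m + 1)) (Fin (m + 1)) ℝ) : Matrix (Fin m) (Fin m) ℝ :=
  (Q.transpose * M * Q).submatrix Fin.succ Fin.succ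

/-- `Qᵀ Q'` with the first row and column deleted. -/
def frameRotation {m : ℕ} (Q Q' : Matrix (Fin (m + 1)) (Fin (m + 1)) ℝ) :
    Matrix (Fin m) (Fin m) ℝ :=
  (Q.transpose * Q').submatrix Fin.succ Fin.succ

end LimitCycle

end

open Filter Topology

/-! Everything rests on three facts about the quasipotential φ near the cycle.

The Hamilton-Jacobi equation ⟨b, ∇φ⟩ + ⟨∇φ, D∇φ⟩ = 0 holds classically on 𝒟 (`hamiltonian_eq_zero`).
Prolonging almost optimal paths by short segments bounds every directional derivative of φ by the
Lagrangian, and the optimal direction gives "≤". If "<" held near a point off Γ, each path of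
bounded action from Γ to that point would spend at least a fixed time in the region of strict
inequality. The Fenchel inequality then charges a fixed extra cost, which contradicts the definition
of φ as an infimum. On Γ, φ attains its minimum 0, so ∇φ vanishes there. Differentiating the
equation twice at such critical points gives the Riccati equation (`hessian_hamiltonJacobi`). The
second derivatives of b, which need not exist, would only enter multiplied by ∇φ = 0.

Exponential stability makes φ grow at least like dist(·, Γ)²
(`exists_min_infDist_sq_le_rateFunction`). A path of action κ² deviates by O(κ) from the flow during
a fixed time in which the flow halves the distance to Γ, so it never gets further than O(κ) from Γ.
A direction not tangent to Γ with nonpositive second derivative would make φ too small along a ray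
whose distance from Γ grows linearly. Hence the kernel of the Hessian is exactly the tangent line,
and the Hessian is positive on the normal hyperplane.

For the prefactor, the weak stationary equation is tested with exp(φ/ε)χ. The exponential cancels
the one in the density, the Hamilton-Jacobi equation removes the 1/ε term, and ε → 0 leaves a weak
transport equation along b + 2D∇φ, which continuity makes pointwise (`transport_equation`). On Γ
this field is b, so the transport equation becomes an ODE along the cycle.

In a frame whose first vector is tangent, the Hessian has zero first row and column. Deleting these
therefore commutes with the products in the Riccati equation. The frame is built from Householder
reflections, so that it depends only on the point of the cycle and inherits every period of the
trajectory. -/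

namespace LimitCycle

/-! ### Real functions: hitting times, Grönwall, absolute continuity -/

section RealFunctions

theorem exists_first_hit {f : ℝ → ℝ} {a c r : ℝ} (hac : a ≤ c) (hf : ContinuousOn f (Icc a c))
    (ha : f a ≤ r) (hc : r ≤ f c) : ∃ t ∈ Icc a c, f t = r ∧ ∀ s ∈ Icc a t, f s ≤ r := by
  set S := Icc a c ∩ f ⁻¹' {r} with hS
  have hScl : IsClosed S := hf.preimage_isClosed_of_isClosed isClosed_Icc isClosed_singleton
  have hSne : S.Nonempty := by
    obtain ⟨t, ht, htr⟩ := intermediate_value_Icc hac hf ⟨ha, hc⟩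
    exact ⟨t, ht, htr⟩
  have hSbd : BddBelow S := ⟨a, fun t ht => ht.1.1⟩
  have hmem := hScl.csInf_mem hSne hSbd
  refine ⟨sInf S, hmem.1, hmem.2, fun s hs => ?_⟩
  by_contra! hlt
  obtain ⟨u, hu, hur⟩ := intermediate_value_Icc hs.1
    (hf.mono (Icc_subset_Icc_right (hs.2.trans hmem.1.2))) ⟨ha, hlt.le⟩
  have huS : u ∈ S := ⟨⟨hu.1, hu.2.trans (hs.2.trans hmem.1.2)⟩, hur⟩
  have h1 := csInf_le hSbd huS
  have h2 : u = s := le_antisymm hu.2 (hs.2.trans h1)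
  rw [← h2, hur] at hlt
  exact lt_irrefl _ hlt

theorem exists_last_hit {f : ℝ → ℝ} {a c r : ℝ} (hac : a ≤ c) (hf : ContinuousOn f (Icc a c))
    (ha : r ≤ f a) (hc : f c ≤ r) : ∃ t ∈ Icc a c, f t = r ∧ ∀ s ∈ Icc t c, f s ≤ r := by
  have hg : ContinuousOn (fun t => f (-t)) (Icc (-c) (-a)) :=
    hf.comp continuous_neg.continuousOn fun t ht => ⟨by linarith [ht.2], by linarith [ht.1]⟩
  obtain ⟨t, ht, htr, hle⟩ := exists_first_hit (neg_le_neg hac) hg (by simpa using hc)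
    (by simpa using ha)
  refine ⟨-t, ⟨by linarith [ht.2], by linarith [ht.1]⟩, htr, fun s hs => ?_⟩
  simpa using hle (-s) ⟨by linarith [hs.2], by linarith [hs.1]⟩

/-- Grönwall's inequality in integral form. -/
theorem le_mul_exp_of_le_add_integral {f : ℝ → ℝ} {a c δ K : ℝ} (hK : 0 < K)
    (hf : ContinuousOn f (Icc a c))
    (h : ∀ t ∈ Icc a c, f t ≤ δ + K * ∫ s in a..t, f s) :
    ∀ t ∈ Icc a c, f t ≤ δ * Real.exp (K * (t - a)) := by
  intro t ht
  have hac : a ≤ c := ht.1.trans ht.2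
  -- The continuous extension makes the primitive differentiable on all of ℝ, endpoints included.
  -- The differential form of Grönwall is then applied to the primitive.
  set g : ℝ → ℝ := IccExtend hac ((Icc a c).domRestrict f) with hg
  have hgc : Continuous g := (continuousOn_iff_continuous_domRestrict.1 hf).Icc_extend'
  have hgf : ∀ s ∈ Icc a c, g s = f s := fun s hs => IccExtend_of_mem hac _ hs
  have hint : ∀ s ∈ Icc a c, ∫ r in a..s, f r = ∫ r in a..s, g r := fun s hs =>
    intervalIntegral.integral_congr fun r hr => by
      rw [uIcc_of_le hs.1] at hr
      exact (hgf r ⟨hr.1, hr.2.trans hs.2⟩).symm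
  have hder : ∀ s, HasDerivAt (fun u => ∫ r in a..u, g r) (g s) s := fun s =>
    (hgc.integral_hasStrictDerivAt a s).hasDerivAt
  have hF := le_gronwallBound_of_liminf_deriv_right_le (f := fun u => ∫ r in a..u, g r) (f' := g)
    (δ := 0) (K := K) (ε := δ) (a := a) (b := c)
    (fun s _ => (hder s).continuousAt.continuousWithinAt)
    (fun s _ r hr => (hder s).hasDerivWithinAt.liminf_right_slope_le hr)
    (by simp) (fun s hs => by
      have := h s ⟨hs.1, hs.2.le⟩
      rw [hint s ⟨hs.1, hs.2.le⟩, ← hgf s ⟨hs.1, hs.2.le⟩] at this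
      linarith) t ht
  rw [gronwallBound_of_K_ne_0 hK.ne'] at hF
  have h1 := h t ht
  rw [hint t ht] at h1
  have h2 : K * ∫ r in a..t, g r ≤ K * (0 * Real.exp (K * (t - a))
      + δ / K * (Real.exp (K * (t - a)) - 1)) := mul_le_mul_of_nonneg_left hF hK.le
  have h3 : K * (0 * Real.exp (K * (t - a)) + δ / K * (Real.exp (K * (t - a)) - 1))
      = δ * Real.exp (K * (t - a)) - δ := by field_simp; ring
  linarith

/-- Applied with g the primitive of ‖v‖: a Lipschitz function of a path moves at most a constant
times the length that the path covers. -/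
theorem absolutelyContinuousOnInterval_of_dist_le {X : Type*} [PseudoMetricSpace X] {f : ℝ → X}
    {g : ℝ → ℝ} {a c L : ℝ} (hg : AbsolutelyContinuousOnInterval g a c)
    (h : ∀ s ∈ uIcc a c, ∀ t ∈ uIcc a c, dist (f s) (f t) ≤ L * dist (g s) (g t)) :
    AbsolutelyContinuousOnInterval f a c := by
  unfold AbsolutelyContinuousOnInterval at hg ⊢
  have h1 := hg.const_mul L
  rw [mul_zero] at h1
  refine squeeze_zero' (Eventually.of_forall fun E => Finset.sum_nonneg fun _ _ => dist_nonneg)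
    ?_ h1
  filter_upwards [mem_inf_of_right (mem_principal_self _)] with E hE
  rw [Finset.mul_sum]
  refine Finset.sum_le_sum fun i hi => ?_
  have := hE.1 i hi
  exact h _ this.1 _ this.2

end RealFunctions

/-! ### Lipschitz vector fields and existence of solutions -/

section ODE

variable {F : Type*} [NormedAddCommGroup F] [NormedSpace ℝ F]

theorem locallyLipschitzOn_of_contDiffOn_isOpen {G : Type*} [NormedAddCommGroup G]
    [NormedSpace ℝ G] {f : F → G} {U S : Set F}
    (hU : IsOpen U) (hf : ContDiffOn ℝ 1 f U) (hS : S ⊆ U) : LocallyLipschitzOn S f := by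
  intro y hy
  obtain ⟨K, t, ht, hK⟩ := (hf.contDiffAt (hU.mem_nhds (hS hy))).exists_lipschitzOnWith
  exact ⟨K, t, mem_nhdsWithin_of_mem_nhds ht, hK⟩

/-- The global bound B allows the Picard-Lindelöf ball to have radius Bτ, so the time interval need
not shrink. -/
theorem exists_solution_of_lipschitz_bounded [CompleteSpace F] {f : F → F} {K : NNReal} {B : ℝ}
    (hf : LipschitzWith K f) (hB : ∀ y, ‖f y‖ ≤ B) (y₀ : F) {τ : ℝ} (hτ : 0 ≤ τ) :
    ∃ y : ℝ → F, y 0 = y₀ ∧ ∀ t ∈ Icc 0 τ, HasDerivWithinAt y (f (y t)) (Icc 0 τ) t := by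
  have hB0 : 0 ≤ B := (norm_nonneg _).trans (hB y₀)
  have hpl : IsPicardLindelof (fun _ => f) (tmin := 0) (tmax := τ) ⟨0, le_rfl, hτ⟩ y₀
      (⟨B * τ, mul_nonneg hB0 hτ⟩) 0 ⟨B, hB0⟩ K :=
    { lipschitzOnWith := fun _ _ => hf.lipschitzOnWith
      continuousOn := fun _ _ => continuousOn_const
      norm_le := fun _ _ y _ => hB y
      mul_max_le := by
        simp only [sub_zero, sub_self, max_eq_left hτ, NNReal.coe_zero]
        exact le_rfl }
  simpa using hpl.exists_eq_forall_mem_Icc_hasDerivWithinAt₀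

end ODE

/-! ### Absolutely continuous paths and the chain rule -/

section Paths

variable {n : ℕ}

theorem IsACPath.intervalIntegrable {T : ℝ} {ξ v : ℝ → EuclideanSpace ℝ (Fin n)}
    (h : IsACPath T ξ v) {s t : ℝ}
    (hs : s ∈ Icc 0 T) (ht : t ∈ Icc 0 T) : IntervalIntegrable v volume s t :=
  h.1.mono_set (by
    rw [uIcc_of_le (hs.1.trans hs.2)]
    exact uIcc_subset_Icc hs ht)

theorem IsACPath.sub_eq_integral {T : ℝ} {ξ v : ℝ → EuclideanSpace ℝ (Fin n)} (h : IsACPath T ξ v)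
    {s t : ℝ}
    (hs : s ∈ Icc 0 T) (ht : t ∈ Icc 0 T) : ξ t - ξ s = ∫ r in s..t, v r := by
  have h0 : (0 : ℝ) ∈ Icc 0 T := ⟨le_rfl, hs.1.trans hs.2⟩
  rw [h.2 t ht, h.2 s hs, add_sub_add_left_eq_sub,
    intervalIntegral.integral_interval_sub_left (h.intervalIntegrable h0 ht)
      (h.intervalIntegrable h0 hs)]

theorem IsACPath.continuousOn {T : ℝ} {ξ v : ℝ → EuclideanSpace ℝ (Fin n)} (h : IsACPath T ξ v)
    (hT : 0 ≤ T) :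
    ContinuousOn ξ (Icc 0 T) := by
  have h1 := intervalIntegral.continuousOn_primitive_interval' (μ := volume) h.1 left_mem_uIcc
  rw [uIcc_of_le hT] at h1
  exact (continuousOn_const.add h1).congr h.2

theorem IsACPath.mono {T S : ℝ} {ξ v : ℝ → EuclideanSpace ℝ (Fin n)} (h : IsACPath T ξ v)
    (hS : S ∈ Icc 0 T) :
    IsACPath S ξ v :=
  ⟨h.intervalIntegrable ⟨le_rfl, hS.1.trans hS.2⟩ hS, fun t ht => h.2 t ⟨ht.1, ht.2.trans hS.2⟩⟩

theorem IsACPath.ae_hasDerivAt {T : ℝ} {ξ v : ℝ → EuclideanSpace ℝ (Fin n)} (h : IsACPath T ξ v)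
    (hT : 0 ≤ T) :
    ∀ᵐ r, r ∈ Icc 0 T → HasDerivAt ξ (v r) r := by
  -- The endpoints are discarded because ξ is the primitive of v only on [0, T], which gives no
  -- two-sided derivative there.
  have h₁ : ∀ᵐ r : ℝ, r ≠ 0 := by simp [ae_iff, measure_singleton]
  have h₂ : ∀ᵐ r : ℝ, r ≠ T := by simp [ae_iff, measure_singleton]
  filter_upwards [h.1.ae_hasDerivAt_integral, h₁, h₂] with r hr hr0 hrT hrI
  rw [uIcc_of_le hT] at hr
  have := (hr hrI 0 ⟨le_rfl, hT⟩).const_add (ξ 0)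
  refine this.congr_of_eventuallyEq ?_
  filter_upwards [Icc_mem_nhds (lt_of_le_of_ne hrI.1 hr0.symm) (lt_of_le_of_ne hrI.2 hrT)]
    with s hs using h.2 s hs

theorem IsACPath.integrable_fderiv {T : ℝ} {ξ v : ℝ → EuclideanSpace ℝ (Fin n)} (h : IsACPath T ξ v)
    {s t : ℝ}
    (hs : 0 ≤ s) (hst : s ≤ t) (ht : t ≤ T) {U : Set (EuclideanSpace ℝ (Fin n))} (hU : IsOpen U)
    {f : EuclideanSpace ℝ (Fin n) → ℝ}
    (hf : ContDiffOn ℝ 1 f U) (hξ : ∀ r ∈ Icc s t, ξ r ∈ U) :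
    IntervalIntegrable (fun r => fderiv ℝ f (ξ r) (v r)) volume s t := by
  have hT : 0 ≤ T := hs.trans (hst.trans ht)
  have hsI : s ∈ Icc 0 T := ⟨hs, hst.trans ht⟩
  have htI : t ∈ Icc 0 T := ⟨hs.trans hst, ht⟩
  have hc : ContinuousOn (fun r => fderiv ℝ f (ξ r)) (uIcc s t) := by
    rw [uIcc_of_le hst]
    exact (hf.continuousOn_fderiv_of_isOpen hU le_rfl).comp
      ((h.continuousOn hT).mono (Icc_subset_Icc hs ht)) hξ
  have hv := h.intervalIntegrable hsI htI
  obtain ⟨C, hC⟩ := isCompact_uIcc.exists_bound_of_continuousOn hc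
  have hv1 := hv.norm.const_mul C
  rw [intervalIntegrable_iff] at hv1 hv ⊢
  refine hv1.mono' ?_ ?_
  · have h1 := (hc.mono uIoc_subset_uIcc).aestronglyMeasurable (μ := volume) measurableSet_uIoc
    exact (ContinuousLinearMap.apply ℝ ℝ).aestronglyMeasurable_comp₂ hv.1 h1
  · refine (ae_restrict_iff' measurableSet_uIoc).2 (Eventually.of_forall fun r hr => ?_)
    exact ((fderiv ℝ f (ξ r)).le_opNorm _).trans
      (mul_le_mul_of_nonneg_right (hC r (uIoc_subset_uIcc hr)) (norm_nonneg _))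

/-- The chain rule and the fundamental theorem of calculus along absolutely continuous paths. -/
theorem IsACPath.integral_fderiv {T : ℝ} {ξ v : ℝ → EuclideanSpace ℝ (Fin n)} (h : IsACPath T ξ v)
    {s t : ℝ}
    (hs : 0 ≤ s) (hst : s ≤ t) (ht : t ≤ T) {U : Set (EuclideanSpace ℝ (Fin n))} (hU : IsOpen U)
    {f : EuclideanSpace ℝ (Fin n) → ℝ}
    (hf : ContDiffOn ℝ 1 f U) (hξ : ∀ r ∈ Icc s t, ξ r ∈ U) :
    ∫ r in s..t, fderiv ℝ f (ξ r) (v r) = f (ξ t) - f (ξ s) := by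
  have hT : 0 ≤ T := hs.trans (hst.trans ht)
  have hsI : s ∈ Icc 0 T := ⟨hs, hst.trans ht⟩
  have htI : t ∈ Icc 0 T := ⟨hs.trans hst, ht⟩
  have hsub : Icc s t ⊆ Icc 0 T := Icc_subset_Icc hs ht
  have hint := h.integrable_fderiv hs hst ht hU hf hξ
  obtain ⟨L, hL⟩ := LocallyLipschitzOn.exists_lipschitzOnWith_of_compact
    (isCompact_Icc.image_of_continuousOn ((h.continuousOn hT).mono hsub))
    (locallyLipschitzOn_of_contDiffOn_isOpen hU hf (S := ξ '' Icc s t)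
      (by rintro _ ⟨r, hr, rfl⟩; exact hξ r hr))
  have hvn := (h.intervalIntegrable hsI htI).norm
  -- f is Lipschitz on the compact image of the path, so f ∘ ξ is dominated by the primitive of ‖v‖.
  have hac1 : AbsolutelyContinuousOnInterval (fun r => f (ξ r)) s t := by
    refine absolutelyContinuousOnInterval_of_dist_le (L := L)
      (hvn.absolutelyContinuousOnInterval_intervalIntegral (c := s) (by simp)) ?_
    rw [uIcc_of_le hst]
    intro a ha c hc
    refine (hL.dist_le_mul _ ⟨a, ha, rfl⟩ _ ⟨c, hc, rfl⟩).trans ?_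
    refine mul_le_mul_of_nonneg_left ?_ L.2
    have hia := (h.intervalIntegrable hsI (hsub ha)).norm
    have hic := (h.intervalIntegrable hsI (hsub hc)).norm
    rw [dist_comm, dist_eq_norm, h.sub_eq_integral (hsub ha) (hsub hc), dist_comm,
      Real.dist_eq, intervalIntegral.integral_interval_sub_left hic hia]
    exact intervalIntegral.norm_integral_le_abs_integral_norm
  have hac2 := hint.absolutelyContinuousOnInterval_intervalIntegral (c := s) (by simp)
  -- Both sides are absolutely continuous with the same derivative almost everywhere, so they differ
  -- by a constant.
  obtain ⟨C, hC⟩ := (hac1.sub hac2).const_of_ae_hasDerivAt_zero (by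
    filter_upwards [h.ae_hasDerivAt hT, hint.ae_hasDerivAt_integral] with r h1 h2 hr
    have h3 := h2 hr s (by simp)
    rw [uIcc_of_le hst] at hr
    have h4 : HasFDerivAt f (fderiv ℝ f (ξ r)) (ξ r) :=
      ((hf.contDiffAt (hU.mem_nhds (hξ r hr))).differentiableAt one_ne_zero).hasFDerivAt
    have h5 := (h4.comp_hasDerivAt r (h1 (hsub hr))).sub h3
    rw [sub_self] at h5
    exact h5)
  have e1 := hC s (by simp)
  have e2 := hC t (by simp)
  simp only [Pi.sub_apply, intervalIntegral.integral_same, sub_zero] at e1 e2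
  linarith

end Paths

/-! ### The Lagrangian and its Legendre duality with the Hamiltonian -/

section Lagrangian

variable {n : ℕ}

/-- The Lagrangian `(1/4) uᵀ D⁻¹ u` as a function of the control `u = ξ' - b(ξ)`. -/
noncomputable def lagrangian (D : Matrix (Fin n) (Fin n) ℝ) (u : EuclideanSpace ℝ (Fin n)) : ℝ :=
  (1 / 4) * (u.ofLp ⬝ᵥ Matrix.mulVec D⁻¹ u.ofLp)

/-- The infimum of the action, of which `rateFunction` is the real part. -/
noncomputable def quasipotential (b : EuclideanSpace ℝ (Fin n) → EuclideanSpace ℝ (Fin n))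
    (D : Matrix (Fin n) (Fin n) ℝ) (Γ : Set (EuclideanSpace ℝ (Fin n)))
        (x : EuclideanSpace ℝ (Fin n)) :
    ℝ≥0∞ :=
  sInf {S : ℝ≥0∞ | ∃ (T : ℝ) (ξ v : ℝ → EuclideanSpace ℝ (Fin n)), 0 < T ∧ IsACPath T ξ v ∧
    ξ 0 ∈ Γ ∧ ξ T = x ∧ S = action b D T ξ v}

variable {b : EuclideanSpace ℝ (Fin n) → EuclideanSpace ℝ (Fin n)}
  {D : Matrix (Fin n) (Fin n) ℝ} {Γ : Set (EuclideanSpace ℝ (Fin n))}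

theorem rateFunction_eq_toReal (x : EuclideanSpace ℝ (Fin n)) :
    rateFunction b D Γ x = (quasipotential b D Γ x).toReal := rfl

theorem action_eq_lintegral (T : ℝ) (ξ v : ℝ → EuclideanSpace ℝ (Fin n)) :
    action b D T ξ v = ∫⁻ s in Icc 0 T, ENNReal.ofReal (lagrangian D (v s - b (ξ s))) := rfl

theorem isSymm_of_posDef (hD : D.PosDef) : D.transpose = D := by
  simpa [Matrix.IsHermitian] using hD.isHermitian

theorem lagrangian_nonneg (hD : D.PosDef) (u : EuclideanSpace ℝ (Fin n)) : 0 ≤ lagrangian D u := by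
  have := hD.inv.posSemidef.dotProduct_mulVec_nonneg u.ofLp
  simp only [star_trivial] at this
  unfold lagrangian
  positivity

theorem continuous_lagrangian (D : Matrix (Fin n) (Fin n) ℝ) : Continuous (lagrangian D) := by
  unfold lagrangian Matrix.mulVec dotProduct
  fun_prop

/-- The Fenchel inequality for the Lagrangian and the Hamiltonian. -/
theorem dotProduct_le_lagrangian_add (hD : D.PosDef) (p : Fin n → ℝ)
    (u : EuclideanSpace ℝ (Fin n)) :
    p ⬝ᵥ u.ofLp ≤ lagrangian D u + p ⬝ᵥ D.mulVec p := by
  have hdet : IsUnit D.det := hD.det_pos.ne'.isUnit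
  have hsymm := isSymm_of_posDef hD
  -- Completing the square: this nonnegative quantity is exactly the gap in the Fenchel inequality.
  have h := lagrangian_nonneg hD (u - WithLp.toLp 2 ((2 : ℝ) • D.mulVec p))
  have e1 : D⁻¹.mulVec (D.mulVec p) = p := by
    rw [Matrix.mulVec_mulVec, Matrix.nonsing_inv_mul _ hdet, Matrix.one_mulVec]
  have e2 : D.mulVec p ⬝ᵥ D⁻¹.mulVec u.ofLp = p ⬝ᵥ u.ofLp := by
    rw [dotProduct_comm, ← Matrix.dotProduct_transpose_mulVec, hsymm,
      Matrix.mulVec_mulVec, Matrix.mul_nonsing_inv _ hdet, Matrix.one_mulVec]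
  have e3 : u.ofLp ⬝ᵥ p = p ⬝ᵥ u.ofLp := dotProduct_comm _ _
  have e4 : D.mulVec p ⬝ᵥ p = p ⬝ᵥ D.mulVec p := dotProduct_comm _ _
  unfold lagrangian at h ⊢
  simp only [WithLp.ofLp_sub, Matrix.mulVec_sub, Matrix.mulVec_smul, e1, sub_dotProduct,
    dotProduct_sub, smul_dotProduct, dotProduct_smul, smul_eq_mul, e2, e3, e4] at h
  linarith

/-- The equality case of the Fenchel inequality: u = 2Dp is the control dual to the momentum p. -/
theorem lagrangian_two_smul_mulVec (hD : D.PosDef) (p : Fin n → ℝ) :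
    lagrangian D (WithLp.toLp 2 ((2 : ℝ) • D.mulVec p)) = p ⬝ᵥ D.mulVec p := by
  have hdet : IsUnit D.det := hD.det_pos.ne'.isUnit
  unfold lagrangian
  simp only [Matrix.mulVec_smul, Matrix.mulVec_mulVec, Matrix.nonsing_inv_mul _ hdet,
    Matrix.one_mulVec, smul_dotProduct, dotProduct_smul, smul_eq_mul]
  rw [dotProduct_comm]
  ring

theorem exists_dotProduct_mulVec_le (D : Matrix (Fin n) (Fin n) ℝ) :
    ∃ M, 0 < M ∧ ∀ u : EuclideanSpace ℝ (Fin n), u.ofLp ⬝ᵥ D.mulVec u.ofLp ≤ M * ‖u‖ ^ 2 := by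
  set A := Matrix.toEuclideanCLM (n := Fin n) (𝕜 := ℝ) D
  refine ⟨‖A‖ + 1, by positivity, fun u => ?_⟩
  have h1 : u.ofLp ⬝ᵥ D.mulVec u.ofLp = inner ℝ u (A u) := by
    rw [EuclideanSpace.inner_eq_star_dotProduct, dotProduct_comm]
    simp [A]
  rw [h1]
  have h2 := real_inner_le_norm u (A u)
  have h3 := mul_le_mul_of_nonneg_left (A.le_opNorm u) (norm_nonneg u)
  nlinarith [sq_nonneg ‖u‖]

/-- Coercivity by duality: the Fenchel inequality at p = u/(2M), where M bounds the quadratic form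
of D, avoids any estimate of D⁻¹ itself. -/
theorem exists_le_lagrangian (hD : D.PosDef) :
    ∃ l, 0 < l ∧ ∀ u : EuclideanSpace ℝ (Fin n), l * ‖u‖ ^ 2 ≤ lagrangian D u := by
  obtain ⟨M, hM, h⟩ := exists_dotProduct_mulVec_le D
  refine ⟨1 / (4 * M), by positivity, fun u => ?_⟩
  have h1 := dotProduct_le_lagrangian_add hD ((1 / (2 * M)) • u.ofLp) u
  have h2 := h u
  have h3 : u.ofLp ⬝ᵥ u.ofLp = ‖u‖ ^ 2 := by
    rw [EuclideanSpace.real_norm_sq_eq]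
    simp [dotProduct, sq]
  simp only [Matrix.mulVec_smul, smul_dotProduct, dotProduct_smul, smul_eq_mul, h3] at h1
  have h4 : 1 / (2 * M) * (1 / (2 * M) * (u.ofLp ⬝ᵥ D.mulVec u.ofLp))
      ≤ 1 / (2 * M) * (1 / (2 * M) * (M * ‖u‖ ^ 2)) := by gcongr
  have h5 : 1 / (2 * M) * (1 / (2 * M) * (M * ‖u‖ ^ 2)) = 1 / (4 * M) * ‖u‖ ^ 2 := by
    field_simp; ring
  have h6 : 1 / (2 * M) * ‖u‖ ^ 2 = 2 * (1 / (4 * M) * ‖u‖ ^ 2) := by field_simp; ring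
  linarith

end Lagrangian

/-! ### The quasipotential: concatenation, finiteness, control estimates -/

section Quasipotential

variable {n : ℕ}

variable {b : EuclideanSpace ℝ (Fin n) → EuclideanSpace ℝ (Fin n)}
  {D : Matrix (Fin n) (Fin n) ℝ} {Γ : Set (EuclideanSpace ℝ (Fin n))}

theorem quasipotential_le_action {T : ℝ} {ξ v : ℝ → EuclideanSpace ℝ (Fin n)} (hT : 0 < T)
    (h : IsACPath T ξ v)
    (h0 : ξ 0 ∈ Γ) : quasipotential b D Γ (ξ T) ≤ action b D T ξ v :=
  sInf_le ⟨T, ξ, v, hT, h, h0, rfl, rfl⟩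

theorem exists_action_lt {x : EuclideanSpace ℝ (Fin n)} {S : ℝ≥0∞}
    (h : quasipotential b D Γ x < S) :
    ∃ (T : ℝ) (ξ v : ℝ → EuclideanSpace ℝ (Fin n)), 0 < T ∧ IsACPath T ξ v ∧ ξ 0 ∈ Γ ∧ ξ T = x ∧ action b D T ξ v < S := by
  obtain ⟨_, ⟨T, ξ, v, hT, hac, h0, hx, rfl⟩, hlt⟩ := sInf_lt_iff.1 h
  exact ⟨T, ξ, v, hT, hac, h0, hx, hlt⟩

theorem isACPath_concat {T τ : ℝ} {ξ v η w : ℝ → EuclideanSpace ℝ (Fin n)} (hT : 0 < T) (hτ : 0 < τ)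
    (h : IsACPath T ξ v) (h' : IsACPath τ η w) (hj : η 0 = ξ T) :
    IsACPath (T + τ) (fun t => if t ≤ T then ξ t else η (t - T))
      (fun t => if t ≤ T then v t else w (t - T)) := by
  set z : ℝ → EuclideanSpace ℝ (Fin n) := fun t => if t ≤ T then v t else w (t - T) with hz
  have hz1 : ∀ t, t ≤ T → EqOn z v (uIcc 0 t) ∨ t < 0 := fun t ht => by
    rcases lt_or_ge t 0 with h0 | h0
    · exact Or.inr h0
    · refine Or.inl fun s hs => ?_
      rw [uIcc_of_le h0] at hs
      exact if_pos (hs.2.trans ht)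
  -- The half-open interval leaves out the junction T, where the concatenated derivative takes its
  -- value from v.
  have hz2 : ∀ t, T ≤ t → ∀ s ∈ uIoc T t, z s = w (s - T) := fun t ht s hs => by
    rw [uIoc_of_le ht] at hs
    exact if_neg (not_le.2 hs.1)
  have hi1 : IntervalIntegrable z volume 0 T :=
    h.1.congr fun s hs => ((hz1 T le_rfl).resolve_right (not_lt.2 hT.le)
      (uIoc_subset_uIcc hs)).symm
  have hi2 : ∀ t, T ≤ t → t ≤ T + τ → IntervalIntegrable z volume T t := fun t ht ht' => by
    have h1 := (h'.intervalIntegrable (s := 0) (t := t - T) ⟨le_rfl, hτ.le⟩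
      ⟨by linarith, by linarith⟩).comp_sub_right T
    rw [zero_add, sub_add_cancel] at h1
    exact h1.congr fun s hs => (hz2 t ht s hs).symm
  refine ⟨hi1.trans (hi2 _ (by linarith) le_rfl), fun t ht => ?_⟩
  simp only [hT.le, if_true]
  split_ifs with htT
  · rw [h.2 t ⟨ht.1, htT⟩]
    congr 1
    exact (intervalIntegral.integral_congr
      ((hz1 t htT).resolve_right (not_lt.2 ht.1))).symm
  · push Not at htT
    rw [← intervalIntegral.integral_add_adjacent_intervals hi1 (hi2 t htT.le ht.2),
      intervalIntegral.integral_congr ((hz1 T le_rfl).resolve_right (not_lt.2 hT.le)),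
      intervalIntegral.integral_congr_ae (Eventually.of_forall (hz2 t htT.le)),
      intervalIntegral.integral_comp_sub_right, sub_self, ← add_assoc,
      ← h.2 T ⟨hT.le, le_rfl⟩, ← hj, ← h'.2 (t - T) ⟨by linarith, by linarith [ht.2]⟩]

theorem action_concat_le {T τ : ℝ} {ξ v η w : ℝ → EuclideanSpace ℝ (Fin n)} :
    action b D (T + τ) (fun t => if t ≤ T then ξ t else η (t - T))
      (fun t => if t ≤ T then v t else w (t - T)) ≤ action b D T ξ v + action b D τ η w := by
  simp only [action_eq_lintegral]
  have hsub : Icc 0 (T + τ) ⊆ Icc 0 T ∪ Ioc T (T + τ) := fun s hs => by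
    rcases le_or_gt s T with h | h
    · exact Or.inl ⟨hs.1, h⟩
    · exact Or.inr ⟨h, hs.2⟩
  refine (lintegral_mono_set hsub).trans ((lintegral_union_le _ _ _).trans (add_le_add ?_ ?_))
  · refine (setLIntegral_congr_fun measurableSet_Icc fun s hs => ?_).le
    simp [hs.2]
  · have h1 : ∫⁻ s in Ioc T (T + τ), ENNReal.ofReal (lagrangian D
        ((if s ≤ T then v s else w (s - T)) - b (if s ≤ T then ξ s else η (s - T))))
        = ∫⁻ s in (fun s => s - T) ⁻¹' Ioc 0 τ, ENNReal.ofReal (lagrangian D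
          (w (s - T) - b (η (s - T)))) := by
      have : (fun s => s - T) ⁻¹' Ioc 0 τ = Ioc T (T + τ) := by
        ext s; simp [add_comm]
      rw [this]
      refine setLIntegral_congr_fun measurableSet_Ioc fun s hs => ?_
      simp [not_le.2 hs.1]
    rw [h1, (measurePreserving_sub_right volume T).setLIntegral_comp_preimage_emb
      (measurableEmbedding_subRight T)
      (fun s => ENNReal.ofReal (lagrangian D (w s - b (η s)))) (Ioc 0 τ)]
    exact lintegral_mono_set Ioc_subset_Icc_self

/-- Dynamic programming: an almost optimal path to η 0 is prolonged by η. -/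
theorem quasipotential_le_add {τ : ℝ} {η w : ℝ → EuclideanSpace ℝ (Fin n)} (hτ : 0 < τ)
    (h : IsACPath τ η w) :
    quasipotential b D Γ (η τ) ≤ quasipotential b D Γ (η 0) + action b D τ η w := by
  refine ENNReal.le_of_forall_pos_le_add fun e he hfin => ?_
  have hlt : quasipotential b D Γ (η 0) < quasipotential b D Γ (η 0) + e :=
    ENNReal.lt_add_right (ne_top_of_lt (lt_of_le_of_lt le_self_add hfin)) (by simpa using he.ne')
  obtain ⟨T, ξ, v, hT, hac, h0, hx, hS⟩ := exists_action_lt hlt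
  have h1 := quasipotential_le_action (b := b) (D := D) (Γ := Γ) (add_pos hT hτ)
    (isACPath_concat hT hτ hac h hx.symm) (by simpa [hT.le] using h0)
  have h2 : ¬ T + τ ≤ T := by linarith
  simp only [h2, if_false, add_sub_cancel_left] at h1
  calc _ ≤ _ := h1
    _ ≤ _ := action_concat_le
    _ ≤ (quasipotential b D Γ (η 0) + e) + action b D τ η w := by gcongr
    _ = _ := by ring

theorem isACPath_line (x v : EuclideanSpace ℝ (Fin n)) (τ : ℝ) : IsACPath τ (fun s => x + s • v)
    (fun _ => v) :=
  ⟨by simp, fun t _ => by simp⟩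

theorem action_le_of_forall_le {τ M : ℝ} {ξ v : ℝ → EuclideanSpace ℝ (Fin n)} (hτ : 0 ≤ τ)
    (h : ∀ s ∈ Icc 0 τ, lagrangian D (v s - b (ξ s)) ≤ M) :
    action b D τ ξ v ≤ ENNReal.ofReal (τ * M) := by
  rw [action_eq_lintegral]
  calc _ ≤ ∫⁻ _ in Icc 0 τ, ENNReal.ofReal M :=
        setLIntegral_mono measurable_const fun s hs => ENNReal.ofReal_le_ofReal (h s hs)
    _ = _ := by
        rw [setLIntegral_const, Real.volume_Icc, sub_zero, mul_comm, ENNReal.ofReal_mul hτ]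

/-- A straight segment traversed in unit time has finite action because b is bounded on it. Hence
`toReal` in `rateFunction` loses no information. -/
theorem quasipotential_ne_top (hb : Continuous b) (hΓ : Γ.Nonempty) (x : EuclideanSpace ℝ (Fin n)) :
    quasipotential b D Γ x ≠ ⊤ := by
  obtain ⟨g, hg⟩ := hΓ
  have hc : Continuous fun s : ℝ => lagrangian D ((x - g) - b (g + s • (x - g))) :=
    (continuous_lagrangian D).comp (by fun_prop)
  obtain ⟨M, hM⟩ := isCompact_Icc.bddAbove_image (hc.continuousOn (s := Icc (0 : ℝ) 1))
  have h1 := quasipotential_le_action (b := b) (D := D) (Γ := Γ) one_pos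
    (isACPath_line g (x - g) 1) (by simpa using hg)
  simp only [one_smul, add_sub_cancel] at h1
  exact ne_top_of_le_ne_top ENNReal.ofReal_ne_top (h1.trans (action_le_of_forall_le zero_le_one
    fun s hs => hM ⟨s, hs, rfl⟩))

theorem lintegral_lagrangian_split {T t : ℝ} {ξ v : ℝ → EuclideanSpace ℝ (Fin n)}
    (ht : t ∈ Icc 0 T) :
    action b D T ξ v = action b D t ξ v
      + ∫⁻ s in Ioc t T, ENNReal.ofReal (lagrangian D (v s - b (ξ s))) := by
  simp only [action_eq_lintegral]
  rw [← lintegral_union measurableSet_Ioc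
    (disjoint_left.2 fun s hs hs' => not_lt.2 hs.2 hs'.1), Icc_union_Ioc_eq_Icc ht.1 ht.2]

/-- Passing to the positive part of f permits negative values. Nothing is asked of g, whose integral
may be infinite, as the action of a path may be. -/
theorem ofReal_integral_le_lintegral {f : ℝ → ℝ} {g : ℝ → ℝ} {s t : ℝ} (hst : s ≤ t)
    (hf : IntervalIntegrable f volume s t) (h : ∀ r ∈ Ioc s t, f r ≤ g r) :
    ENNReal.ofReal (∫ r in s..t, f r) ≤ ∫⁻ r in Ioc s t, ENNReal.ofReal (g r) := by
  rw [intervalIntegral.integral_of_le hst]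
  rw [intervalIntegrable_iff, uIoc_of_le hst] at hf
  calc _ ≤ ENNReal.ofReal (∫ r in Ioc s t, max (f r) 0) :=
        ENNReal.ofReal_le_ofReal (integral_mono hf hf.pos_part fun r => le_max_left _ _)
    _ = ∫⁻ r in Ioc s t, ENNReal.ofReal (max (f r) 0) :=
        ofReal_integral_eq_lintegral_ofReal hf.pos_part (Eventually.of_forall fun r =>
          le_max_right _ _)
    _ ≤ _ := setLIntegral_mono' measurableSet_Ioc fun r hr => by
        rw [ENNReal.ofReal_max, ENNReal.ofReal_zero, max_eq_left zero_le]
        exact ENNReal.ofReal_le_ofReal (h r hr)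

theorem integrable_control {T : ℝ} {ξ v : ℝ → EuclideanSpace ℝ (Fin n)} (h : IsACPath T ξ v)
    (hb : Continuous b)
    {s t : ℝ} (hs : 0 ≤ s) (hst : s ≤ t) (ht : t ≤ T) :
    IntervalIntegrable (fun r => v r - b (ξ r)) volume s t := by
  refine (h.intervalIntegrable ⟨hs, hst.trans ht⟩ ⟨hs.trans hst, ht⟩).sub
    (ContinuousOn.intervalIntegrable ?_)
  rw [uIcc_of_le hst]
  exact hb.comp_continuousOn ((h.continuousOn (hs.trans (hst.trans ht))).mono
    (Icc_subset_Icc hs ht))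

/-- A small action makes the control small in `L¹`. -/
theorem integral_norm_control_le {T : ℝ} {ξ v : ℝ → EuclideanSpace ℝ (Fin n)} (h : IsACPath T ξ v)
    (hb : Continuous b)
    {l : ℝ} (hl : 0 < l) (hlD : ∀ u : EuclideanSpace ℝ (Fin n), l * ‖u‖ ^ 2 ≤ lagrangian D u)
    {s t a m : ℝ} (hs : 0 ≤ s) (hst : s ≤ t) (ht : t ≤ T) (ha : 0 ≤ a) (hm : 0 < m)
    (hS : ∫⁻ r in Ioc s t, ENNReal.ofReal (lagrangian D (v r - b (ξ r))) ≤ ENNReal.ofReal a) :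
    ∫ r in s..t, ‖v r - b (ξ r)‖ ≤ a / (2 * l * m) + m * (t - s) / 2 := by
  have hint := (integrable_control h hb hs hst ht).norm.const_mul m
  -- Young's inequality combined with coercivity. The free parameter m is tuned by each caller to
  -- balance action against elapsed time.
  have hpt : ∀ u : EuclideanSpace ℝ (Fin n), m * ‖u‖ ≤ 1 / (2 * l) * lagrangian D u + m ^ 2 / 2 := fun u => by
    have h1 : 1 / (2 * l) * (l * ‖u‖ ^ 2) ≤ 1 / (2 * l) * lagrangian D u := by
      gcongr; exact hlD u
    have h2 : 1 / (2 * l) * (l * ‖u‖ ^ 2) = ‖u‖ ^ 2 / 2 := by field_simp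
    nlinarith [sq_nonneg (m - ‖u‖)]
  have h1 := ofReal_integral_le_lintegral hst hint (fun r _ => hpt (v r - b (ξ r)))
  have hl0 : 0 ≤ 1 / (2 * l) := by positivity
  have h4 : 0 ≤ t - s := by linarith
  have h2 : ∫⁻ r in Ioc s t, ENNReal.ofReal (1 / (2 * l) * lagrangian D (v r - b (ξ r)) + m ^ 2 / 2)
      ≤ ENNReal.ofReal (m * (a / (2 * l * m) + m * (t - s) / 2)) := by
    calc _ ≤ ∫⁻ r in Ioc s t, (ENNReal.ofReal (1 / (2 * l))
            * ENNReal.ofReal (lagrangian D (v r - b (ξ r))) + ENNReal.ofReal (m ^ 2 / 2)) := by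
          refine lintegral_mono fun r => ?_
          refine ENNReal.ofReal_add_le.trans ?_
          rw [ENNReal.ofReal_mul hl0]
      _ = ENNReal.ofReal (1 / (2 * l)) * (∫⁻ r in Ioc s t, ENNReal.ofReal (lagrangian D
            (v r - b (ξ r)))) + ENNReal.ofReal (m ^ 2 / 2) * ENNReal.ofReal (t - s) := by
          rw [lintegral_add_right _ measurable_const, lintegral_const_mul' _ _ ENNReal.ofReal_ne_top,
            setLIntegral_const, Real.volume_Ioc]
      _ ≤ ENNReal.ofReal (1 / (2 * l)) * ENNReal.ofReal a
            + ENNReal.ofReal (m ^ 2 / 2) * ENNReal.ofReal (t - s) := by gcongr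
      _ = _ := by
          rw [← ENNReal.ofReal_mul hl0, ← ENNReal.ofReal_mul (by positivity),
            ← ENNReal.ofReal_add (by positivity) (by positivity)]
          congr 1; field_simp
  have h3 := h1.trans h2
  rw [ENNReal.ofReal_le_ofReal_iff (by positivity), intervalIntegral.integral_const_mul] at h3
  exact le_of_mul_le_mul_left h3 hm

end Quasipotential

/-! ### The Hamilton-Jacobi equation for the quasipotential -/

section HamiltonJacobi

variable {n : ℕ}

/-- The vector of partial derivatives of `f` at `y`. -/
noncomputable def partials (f : EuclideanSpace ℝ (Fin n) → ℝ)
    (y : EuclideanSpace ℝ (Fin n)) : Fin n → ℝ :=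
  fun i => fderiv ℝ f y (EuclideanSpace.single i 1)

theorem clm_apply_eq_sum {G : Type*} [NormedAddCommGroup G] [NormedSpace ℝ G]
    (L : EuclideanSpace ℝ (Fin n) →L[ℝ] G) (u : EuclideanSpace ℝ (Fin n)) : L u = ∑ i, u i • L
    (EuclideanSpace.single i 1) := by
  conv_lhs => rw [← (EuclideanSpace.basisFun (Fin n) ℝ).sum_repr u]
  simp

theorem fderiv_eq_partials_dotProduct (f : EuclideanSpace ℝ (Fin n) → ℝ)
    (y u : EuclideanSpace ℝ (Fin n)) :
    fderiv ℝ f y u = partials f y ⬝ᵥ u.ofLp := by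
  rw [clm_apply_eq_sum]
  simp [partials, dotProduct, mul_comm]

/-- The Hamiltonian `⟨b, ∇f⟩ + ⟨∇f, D ∇f⟩`. -/
noncomputable def hamiltonian (b : EuclideanSpace ℝ (Fin n) → EuclideanSpace ℝ (Fin n))
    (D : Matrix (Fin n) (Fin n) ℝ) (f : EuclideanSpace ℝ (Fin n) → ℝ)
        (y : EuclideanSpace ℝ (Fin n)) : ℝ :=
  fderiv ℝ f y (b y) + partials f y ⬝ᵥ D.mulVec (partials f y)

variable {b : EuclideanSpace ℝ (Fin n) → EuclideanSpace ℝ (Fin n)}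
  {D : Matrix (Fin n) (Fin n) ℝ} {Γ 𝒟 : Set (EuclideanSpace ℝ (Fin n))}
  {φ : EuclideanSpace ℝ (Fin n) → ℝ}

theorem continuousOn_partials (h𝒟 : IsOpen 𝒟) (hφ : ContDiffOn ℝ 1 φ 𝒟) :
    ContinuousOn (partials φ) 𝒟 :=
  continuousOn_pi.2 fun _ => (hφ.continuousOn_fderiv_of_isOpen h𝒟 le_rfl).clm_apply
    continuousOn_const

theorem continuousOn_hamiltonian (h𝒟 : IsOpen 𝒟) (hb : Continuous b) (hφ : ContDiffOn ℝ 1 φ 𝒟) :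
    ContinuousOn (hamiltonian b D φ) 𝒟 := by
  have h1 := continuousOn_partials h𝒟 hφ
  have h2 : ContinuousOn (fun y => fderiv ℝ φ y (b y)) 𝒟 :=
    (hφ.continuousOn_fderiv_of_isOpen h𝒟 le_rfl).clm_apply hb.continuousOn
  have h3 : Continuous fun p : Fin n → ℝ => p ⬝ᵥ D.mulVec p := by
    unfold Matrix.mulVec dotProduct; fun_prop
  exact h2.add (h3.comp_continuousOn h1)

/-- Along the segment s ↦ x + s v, dynamic programming bounds the increment of φ over [0, h] by hM
for any M above the Lagrangian at s = 0. Dividing by h and letting h → 0 gives the slope. -/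
theorem fderiv_le_lagrangian (hD : D.PosDef) (h𝒟 : IsOpen 𝒟) (hb : Continuous b) (hΓ : Γ.Nonempty)
    (hφ : ∀ y ∈ 𝒟, φ y = rateFunction b D Γ y) (hφ1 : ContDiffOn ℝ 1 φ 𝒟)
    {x : EuclideanSpace ℝ (Fin n)} (hx : x ∈ 𝒟)
    (v : EuclideanSpace ℝ (Fin n)) : fderiv ℝ φ x v ≤ lagrangian D (v - b x) := by
  refine le_of_forall_gt_imp_ge_of_dense fun M hM => ?_
  have hline : Continuous fun h : ℝ => x + h • v := by fun_prop
  have hd : HasDerivAt (fun h : ℝ => φ (x + h • v)) (fderiv ℝ φ x v) 0 := by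
    have h1 : HasDerivAt (fun h : ℝ => x + h • v) v 0 := by
      simpa using ((hasDerivAt_id (0 : ℝ)).smul_const v).const_add x
    have h2 : HasFDerivAt φ (fderiv ℝ φ x) (x + (0 : ℝ) • v) := by
      simpa using ((hφ1.contDiffAt (h𝒟.mem_nhds hx)).differentiableAt one_ne_zero).hasFDerivAt
    exact h2.comp_hasDerivAt 0 h1
  have hs := hd.tendsto_slope_zero_right
  refine le_of_tendsto hs ?_
  have h1 : ∀ᶠ s in 𝓝 (0 : ℝ), lagrangian D (v - b (x + s • v)) < M := by
    have hc : Continuous fun s : ℝ => lagrangian D (v - b (x + s • v)) :=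
      (continuous_lagrangian D).comp (by fun_prop)
    exact hc.continuousAt.eventually_lt continuousAt_const (by simpa using hM)
  have h2 : ∀ᶠ s in 𝓝 (0 : ℝ), x + s • v ∈ 𝒟 :=
    hline.continuousAt.eventually_mem (h𝒟.mem_nhds (by simpa using hx))
  obtain ⟨e, he, hball⟩ := Metric.eventually_nhds_iff.1 (h1.and h2)
  filter_upwards [Ioo_mem_nhdsGT he] with h hh
  have hin : ∀ s ∈ Icc 0 h, lagrangian D (v - b (x + s • v)) < M ∧ x + s • v ∈ 𝒟 := fun s hs =>
    hball (by rw [Real.dist_eq, sub_zero, abs_of_nonneg hs.1]; exact hs.2.trans_lt hh.2)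
  have h3 := (quasipotential_le_add (b := b) (D := D) (Γ := Γ) hh.1 (isACPath_line x v h)).trans
    (add_le_add_right (action_le_of_forall_le hh.1.le fun s hs => (hin s hs).1.le) _)
  have hhM : 0 ≤ h * M := mul_nonneg hh.1.le ((lagrangian_nonneg hD _).trans hM.le)
  simp only [zero_smul, add_zero] at h3
  have h4 := ENNReal.toReal_mono (ENNReal.add_ne_top.2
    ⟨quasipotential_ne_top hb hΓ x, ENNReal.ofReal_ne_top⟩) h3
  rw [ENNReal.toReal_add (quasipotential_ne_top hb hΓ x) ENNReal.ofReal_ne_top,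
    ENNReal.toReal_ofReal hhM, ← rateFunction_eq_toReal, ← rateFunction_eq_toReal,
    ← hφ x hx, ← hφ _ (hin h ⟨hh.1.le, le_rfl⟩).2] at h4
  rw [zero_add, zero_smul, add_zero, smul_eq_mul, inv_mul_le_iff₀ hh.1]
  linarith

/-- The bound on directional derivatives is sharpest at v = b + 2D∇φ, where the Lagrangian equals
⟨∇φ, D∇φ⟩. -/
theorem hamiltonian_nonpos (hD : D.PosDef) (h𝒟 : IsOpen 𝒟) (hb : Continuous b) (hΓ : Γ.Nonempty)
    (hφ : ∀ y ∈ 𝒟, φ y = rateFunction b D Γ y) (hφ1 : ContDiffOn ℝ 1 φ 𝒟)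
    {x : EuclideanSpace ℝ (Fin n)} (hx : x ∈ 𝒟) :
    hamiltonian b D φ x ≤ 0 := by
  have h := fderiv_le_lagrangian hD h𝒟 hb hΓ hφ hφ1 hx
    (b x + WithLp.toLp 2 ((2 : ℝ) • D.mulVec (partials φ x)))
  rw [add_sub_cancel_left, lagrangian_two_smul_mulVec hD, map_add,
    fderiv_eq_partials_dotProduct φ x (WithLp.toLp 2 ((2 : ℝ) • D.mulVec (partials φ x)))] at h
  simp only [dotProduct_smul, smul_eq_mul] at h
  unfold hamiltonian
  linarith

/-- The Fenchel inequality at p = ∇φ. Where the Hamiltonian is below -η, a path pays more than the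
increment of φ, by η per unit of time. -/
theorem fderiv_le_lagrangian_add_hamiltonian (hD : D.PosDef) (x v : EuclideanSpace ℝ (Fin n)) :
    fderiv ℝ φ x v ≤ lagrangian D (v - b x) + hamiltonian b D φ x := by
  have h := dotProduct_le_lagrangian_add hD (partials φ x) (v - b x)
  rw [← fderiv_eq_partials_dotProduct, map_sub] at h
  unfold hamiltonian
  linarith

/-- Suppose the Hamiltonian is below -η on a ball around x disjoint from Γ. An almost optimal path
to x has bounded action, so it cannot cross the ball arbitrarily fast. The extra cost paid inside is
at least η times a crossing time τ₀ that does not depend on the path, which exceeds the allowed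
error δ. -/
theorem hamiltonian_nonneg (hD : D.PosDef) (h𝒟 : IsOpen 𝒟) (hb : Continuous b)
    (hΓ : Γ.Nonempty) (hΓc : IsClosed Γ)
    (hφ : ∀ y ∈ 𝒟, φ y = rateFunction b D Γ y) (hφ1 : ContDiffOn ℝ 1 φ 𝒟)
    {x : EuclideanSpace ℝ (Fin n)} (hx : x ∈ 𝒟)
    (hxΓ : x ∉ Γ) : 0 ≤ hamiltonian b D φ x := by
  by_contra! hneg
  obtain ⟨η, hη, hηH⟩ : ∃ η, 0 < η ∧ hamiltonian b D φ x < -η :=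
    ⟨-hamiltonian b D φ x / 2, by linarith, by linarith⟩
  have hev : ∀ᶠ y in 𝓝 x, y ∈ 𝒟 ∧ y ∉ Γ ∧ hamiltonian b D φ y < -η :=
    (h𝒟.eventually_mem hx).and ((hΓc.isOpen_compl.eventually_mem hxΓ).and
      (((continuousOn_hamiltonian h𝒟 hb hφ1).continuousAt (h𝒟.mem_nhds hx)).eventually_lt
        continuousAt_const hηH))
  obtain ⟨r, hr, hball⟩ := Metric.nhds_basis_closedBall.eventually_iff.1 hev
  obtain ⟨B, hB⟩ := (isCompact_closedBall x r).exists_bound_of_continuousOn hb.continuousOn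
  have hB0 : 0 ≤ B := (norm_nonneg _).trans (hB x (Metric.mem_closedBall_self hr.le))
  obtain ⟨l, hl, hlD⟩ := exists_le_lagrangian hD
  have hφ0 : ∀ y ∈ 𝒟, 0 ≤ φ y := fun y hy => by rw [hφ y hy]; exact ENNReal.toReal_nonneg
  have hV : ∀ y ∈ 𝒟, quasipotential b D Γ y = ENNReal.ofReal (φ y) := fun y hy => by
    rw [hφ y hy, rateFunction_eq_toReal, ENNReal.ofReal_toReal (quasipotential_ne_top hb hΓ y)]
  set a := φ x + 1 with ha
  have ha0 : 0 < a := by linarith [hφ0 x hx]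
  -- With this m the action term a/(2lm) of the control estimate is r/2, half of the distance to be
  -- covered.
  set m := a / (l * r) with hm
  have hm0 : 0 < m := by positivity
  -- The remaining r/2 is covered at speed at most m/2 + B, where B bounds the drift on the ball.
  set τ₀ := r / (2 * (m / 2 + B)) with hτ₀
  have hτ₀0 : 0 < τ₀ := by positivity
  set δ := min 1 (η * τ₀) with hδ
  have hδ0 : 0 < δ := lt_min one_pos (by positivity)
  obtain ⟨T, ξ, v, hT, hac, h0, hxT, hS⟩ := exists_action_lt (b := b) (D := D) (Γ := Γ)
    (x := x) (S := ENNReal.ofReal (φ x + δ)) (by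
      rw [hV x hx]
      exact (ENNReal.ofReal_lt_ofReal_iff (by linarith [hφ0 x hx])).2 (by linarith))
  have hcont := hac.continuousOn hT.le
  -- Only the part of the path after its last entry into the ball is compared with φ. The earlier
  -- part costs at least φ(ξ t).
  obtain ⟨t, ht, htr, hle⟩ := exists_last_hit (f := fun s => dist (ξ s) x) (r := r) hT.le
    (continuous_dist.comp_continuousOn (hcont.prodMk continuousOn_const)) (by
      by_contra! hlt
      exact (hball (Metric.mem_closedBall.2 hlt.le)).2.1 h0) (by simp [hxT, hr.le])
  -- Positivity matters because the quasipotential admits only paths of positive duration.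
  have ht0 : 0 < t := lt_of_le_of_ne ht.1 fun h => by
    subst h
    exact (hball (Metric.mem_closedBall.2 htr.le)).2.1 h0
  have hin : ∀ s ∈ Icc t T, ξ s ∈ Metric.closedBall x r := fun s hs => hle s hs
  have hsplit := lintegral_lagrangian_split (b := b) (D := D) (ξ := ξ) (v := v) ht
  have hSa : ∫⁻ s in Ioc t T, ENNReal.ofReal (lagrangian D (v s - b (ξ s)))
      ≤ ENNReal.ofReal a := by
    refine (le_add_self.trans hsplit.ge).trans (hS.le.trans (ENNReal.ofReal_le_ofReal ?_))
    linarith [min_le_left (1 : ℝ) (η * τ₀)]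
  have hu := integral_norm_control_le hac hb hl hlD ht.1 ht.2 le_rfl ha0.le hm0 hSa
  have htI : t ∈ Icc 0 T := ht
  have hTI : T ∈ Icc 0 T := ⟨hT.le, le_rfl⟩
  have hctl := integrable_control hac hb ht.1 ht.2 le_rfl
  have hbint : IntervalIntegrable (fun s => b (ξ s)) volume t T :=
    ContinuousOn.intervalIntegrable (by
      rw [uIcc_of_le ht.2]
      exact hb.comp_continuousOn (hcont.mono (Icc_subset_Icc_left ht.1)))
  have hrle : r ≤ (∫ s in t..T, ‖v s - b (ξ s)‖) + B * (T - t) := by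
    have e1 : ξ T - ξ t = (∫ s in t..T, (v s - b (ξ s))) + ∫ s in t..T, b (ξ s) := by
      rw [hac.sub_eq_integral htI hTI, ← intervalIntegral.integral_add hctl hbint]
      simp
    have e2 : r = ‖ξ T - ξ t‖ := by rw [← htr, hxT, dist_comm, dist_eq_norm]
    rw [e2, e1]
    refine (norm_add_le _ _).trans (add_le_add
      (intervalIntegral.norm_integral_le_integral_norm ht.2) ?_)
    refine (intervalIntegral.norm_integral_le_of_norm_le_const (C := B) fun s hs => ?_).trans ?_
    · rw [uIoc_of_le ht.2] at hs
      exact hB _ (hin s ⟨hs.1.le, hs.2⟩)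
    · rw [abs_of_nonneg (by linarith [ht.2])]
  have hτ : τ₀ ≤ T - t := by
    have e1 : a / (2 * l * m) = r / 2 := by rw [hm]; field_simp
    rw [hτ₀, div_le_iff₀ (by positivity)]
    nlinarith
  have hlow : ENNReal.ofReal (φ x - φ (ξ t) + η * (T - t))
      ≤ ∫⁻ s in Ioc t T, ENNReal.ofReal (lagrangian D (v s - b (ξ s))) := by
    have hi := hac.integrable_fderiv ht.1 ht.2 le_rfl h𝒟 hφ1 fun s hs => (hball (hin s hs)).1
    have h1 := ofReal_integral_le_lintegral (g := fun s => lagrangian D (v s - b (ξ s))) ht.2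
      (hi.add (intervalIntegrable_const (c := η))) fun s hs => by
        have h2 := fderiv_le_lagrangian_add_hamiltonian (b := b) (φ := φ) hD (ξ s) (v s)
        have h3 := (hball (hin s ⟨hs.1.le, hs.2⟩)).2.2
        linarith
    rw [intervalIntegral.integral_add hi intervalIntegrable_const,
      hac.integral_fderiv ht.1 ht.2 le_rfl h𝒟 hφ1 (fun s hs => (hball (hin s hs)).1),
      intervalIntegral.integral_const, hxT, smul_eq_mul, mul_comm (T - t)] at h1
    exact h1
  have hVt : ENNReal.ofReal (φ (ξ t)) ≤ action b D t ξ v := by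
    rw [← hV (ξ t) (hball (hin t ⟨le_rfl, ht.2⟩)).1]
    exact quasipotential_le_action ht0 (hac.mono ht) h0
  have hfin : ENNReal.ofReal (φ x + η * (T - t)) < ENNReal.ofReal (φ x + δ) := by
    calc _ = ENNReal.ofReal (φ (ξ t) + (φ x - φ (ξ t) + η * (T - t))) := by congr 1; ring
      _ ≤ _ := ENNReal.ofReal_add_le
      _ ≤ _ := add_le_add hVt hlow
      _ = _ := hsplit.symm
      _ < _ := hS
  rw [ENNReal.ofReal_lt_ofReal_iff (by linarith [hφ0 x hx])] at hfin
  have h1 : δ ≤ η * τ₀ := min_le_right _ _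
  have h2 : η * τ₀ ≤ η * (T - t) := by gcongr
  linarith

/-- The solution itself has zero action. Starting one time unit earlier on the orbit supplies a path
of positive duration. -/
theorem quasipotential_eq_zero_of_mem_range {p : ℝ → EuclideanSpace ℝ (Fin n)} (hb : Continuous b)
    (hp : ∀ t, HasDerivAt p (b (p t)) t) (hΓ : Γ = range p) {y : EuclideanSpace ℝ (Fin n)}
    (hy : y ∈ Γ) :
    quasipotential b D Γ y = 0 := by
  obtain ⟨t, rfl⟩ := hΓ ▸ hy
  have hpc : Continuous p := continuous_iff_continuousAt.2 fun t => (hp t).continuousAt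
  have hpath : IsACPath 1 (fun s => p (t - 1 + s)) (fun s => b (p (t - 1 + s))) := by
    have hc : Continuous fun s => b (p (t - 1 + s)) := by fun_prop
    refine ⟨hc.intervalIntegrable _ _, fun s _ => ?_⟩
    rw [intervalIntegral.integral_eq_sub_of_hasDerivAt (f := fun s => p (t - 1 + s))
      (fun r _ => (hp (t - 1 + r)).comp_const_add (t - 1) r) (hc.intervalIntegrable _ _)]
    abel
  have h := quasipotential_le_action (b := b) (D := D) (Γ := Γ) one_pos hpath
    (by rw [hΓ]; exact ⟨_, rfl⟩)
  rw [sub_add_cancel, action_eq_lintegral] at h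
  simpa [lagrangian] using h

theorem rateFunction_eq_zero_of_mem (hb : Continuous b) (hΓ : IsPeriodicOrbit b Γ)
    {y : EuclideanSpace ℝ (Fin n)} (hy : y ∈ Γ) : rateFunction b D Γ y = 0 := by
  obtain ⟨p, T, -, hp, -, -, hΓp⟩ := hΓ
  rw [rateFunction_eq_toReal, quasipotential_eq_zero_of_mem_range hb
    (fun t => (hp t (mem_univ t)).hasDerivAt univ_mem) hΓp hy, ENNReal.toReal_zero]

theorem fderiv_eq_zero_of_mem (h𝒟 : IsOpen 𝒟) (hΓ𝒟 : Γ ⊆ 𝒟) (hb : Continuous b)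
    (hΓ : IsPeriodicOrbit b Γ) (hφ : ∀ y ∈ 𝒟, φ y = rateFunction b D Γ y)
    {y : EuclideanSpace ℝ (Fin n)} (hy : y ∈ Γ) : fderiv ℝ φ y = 0 := by
  refine IsLocalMin.fderiv_eq_zero ?_
  filter_upwards [h𝒟.mem_nhds (hΓ𝒟 hy)] with z hz
  rw [hφ y (hΓ𝒟 hy), hφ z hz, rateFunction_eq_zero_of_mem hb hΓ hy]
  exact ENNReal.toReal_nonneg

/-- The quasipotential solves the Hamilton-Jacobi equation. -/
theorem hamiltonian_eq_zero (hD : D.PosDef) (h𝒟 : IsOpen 𝒟) (hΓ𝒟 : Γ ⊆ 𝒟) (hb : Continuous b)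
    (hΓ : IsPeriodicOrbit b Γ) (hΓc : IsClosed Γ)
    (hφ : ∀ y ∈ 𝒟, φ y = rateFunction b D Γ y) (hφ1 : ContDiffOn ℝ 1 φ 𝒟)
    {x : EuclideanSpace ℝ (Fin n)} (hx : x ∈ 𝒟) :
    hamiltonian b D φ x = 0 := by
  have hΓne : Γ.Nonempty := by
    obtain ⟨p, T, -, -, -, -, rfl⟩ := hΓ
    exact range_nonempty p
  by_cases hxΓ : x ∈ Γ
  · have h := fderiv_eq_zero_of_mem h𝒟 hΓ𝒟 hb hΓ hφ hxΓ
    have hp : partials φ x = 0 := by ext i; simp [partials, h]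
    simp [hamiltonian, h, hp]
  · exact le_antisymm (hamiltonian_nonpos hD h𝒟 hb hΓne hφ hφ1 hx)
      (hamiltonian_nonneg hD h𝒟 hb hΓne hΓc hφ hφ1 hx hxΓ)

end HamiltonJacobi

/-! ### The stable cycle: tubes, trajectories, quadratic growth -/

section Cycle

variable {n : ℕ} {b : EuclideanSpace ℝ (Fin n) → EuclideanSpace ℝ (Fin n)}
  {D : Matrix (Fin n) (Fin n) ℝ} {Γ 𝒟 : Set (EuclideanSpace ℝ (Fin n))}
  {φ : EuclideanSpace ℝ (Fin n) → ℝ}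

/-- Each component is extended with a Lipschitz constant and then truncated at a bound of ‖b‖ on U,
which changes nothing on U. Solutions of the extended field exist on any time interval and solve the
original equation while they stay in U. -/
theorem exists_bounded_lipschitz_extension {U : Set (EuclideanSpace ℝ (Fin n))} {K : NNReal}
    (hU : IsCompact U)
    (hK : LipschitzOnWith K b U) :
    ∃ (g : EuclideanSpace ℝ (Fin n) → EuclideanSpace ℝ (Fin n)) (K' : NNReal) (B : ℝ), LipschitzWith K' g ∧ (∀ y, ‖g y‖ ≤ B) ∧ EqOn g b U := by
  obtain ⟨g, hg, hgb⟩ := LipschitzOnWith.extend_pi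
    ((PiLp.lipschitzWith_ofLp 2 (fun _ : Fin n => ℝ)).comp_lipschitzOnWith hK)
  obtain ⟨R, hR⟩ := hU.exists_bound_of_continuousOn hK.continuousOn
  set R' := max R 0 with hR'
  have hR'0 : 0 ≤ R' := le_max_right _ _
  set f : EuclideanSpace ℝ (Fin n) → (Fin n → ℝ) := fun y i => max (-R') (min R' (g y i)) with hf
  have hfl : LipschitzWith (1 * (1 * K)) f := by
    refine LipschitzWith.of_dist_le_mul fun y z => (dist_pi_le_iff (by positivity)).2 fun i => ?_
    exact ((((LipschitzWith.eval i).comp hg).const_min R').const_max (-R')).dist_le_mul y z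
  have hl := (PiLp.lipschitzWith_toLp 2 (fun _ : Fin n => ℝ)).comp hfl
  have hfb : ∀ y i, ‖f y i‖ ≤ R' := fun y i => by
    rw [Real.norm_eq_abs, abs_le]
    exact ⟨le_max_left _ _, max_le (by linarith) (min_le_left _ _)⟩
  refine ⟨_, _, ∑ _i : Fin n, R', hl, fun y => ?_, fun y hy => ?_⟩
  · simp only [Function.comp_apply]
    rw [← (EuclideanSpace.basisFun (Fin n) ℝ).sum_repr (WithLp.toLp 2 (f y))]
    refine (norm_sum_le _ _).trans (Finset.sum_le_sum fun i _ => ?_)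
    rw [norm_smul, (EuclideanSpace.basisFun (Fin n) ℝ).norm_eq_one, mul_one]
    exact hfb y i
  · ext i
    have h1 : g y i = b y i := by rw [← hgb hy]; rfl
    have h2 : |b y i| ≤ R' := by
      rw [← Real.norm_eq_abs]
      exact (PiLp.norm_apply_le (b y) i).trans ((hR y hy).trans (le_max_left _ _))
    rw [abs_le] at h2
    simp only [Function.comp_apply, hf, h1, min_eq_right h2.2, max_eq_right h2.1]

theorem IsPeriodicOrbit.isCompact (hΓ : IsPeriodicOrbit b Γ) : IsCompact Γ := by
  obtain ⟨p, T, hT, hp, hper, -, rfl⟩ := hΓ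
  rw [← Function.Periodic.image_Icc (f := p) hper hT 0]
  refine isCompact_Icc.image (continuous_iff_continuousAt.2 fun t => ?_)
  exact ((hp t (mem_univ t)).hasDerivAt univ_mem).continuousAt

theorem IsPeriodicOrbit.nonempty (hΓ : IsPeriodicOrbit b Γ) : Γ.Nonempty := by
  obtain ⟨p, T, -, -, -, -, rfl⟩ := hΓ
  exact range_nonempty p

theorem cthickening_eq_setOf_infDist_le (hΓ : Γ.Nonempty) {r : ℝ} (hr : 0 ≤ r) :
    Metric.cthickening r Γ = {y | Metric.infDist y Γ ≤ r} := by
  ext y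
  exact ENNReal.le_ofReal_iff_toReal_le (Metric.infEDist_ne_top hΓ) hr

/-- A compact tube around `Γ` on which `b` is Lipschitz. -/
theorem exists_lipschitz_tube (h𝒟 : IsOpen 𝒟) (hΓ𝒟 : Γ ⊆ 𝒟) (hb𝒟 : ContDiffOn ℝ 1 b 𝒟)
    (hΓ : IsPeriodicOrbit b Γ) :
    ∃ (r : ℝ) (K : NNReal), 0 < r ∧ {y | Metric.infDist y Γ ≤ r} ⊆ 𝒟 ∧
      IsCompact {y | Metric.infDist y Γ ≤ r} ∧
      LipschitzOnWith K b {y | Metric.infDist y Γ ≤ r} := by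
  obtain ⟨r, hr, hsub⟩ := hΓ.isCompact.exists_cthickening_subset_open h𝒟 hΓ𝒟
  have hc : IsCompact (Metric.cthickening r Γ) := hΓ.isCompact.cthickening
  obtain ⟨K, hK⟩ := LocallyLipschitzOn.exists_lipschitzOnWith_of_compact hc
    (locallyLipschitzOn_of_contDiffOn_isOpen h𝒟 hb𝒟 hsub)
  rw [cthickening_eq_setOf_infDist_le hΓ.nonempty hr.le] at hsub hc hK
  exact ⟨r, K, hr, hsub, hc, hK⟩

/-- Solutions that start near a stable cycle exist for all times and stay near it. -/
theorem exists_trajectory_near {r : ℝ} {K : NNReal} (hr : 0 < r)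
    (hUc : IsCompact {y | Metric.infDist y Γ ≤ r})
    (hK : LipschitzOnWith K b {y | Metric.infDist y Γ ≤ r}) {δ C c : ℝ} (hδ : 0 < δ) (hc : 0 < c)
    (hstab : ∀ (T : ℝ) (x : ℝ → EuclideanSpace ℝ (Fin n)), 0 ≤ T → IsTrajectoryOn b x (Icc 0 T) →
      Metric.infDist (x 0) Γ < δ →
      ∀ t ∈ Icc 0 T, Metric.infDist (x t) Γ ≤ C * Real.exp (-c * t) * Metric.infDist (x 0) Γ) :
    ∃ ρ, 0 < ρ ∧ ρ ≤ r ∧ ρ < δ ∧ ∀ (y₀ : EuclideanSpace ℝ (Fin n)) (τ : ℝ), 0 ≤ τ → Metric.infDist y₀ Γ ≤ ρ →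
      ∃ y : ℝ → EuclideanSpace ℝ (Fin n), y 0 = y₀ ∧ IsTrajectoryOn b y (Icc 0 τ) ∧
        ∀ t ∈ Icc 0 τ, Metric.infDist (y t) Γ ≤ r := by
  set C' := max C 1 with hC'
  have hC'1 : 1 ≤ C' := le_max_right _ _
  obtain ⟨g, K', B, hg, hB, hgb⟩ := exists_bounded_lipschitz_extension hUc hK
  -- Starting within r/(2C') leaves a factor 2 of room: the stability estimate keeps the distance
  -- below r/2.
  refine ⟨min (δ / 2) (r / (2 * C')), by positivity, ?_, ?_, fun y₀ τ hτ hy₀ => ?_⟩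
  · refine (min_le_right _ _).trans ?_
    rw [div_le_iff₀ (by positivity)]
    nlinarith
  · exact (min_le_left _ _).trans_lt (by linarith)
  have hy1 : Metric.infDist y₀ Γ < δ := (hy₀.trans (min_le_left _ _)).trans_lt (by linarith)
  have hy2 : C' * Metric.infDist y₀ Γ < r := by
    have h1 : C' * Metric.infDist y₀ Γ ≤ C' * (r / (2 * C')) := by
      gcongr; exact hy₀.trans (min_le_right _ _)
    have h2 : C' * (r / (2 * C')) = r / 2 := by field_simp
    linarith
  have hy0 : 0 ≤ Metric.infDist y₀ Γ := Metric.infDist_nonneg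
  obtain ⟨y, hyy, hy⟩ := exists_solution_of_lipschitz_bounded hg hB y₀ hτ
  have hycont : ContinuousOn y (Icc 0 τ) := fun t ht => (hy t ht).continuousWithinAt
  have htraj : ∀ T ∈ Icc 0 τ, (∀ t ∈ Icc 0 T, Metric.infDist (y t) Γ ≤ r) →
      IsTrajectoryOn b y (Icc 0 T) := fun T hT h t ht => by
    rw [← hgb (h t ht)]
    exact (hy t ⟨ht.1, ht.2.trans hT.2⟩).mono (Icc_subset_Icc_right hT.2)
  have hin : ∀ t ∈ Icc 0 τ, Metric.infDist (y t) Γ ≤ r := by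
    by_contra! hne
    obtain ⟨t, ht, hlt⟩ := hne
    have hfc : ContinuousOn (fun s => Metric.infDist (y s) Γ) (Icc 0 t) :=
      (Metric.continuous_infDist_pt Γ).comp_continuousOn (hycont.mono (Icc_subset_Icc_right ht.2))
    -- Until the first time at distance r, the solution of the extended field solves the original
    -- equation. Stability applies up to that time and contradicts reaching r.
    obtain ⟨s, hs, hsr, hsle⟩ := exists_first_hit ht.1 hfc (by
      rw [hyy]; nlinarith) hlt.le
    have hsτ : s ∈ Icc 0 τ := ⟨hs.1, hs.2.trans ht.2⟩
    have h1 := hstab s y hs.1 (htraj s hsτ hsle) (by rw [hyy]; exact hy1) s ⟨hs.1, le_rfl⟩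
    rw [hsr, hyy] at h1
    have h2 : C * Real.exp (-c * s) ≤ C' := by
      have h3 : Real.exp (-c * s) ≤ 1 := Real.exp_le_one_iff.2 (by nlinarith [hs.1])
      have h4 : 0 < Real.exp (-c * s) := Real.exp_pos _
      calc C * Real.exp (-c * s) ≤ C' * Real.exp (-c * s) := by
            gcongr; exact le_max_left _ _
        _ ≤ C' * 1 := by gcongr
        _ = C' := mul_one _
    have h3 : C * Real.exp (-c * s) * Metric.infDist y₀ Γ ≤ C' * Metric.infDist y₀ Γ := by gcongr
    linarith
  exact ⟨y, hyy, htraj τ ⟨hτ, le_rfl⟩ hin, hin⟩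

/-- A controlled path stays close to the uncontrolled trajectory with the same starting point. -/
theorem norm_path_sub_trajectory_le {T : ℝ} {ξ v : ℝ → EuclideanSpace ℝ (Fin n)}
    (h : IsACPath T ξ v) (hb : Continuous b)
    {s t : ℝ} (hs : 0 ≤ s) (hst : s ≤ t) (ht : t ≤ T) {U : Set (EuclideanSpace ℝ (Fin n))}
    {K : NNReal}
    (hK : LipschitzOnWith K b U) (hξ : ∀ r ∈ Icc s t, ξ r ∈ U) {y : ℝ → EuclideanSpace ℝ (Fin n)}
    (hy0 : y 0 = ξ s)
    (hy : IsTrajectoryOn b y (Icc 0 (t - s))) (hyU : ∀ r ∈ Icc 0 (t - s), y r ∈ U) :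
    ‖ξ t - y (t - s)‖
      ≤ (∫ r in s..t, ‖v r - b (ξ r)‖) * Real.exp ((K + 1) * (t - s)) := by
  have hsub : Icc s t ⊆ Icc 0 T := Icc_subset_Icc hs ht
  have hξc : ContinuousOn ξ (Icc s t) := (h.continuousOn (hs.trans (hst.trans ht))).mono hsub
  have hyc : ContinuousOn y (Icc 0 (t - s)) := fun r hr => (hy r hr).continuousWithinAt
  set z : ℝ → EuclideanSpace ℝ (Fin n) := fun r => y (r - s) with hz
  have hzc : ContinuousOn z (Icc s t) := hyc.comp (by fun_prop) fun r hr =>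
    ⟨by linarith [hr.1], by linarith [hr.2]⟩
  have hzU : ∀ r ∈ Icc s t, z r ∈ U := fun r hr =>
    hyU _ ⟨by linarith [hr.1], by linarith [hr.2]⟩
  have hzd : ∀ r ∈ Ioo s t, HasDerivAt z (b (z r)) r := fun r hr => by
    have h1 : HasDerivAt y (b (y (r - s))) (r - s) :=
      (hy (r - s) ⟨by linarith [hr.1], by linarith [hr.2]⟩).hasDerivAt
        (Icc_mem_nhds (by linarith [hr.1]) (by linarith [hr.2]))
    exact h1.comp_sub_const r s
  have hci : ∀ r ∈ Icc s t, IntervalIntegrable (fun q => v q - b (ξ q)) volume s r := fun r hr =>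
    integrable_control h hb hs hr.1 (hr.2.trans ht)
  have hbc : ∀ {w : ℝ → EuclideanSpace ℝ (Fin n)}, ContinuousOn w (Icc s t) → ∀ r ∈ Icc s t,
      IntervalIntegrable (fun q => b (w q)) volume s r := fun hw r hr =>
    ContinuousOn.intervalIntegrable (by
      rw [uIcc_of_le hr.1]
      exact hb.comp_continuousOn (hw.mono (Icc_subset_Icc_right hr.2)))
  have hfc : ContinuousOn (fun r => ‖ξ r - z r‖) (Icc s t) := (hξc.sub hzc).norm
  -- K + 1 replaces the Lipschitz constant K, which may be 0, because the Grönwall lemma asks for a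
  -- positive constant.
  have hmain : ∀ r ∈ Icc s t, ‖ξ r - z r‖ ≤ (∫ q in s..t, ‖v q - b (ξ q)‖)
      + (K + 1) * ∫ q in s..r, ‖ξ q - z q‖ := fun r hr => by
    have e1 : z r - z s = ∫ q in s..r, b (z q) :=
      (intervalIntegral.integral_eq_sub_of_hasDerivAt_of_le hr.1
        (hzc.mono (Icc_subset_Icc_right hr.2))
        (fun q hq => hzd q ⟨hq.1, hq.2.trans_le hr.2⟩) (hbc hzc r hr)).symm
    have e2 : ξ r - ξ s = ∫ q in s..r, v q :=
      h.sub_eq_integral (hsub ⟨le_rfl, hst⟩) (hsub hr)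
    have e3 : z s = ξ s := by simp [hz, hy0]
    have e4 : ξ r - z r = (∫ q in s..r, (v q - b (ξ q))) + ∫ q in s..r, (b (ξ q) - b (z q)) := by
      rw [← intervalIntegral.integral_add (hci r hr) ((hbc hξc r hr).sub (hbc hzc r hr))]
      simp only [sub_add_sub_cancel]
      rw [intervalIntegral.integral_sub (h.intervalIntegrable (hsub ⟨le_rfl, hst⟩) (hsub hr))
        (hbc hzc r hr), ← e1, ← e2, e3]
      abel
    rw [e4]
    refine (norm_add_le _ _).trans (add_le_add ?_ ?_)
    · refine (intervalIntegral.norm_integral_le_integral_norm hr.1).trans ?_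
      exact intervalIntegral.integral_mono_interval le_rfl hr.1 hr.2
        (Eventually.of_forall fun _ => norm_nonneg _) (hci t ⟨hst, le_rfl⟩).norm
    · rw [← intervalIntegral.integral_const_mul]
      refine intervalIntegral.norm_integral_le_of_norm_le hr.1 ?_ ?_
      · refine Eventually.of_forall fun q hq => ?_
        have hqI : q ∈ Icc s t := ⟨hq.1.le, hq.2.trans hr.2⟩
        have h1 := hK.dist_le_mul _ (hξ q hqI) _ (hzU q hqI)
        rw [dist_eq_norm, dist_eq_norm] at h1
        nlinarith [norm_nonneg (ξ q - z q)]
      · refine (ContinuousOn.intervalIntegrable ?_).const_mul _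
        rw [uIcc_of_le hr.1]
        exact hfc.mono (Icc_subset_Icc_right hr.2)
  exact le_mul_exp_of_le_add_integral (by positivity) hfc hmain t ⟨hst, le_rfl⟩

/-- A path of small action that starts on a stable cycle ends near it. -/
theorem exists_min_infDist_le (hD : D.PosDef) (h𝒟 : IsOpen 𝒟) (hΓ𝒟 : Γ ⊆ 𝒟) (hb : Continuous b)
    (hb𝒟 : ContDiffOn ℝ 1 b 𝒟) (hΓ : IsStableLimitCycle b Γ) :
    ∃ M ρ : ℝ, 0 < M ∧ 0 < ρ ∧ ∀ (κ T : ℝ) (ξ v : ℝ → EuclideanSpace ℝ (Fin n)), 0 < κ → 0 < T → IsACPath T ξ v →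
      ξ 0 ∈ Γ → action b D T ξ v ≤ ENNReal.ofReal (κ ^ 2) →
        min (Metric.infDist (ξ T) Γ) ρ ≤ M * κ := by
  obtain ⟨r, K, hr, hU𝒟, hUc, hK⟩ := exists_lipschitz_tube h𝒟 hΓ𝒟 hb𝒟 hΓ.orbit
  obtain ⟨δ, C, c, hδ, hc, hstab⟩ := hΓ.stable
  obtain ⟨ρ, hρ, hρr, hρδ, hflow⟩ :=
    exists_trajectory_near hr hUc hK hδ hc hstab
  obtain ⟨l, hl, hlD⟩ := exists_le_lagrangian hD
  set C' := max C 1 with hC'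
  have hC'1 : 1 ≤ C' := le_max_right _ _
  -- In time τ the stability estimate at least halves the distance to Γ.
  set τ := Real.log (2 * C') / c with hτ
  have hτ0 : 0 < τ := div_pos (Real.log_pos (by linarith)) hc
  have hCτ : C * Real.exp (-c * τ) ≤ 1 / 2 := by
    have h1 : -c * τ = -Real.log (2 * C') := by rw [hτ]; field_simp
    rw [h1, Real.exp_neg, Real.exp_log (by linarith), ← div_eq_mul_inv, div_le_iff₀ (by linarith)]
    linarith [le_max_left C 1]
  -- With m = κ, the control has L¹ norm at most κ(1/(2l) + τ/2) over a time up to τ. The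
  -- exponential is the Grönwall factor.
  set N := (1 / (2 * l) + τ / 2) * Real.exp ((K + 1) * τ) with hN
  have hN0 : 0 < N := by positivity
  refine ⟨2 * N, ρ, by positivity, hρ, fun κ T ξ v hκ hT hac h0 hS => ?_⟩
  by_contra! hlt
  have hcont : ContinuousOn (fun s => Metric.infDist (ξ s) Γ) (Icc 0 T) :=
    (Metric.continuous_infDist_pt Γ).comp_continuousOn (hac.continuousOn hT.le)
  have hd0 : Metric.infDist (ξ 0) Γ = 0 := Metric.infDist_zero_of_mem h0
  -- If the path leaves the tube of radius ρ, it is stopped when it first reaches the boundary.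
  -- Either way its end is still too far from Γ.
  obtain ⟨T₁, hT₁, hfar, hnear⟩ : ∃ T₁ ∈ Icc 0 T, 2 * N * κ < Metric.infDist (ξ T₁) Γ ∧
      ∀ s ∈ Icc 0 T₁, Metric.infDist (ξ s) Γ ≤ ρ := by
    by_cases hall : ∀ s ∈ Icc 0 T, Metric.infDist (ξ s) Γ ≤ ρ
    · exact ⟨T, ⟨hT.le, le_rfl⟩, hlt.trans_le (min_le_left _ _), hall⟩
    · push Not at hall
      obtain ⟨s, hs, hsρ⟩ := hall
      obtain ⟨t, ht, htρ, hle⟩ := exists_first_hit hs.1 (hcont.mono (Icc_subset_Icc_right hs.2))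
        (by rw [hd0]; exact hρ.le) hsρ.le
      exact ⟨t, ⟨ht.1, ht.2.trans hs.2⟩, by rw [htρ]; exact hlt.trans_le (min_le_right _ _), hle⟩
  have hstep : ∀ s t, 0 ≤ s → s ≤ t → t ≤ T₁ → t - s ≤ τ → Metric.infDist (ξ t) Γ
      ≤ C * Real.exp (-c * (t - s)) * Metric.infDist (ξ s) Γ + N * κ := fun s t hs hst ht hτt => by
    have hts : 0 ≤ t - s := by linarith
    have hsρ := hnear s ⟨hs, hst.trans ht⟩
    obtain ⟨y, hy0, hy, hyr⟩ := hflow (ξ s) (t - s) hts hsρ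
    have h1 := hstab (t - s) y hts hy (by rw [hy0]; exact hsρ.trans_lt hρδ) (t - s) ⟨hts, le_rfl⟩
    rw [hy0] at h1
    have h2 := norm_path_sub_trajectory_le hac hb hs hst (ht.trans hT₁.2) hK
      (fun q hq => (hnear q ⟨hs.trans hq.1, hq.2.trans ht⟩).trans hρr) hy0 hy hyr
    have hSst : ∫⁻ q in Ioc s t, ENNReal.ofReal (lagrangian D (v q - b (ξ q)))
        ≤ ENNReal.ofReal (κ ^ 2) := by
      refine (lintegral_mono_set fun q hq => ?_).trans hS
      exact ⟨hs.trans hq.1.le, hq.2.trans (ht.trans hT₁.2)⟩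
    have h3 := integral_norm_control_le hac hb hl hlD hs hst (ht.trans hT₁.2) (sq_nonneg κ) hκ hSst
    have h4 : κ ^ 2 / (2 * l * κ) + κ * (t - s) / 2 ≤ κ * (1 / (2 * l) + τ / 2) := by
      have : κ ^ 2 / (2 * l * κ) = κ * (1 / (2 * l)) := by field_simp
      rw [this]
      nlinarith
    have h5 : ‖ξ t - y (t - s)‖ ≤ N * κ := by
      calc _ ≤ _ := h2
        _ ≤ (κ * (1 / (2 * l) + τ / 2)) * Real.exp ((K + 1) * τ) := by
            gcongr; exact h3.trans h4
        _ = N * κ := by rw [hN]; ring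
    have h6 := Metric.infDist_le_infDist_add_dist (s := Γ) (x := ξ t) (y := y (t - s))
    rw [dist_eq_norm] at h6
    linarith
  -- 2Nκ is the fixed point of d ↦ d/2 + Nκ, so steps of length τ preserve the bound, however long
  -- the path. The base case starts on Γ and needs only Nκ.
  have hind : ∀ k : ℕ, ∀ t ∈ Icc 0 T₁, t ≤ (k + 1) * τ → Metric.infDist (ξ t) Γ ≤ 2 * N * κ := by
    intro k
    induction k with
    | zero =>
      intro t ht htτ
      have h1 := hstep 0 t le_rfl ht.1 ht.2 (by simpa using htτ)
      rw [hd0, mul_zero, zero_add] at h1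
      nlinarith
    | succ k ih =>
      intro t ht htτ
      rcases le_or_gt t τ with htt | htt
      · exact ih t ht (by nlinarith [k.cast_nonneg (α := ℝ)])
      · have h1 := hstep (t - τ) t (by linarith) (by linarith) ht.2 (by linarith)
        have h2 := ih (t - τ) ⟨by linarith, by linarith [ht.2]⟩ (by push_cast at htτ; linarith)
        rw [sub_sub_cancel] at h1
        have h3 : C * Real.exp (-c * τ) * Metric.infDist (ξ (t - τ)) Γ
            ≤ 1 / 2 * Metric.infDist (ξ (t - τ)) Γ :=
          mul_le_mul_of_nonneg_right hCτ Metric.infDist_nonneg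
        linarith
  obtain ⟨k, hk⟩ := exists_nat_gt (T₁ / τ)
  rw [div_lt_iff₀ hτ0] at hk
  have := hind k T₁ ⟨hT₁.1, le_rfl⟩ (by nlinarith)
  linarith

/-- The quasipotential grows at least quadratically with the distance from a stable cycle. -/
theorem exists_min_infDist_sq_le_rateFunction (hD : D.PosDef) (h𝒟 : IsOpen 𝒟) (hΓ𝒟 : Γ ⊆ 𝒟)
    (hb : Continuous b) (hb𝒟 : ContDiffOn ℝ 1 b 𝒟) (hΓ : IsStableLimitCycle b Γ) :
    ∃ M ρ : ℝ, 0 < M ∧ 0 < ρ ∧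
      ∀ y, min (Metric.infDist y Γ) ρ ^ 2 ≤ M * rateFunction b D Γ y := by
  obtain ⟨M, ρ, hM, hρ, h⟩ := exists_min_infDist_le hD h𝒟 hΓ𝒟 hb hb𝒟 hΓ
  refine ⟨M ^ 2, ρ, by positivity, hρ, fun y => ?_⟩
  have hfin := quasipotential_ne_top (D := D) hb hΓ.orbit.nonempty y
  have hnn : 0 ≤ rateFunction b D Γ y := ENNReal.toReal_nonneg
  rw [← div_le_iff₀' (by positivity)]
  refine le_of_forall_gt_imp_ge_of_dense fun a ha => ?_
  have ha0 : 0 < a := hnn.trans_lt ha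
  obtain ⟨T, ξ, v, hT, hac, h0, hy, hS⟩ := exists_action_lt (b := b) (D := D) (Γ := Γ)
    (x := y) (S := ENNReal.ofReal a) (by
      rw [← ENNReal.ofReal_toReal hfin]
      exact (ENNReal.ofReal_lt_ofReal_iff ha0).2 ha)
  -- Taking κ² = a for any a above the rate function gives the squared estimate. The infimum over a
  -- is handled by density.
  have h1 := h (Real.sqrt a) T ξ v (Real.sqrt_pos.2 ha0) hT hac h0
    (by rw [Real.sq_sqrt ha0.le]; exact hS.le)
  rw [hy] at h1
  have h2 : 0 ≤ min (Metric.infDist y Γ) ρ := le_min Metric.infDist_nonneg hρ.le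
  have h3 := pow_le_pow_left₀ h2 h1 2
  rw [mul_pow, Real.sq_sqrt ha0.le] at h3
  rw [div_le_iff₀' (by positivity)]
  exact h3

/-- The stability estimate with initial distance 0 confines the trajectory to Γ, with no appeal to
uniqueness of solutions. -/
theorem trajectory_mem_of_isStable (hΓ : IsStableLimitCycle b Γ) {x : ℝ → EuclideanSpace ℝ (Fin n)}
    (hx0 : x 0 ∈ Γ)
    (hx : IsTrajectoryOn b x (Ici 0)) {t : ℝ} (ht : 0 ≤ t) : x t ∈ Γ := by
  obtain ⟨δ, C, c, hδ, hc, hstab⟩ := hΓ.stable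
  have hd0 : Metric.infDist (x 0) Γ = 0 := Metric.infDist_zero_of_mem hx0
  have h1 := hstab t x ht (fun s hs => (hx s hs.1).mono Icc_subset_Ici_self)
    (by rw [hd0]; exact hδ) t ⟨ht, le_rfl⟩
  rw [hd0, mul_zero] at h1
  exact (hΓ.orbit.isCompact.isClosed.mem_iff_infDist_zero hΓ.orbit.nonempty).2
    (le_antisymm h1 Metric.infDist_nonneg)

/-- At an equilibrium on Γ the constant solution and the periodic one would both stay in Γ, where b
is Lipschitz. By uniqueness they would coincide, but the periodic solution is not constant. -/
theorem ne_zero_of_mem_periodicOrbit (h𝒟 : IsOpen 𝒟) (hΓ𝒟 : Γ ⊆ 𝒟) (hb𝒟 : ContDiffOn ℝ 1 b 𝒟)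
    (hΓ : IsPeriodicOrbit b Γ) {y : EuclideanSpace ℝ (Fin n)} (hy : y ∈ Γ) : b y ≠ 0 := by
  intro hb0
  obtain ⟨K, hK⟩ := LocallyLipschitzOn.exists_lipschitzOnWith_of_compact hΓ.isCompact
    (locallyLipschitzOn_of_contDiffOn_isOpen h𝒟 hb𝒟 hΓ𝒟)
  obtain ⟨p, T, hT, hp, hper, ⟨s, hs⟩, rfl⟩ := hΓ
  obtain ⟨t, rfl⟩ := hy
  have h := ODE_solution_unique_univ (v := fun _ => b) (s := fun _ => range p) (t₀ := t)
    (f := p) (g := fun _ => p t) (fun _ => hK)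
    (fun q => ⟨(hp q (mem_univ q)).hasDerivAt univ_mem, mem_range_self q⟩)
    (fun q => ⟨by rw [hb0]; exact hasDerivAt_const q (p t), mem_range_self t⟩) rfl
  exact hs (by rw [h])

/-- A trajectory that starts on a stable cycle is the restriction of a periodic solution. -/
theorem exists_periodic_extension (h𝒟 : IsOpen 𝒟) (hΓ𝒟 : Γ ⊆ 𝒟) (hb𝒟 : ContDiffOn ℝ 1 b 𝒟)
    (hΓ : IsStableLimitCycle b Γ) {x : ℝ → EuclideanSpace ℝ (Fin n)} (hx0 : x 0 ∈ Γ)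
    (hx : IsTrajectoryOn b x (Ici 0)) :
    ∃ (p : ℝ → EuclideanSpace ℝ (Fin n)) (T : ℝ), 0 < T ∧ (∀ t, HasDerivAt p (b (p t)) t) ∧ Function.Periodic p T ∧
      Γ = range p ∧ ∀ t, 0 ≤ t → x t = p t := by
  obtain ⟨K, hK⟩ := LocallyLipschitzOn.exists_lipschitzOnWith_of_compact hΓ.orbit.isCompact
    (locallyLipschitzOn_of_contDiffOn_isOpen h𝒟 hb𝒟 hΓ𝒟)
  obtain ⟨p, T, hT, hp, hper, -, hΓp⟩ := hΓ.orbit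
  obtain ⟨t₀, ht₀⟩ := hΓp ▸ hx0
  have hq : ∀ t, HasDerivAt (fun s => p (t₀ + s)) (b (p (t₀ + t))) t := fun t =>
    ((hp (t₀ + t) (mem_univ _)).hasDerivAt univ_mem).comp_const_add t₀ t
  have hqΓ : ∀ t, p (t₀ + t) ∈ Γ := fun t => by rw [hΓp]; exact mem_range_self _
  refine ⟨fun s => p (t₀ + s), T, hT, hq, fun t => ?_, ?_, fun t ht => ?_⟩
  · show p (t₀ + (t + T)) = p (t₀ + t)
    rw [← add_assoc]; exact hper _
  · rw [hΓp]
    exact ((Equiv.addLeft t₀).surjective.range_comp p).symm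
  · refine ODE_solution_unique_of_mem_Icc_right (v := fun _ => b) (s := fun _ => Γ) (f := x)
      (g := fun s => p (t₀ + s)) (a := 0) (b := t) (fun _ _ => hK) ?_ ?_ ?_ ?_ ?_ ?_ ?_ ⟨ht, le_rfl⟩
    · exact fun s hs => (hx s hs.1).continuousWithinAt.mono Icc_subset_Ici_self
    · exact fun s hs => (hx s hs.1).mono (Ici_subset_Ici.2 hs.1)
    · exact fun s hs => trajectory_mem_of_isStable hΓ hx0 hx hs.1
    · exact fun s _ => (hq s).continuousAt.continuousWithinAt
    · exact fun s _ => (hq s).hasDerivWithinAt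
    · exact fun s _ => hqΓ s
    · simp [ht₀]

end Cycle

/-! ### Derivatives of the Hamilton-Jacobi equation up to second order -/

section Derivatives

variable {n : ℕ} {b : EuclideanSpace ℝ (Fin n) → EuclideanSpace ℝ (Fin n)}
  {D : Matrix (Fin n) (Fin n) ℝ} {Γ 𝒟 : Set (EuclideanSpace ℝ (Fin n))}
  {φ : EuclideanSpace ℝ (Fin n) → ℝ}

theorem contDiffOn_partials {k m : WithTop ℕ∞} (h𝒟 : IsOpen 𝒟) (hφ : ContDiffOn ℝ k φ 𝒟)
    (hmk : m + 1 ≤ k) (i : Fin n) : ContDiffOn ℝ m (fun y => partials φ y i) 𝒟 :=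
  (hφ.fderiv_of_isOpen h𝒟 hmk).clm_apply contDiffOn_const

theorem fderiv_partials_single (h𝒟 : IsOpen 𝒟) (hφ : ContDiffOn ℝ 2 φ 𝒟)
    {z : EuclideanSpace ℝ (Fin n)} (hz : z ∈ 𝒟)
    (i k : Fin n) :
    fderiv ℝ (fun w => partials φ w i) z (EuclideanSpace.single k 1) = hessian φ z k i := by
  have h1 : DifferentiableAt ℝ (fderiv ℝ φ) z :=
    ((hφ.fderiv_of_isOpen (m := 1) h𝒟 (by norm_num)).contDiffAt
      (h𝒟.mem_nhds hz)).differentiableAt one_ne_zero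
  have h2 := fderiv_clm_apply (u := fun _ => EuclideanSpace.single i (1 : ℝ)) h1
    (differentiableAt_const _)
  simp only [partials, h2, hessian, Matrix.of_apply]
  simp

theorem hessian_symm (h𝒟 : IsOpen 𝒟) (hφ : ContDiffOn ℝ 2 φ 𝒟) {z : EuclideanSpace ℝ (Fin n)}
    (hz : z ∈ 𝒟)
    (i j : Fin n) : hessian φ z i j = hessian φ z j i :=
  (hφ.contDiffAt (h𝒟.mem_nhds hz)).isSymmSndFDerivAt
    (by rw [minSmoothness_of_isRCLikeNormedField]) _ _

theorem differentiableAt_partials (h𝒟 : IsOpen 𝒟) (hφ : ContDiffOn ℝ 2 φ 𝒟)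
    {z : EuclideanSpace ℝ (Fin n)} (hz : z ∈ 𝒟)
    (i : Fin n) : DifferentiableAt ℝ (fun w => partials φ w i) z :=
  ((contDiffOn_partials (m := 1) h𝒟 hφ (by norm_num) i).contDiffAt
    (h𝒟.mem_nhds hz)).differentiableAt one_ne_zero

theorem hessian_eventuallyEq (h𝒟 : IsOpen 𝒟) (hφ : ContDiffOn ℝ 2 φ 𝒟)
    {z : EuclideanSpace ℝ (Fin n)} (hz : z ∈ 𝒟)
    (i j : Fin n) :
    (fun w => hessian φ w i j) =ᶠ[𝓝 z] fun w => partials (fun w => partials φ w j) w i := by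
  filter_upwards [h𝒟.mem_nhds hz] with w hw
  exact (fderiv_partials_single h𝒟 hφ hw j i).symm

theorem differentiableAt_hessian (h𝒟 : IsOpen 𝒟) (hφ : ContDiffOn ℝ 3 φ 𝒟)
    {z : EuclideanSpace ℝ (Fin n)} (hz : z ∈ 𝒟)
    (i j : Fin n) : DifferentiableAt ℝ (fun w => hessian φ w i j) z :=
  (differentiableAt_partials h𝒟 (contDiffOn_partials (m := 2) h𝒟 hφ (by norm_num) j) hz
    i).congr_of_eventuallyEq (hessian_eventuallyEq h𝒟 (hφ.of_le (by norm_num)) hz i j)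

/-- The third partial derivatives of `f`. -/
noncomputable def thirdPartial (f : EuclideanSpace ℝ (Fin n) → ℝ) (z : EuclideanSpace ℝ (Fin n))
    (k i j : Fin n) : ℝ :=
  fderiv ℝ (fun w => hessian f w i j) z (EuclideanSpace.single k 1)

/-- Schwarz's theorem for the C² function ∂ⱼφ, whose Hessian contains these third derivatives. -/
theorem thirdPartial_swap_left (h𝒟 : IsOpen 𝒟) (hφ : ContDiffOn ℝ 3 φ 𝒟)
    {z : EuclideanSpace ℝ (Fin n)} (hz : z ∈ 𝒟)
    (k i j : Fin n) : thirdPartial φ z k i j = thirdPartial φ z i k j := by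
  have h2 : ContDiffOn ℝ 2 (fun w => partials φ w j) 𝒟 :=
    contDiffOn_partials h𝒟 hφ (by norm_num) j
  have h : ∀ k i, thirdPartial φ z k i j = hessian (fun w => partials φ w j) z k i := fun k i => by
    rw [thirdPartial, (hessian_eventuallyEq h𝒟 (hφ.of_le (by norm_num)) hz i j).fderiv_eq,
      fderiv_partials_single h𝒟 h2 hz]
  rw [h, h, hessian_symm h𝒟 h2 hz]

theorem thirdPartial_swap_right (h𝒟 : IsOpen 𝒟) (hφ : ContDiffOn ℝ 3 φ 𝒟)
    {z : EuclideanSpace ℝ (Fin n)} (hz : z ∈ 𝒟)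
    (k i j : Fin n) : thirdPartial φ z k i j = thirdPartial φ z k j i := by
  have h : (fun w => hessian φ w i j) =ᶠ[𝓝 z] fun w => hessian φ w j i := by
    filter_upwards [h𝒟.mem_nhds hz] with w hw
    exact hessian_symm h𝒟 (hφ.of_le (by norm_num)) hw i j
  rw [thirdPartial, h.fderiv_eq, thirdPartial]

theorem hasDerivAt_line {f : EuclideanSpace ℝ (Fin n) → ℝ} {z : EuclideanSpace ℝ (Fin n)}
    (hf : DifferentiableAt ℝ f z) (u : EuclideanSpace ℝ (Fin n)) :
    HasDerivAt (fun s : ℝ => f (z + s • u)) (fderiv ℝ f z u) 0 :=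
  hf.hasFDerivAt.hasLineDerivAt u

theorem differentiableAt_apply (h𝒟 : IsOpen 𝒟) (hb𝒟 : ContDiffOn ℝ 1 b 𝒟)
    {z : EuclideanSpace ℝ (Fin n)} (hz : z ∈ 𝒟)
    (i : Fin n) : DifferentiableAt ℝ (fun w => b w i) z :=
  (EuclideanSpace.proj i : EuclideanSpace ℝ (Fin n) →L[ℝ] ℝ).differentiableAt.comp z
    ((hb𝒟.contDiffAt (h𝒟.mem_nhds hz)).differentiableAt one_ne_zero)

theorem fderiv_apply_single (h𝒟 : IsOpen 𝒟) (hb𝒟 : ContDiffOn ℝ 1 b 𝒟)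
    {z : EuclideanSpace ℝ (Fin n)} (hz : z ∈ 𝒟)
    (i k : Fin n) :
    fderiv ℝ (fun w => b w i) z (EuclideanSpace.single k 1) = jacobian b z i k := by
  have h := (EuclideanSpace.proj i : EuclideanSpace ℝ (Fin n) →L[ℝ] ℝ).hasFDerivAt.comp z
    ((hb𝒟.contDiffAt (h𝒟.mem_nhds hz)).differentiableAt one_ne_zero).hasFDerivAt
  have h2 : fderiv ℝ (fun w => b w i) z
      = (EuclideanSpace.proj i : EuclideanSpace ℝ (Fin n) →L[ℝ] ℝ).comp (fderiv ℝ b z) := h.fderiv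
  rw [h2]
  rfl

theorem continuousOn_jacobian (h𝒟 : IsOpen 𝒟) (hb𝒟 : ContDiffOn ℝ 1 b 𝒟) (i k : Fin n) :
    ContinuousOn (fun w => jacobian b w i k) 𝒟 :=
  (EuclideanSpace.proj i : EuclideanSpace ℝ (Fin n) →L[ℝ] ℝ).continuous.comp_continuousOn
    ((hb𝒟.continuousOn_fderiv_of_isOpen h𝒟 le_rfl).clm_apply continuousOn_const)

/-- A product rule that needs only continuity of the second factor where the first vanishes. -/
theorem hasDerivAt_mul_of_eq_zero {f g : ℝ → ℝ} {f' : ℝ} (hf : HasDerivAt f f' 0) (h0 : f 0 = 0)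
    (hg : ContinuousAt g 0) : HasDerivAt (fun s => f s * g s) (f' * g 0) 0 := by
  rw [hasDerivAt_iff_tendsto_slope_zero] at hf ⊢
  have h1 : Tendsto (fun t => g (0 + t)) (𝓝[≠] 0) (𝓝 (g 0)) := by
    simpa using hg.tendsto.mono_left nhdsWithin_le_nhds
  refine (hf.mul h1).congr fun t => ?_
  simp only [h0, zero_mul, sub_zero, smul_eq_mul, mul_assoc]

theorem hasDerivAt_line_partials (h𝒟 : IsOpen 𝒟) (hφ : ContDiffOn ℝ 2 φ 𝒟)
    {z : EuclideanSpace ℝ (Fin n)} (hz : z ∈ 𝒟)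
    (i k : Fin n) : HasDerivAt (fun s : ℝ => partials φ (z + s • EuclideanSpace.single k 1) i)
      (hessian φ z k i) 0 := by
  have h := hasDerivAt_line (differentiableAt_partials h𝒟 hφ hz i) (EuclideanSpace.single k 1)
  rwa [fderiv_partials_single h𝒟 hφ hz] at h

theorem hasDerivAt_line_field (h𝒟 : IsOpen 𝒟) (hb𝒟 : ContDiffOn ℝ 1 b 𝒟)
    {z : EuclideanSpace ℝ (Fin n)} (hz : z ∈ 𝒟)
    (i k : Fin n) : HasDerivAt (fun s : ℝ => b (z + s • EuclideanSpace.single k 1) i)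
      (jacobian b z i k) 0 := by
  have h := hasDerivAt_line (differentiableAt_apply h𝒟 hb𝒟 hz i) (EuclideanSpace.single k 1)
  rwa [fderiv_apply_single h𝒟 hb𝒟 hz] at h

theorem eventually_line_mem (h𝒟 : IsOpen 𝒟) {z : EuclideanSpace ℝ (Fin n)} (hz : z ∈ 𝒟)
    (u : EuclideanSpace ℝ (Fin n)) :
    ∀ᶠ s : ℝ in 𝓝 0, z + s • u ∈ 𝒟 := by
  have hline : Continuous fun s : ℝ => z + s • u := by fun_prop
  exact hline.continuousAt.eventually_mem (h𝒟.mem_nhds (by simpa using hz))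

theorem deriv_eq_zero_of_eventually_eq_zero {f : ℝ → ℝ} {f' : ℝ} (hf : HasDerivAt f f' 0)
    (h : ∀ᶠ s in 𝓝 (0 : ℝ), f s = 0) : f' = 0 :=
  hf.unique ((hasDerivAt_const (0 : ℝ) (0 : ℝ)).congr_of_eventuallyEq h)

/-- The gradient of the Hamilton-Jacobi equation. -/
theorem gradient_hamiltonJacobi (hD : D.PosDef) (h𝒟 : IsOpen 𝒟) (hb𝒟 : ContDiffOn ℝ 1 b 𝒟)
    (hφ : ContDiffOn ℝ 2 φ 𝒟) (hHJ : ∀ z ∈ 𝒟, hamiltonian b D φ z = 0)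
    {z : EuclideanSpace ℝ (Fin n)} (hz : z ∈ 𝒟)
    (k : Fin n) :
    (∑ i, hessian φ z k i * b z i) + (∑ i, partials φ z i * jacobian b z i k)
      + 2 * ∑ i, hessian φ z k i * ∑ j, D i j * partials φ z j = 0 := by
  have hsymm : ∀ i j, D i j = D j i := fun i j => congrFun (congrFun (isSymm_of_posDef hD) j) i
  have hP := fun i => hasDerivAt_line_partials h𝒟 hφ hz i k
  have hb := fun i => hasDerivAt_line_field h𝒟 hb𝒟 hz i k
  have hd := (HasDerivAt.fun_sum (u := Finset.univ) fun i _ => (hP i).mul (hb i)).add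
    (HasDerivAt.fun_sum (u := Finset.univ) fun i _ => (hP i).mul
      (HasDerivAt.fun_sum (u := Finset.univ) fun j _ => (hP j).const_mul (D i j)))
  have h0 := deriv_eq_zero_of_eventually_eq_zero hd (by
    filter_upwards [eventually_line_mem h𝒟 hz (EuclideanSpace.single k 1)] with s hs
    have := hHJ _ hs
    rw [hamiltonian, fderiv_eq_partials_dotProduct] at this
    exact this)
  simp only [zero_smul, add_zero, Finset.sum_add_distrib] at h0
  -- Symmetry of D merges the two terms of the differentiated quadratic form, which accounts for the
  -- factor 2.
  have e : ∑ i, partials φ z i * ∑ j, D i j * hessian φ z k j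
      = ∑ i, hessian φ z k i * ∑ j, D i j * partials φ z j := by
    simp only [Finset.mul_sum]
    rw [Finset.sum_comm]
    refine Finset.sum_congr rfl fun i _ => Finset.sum_congr rfl fun j _ => ?_
    rw [hsymm j i]
    ring
  rw [e] at h0
  linarith

/-- The Hessian of the Hamilton-Jacobi equation at a critical point. -/
theorem hessian_hamiltonJacobi (hD : D.PosDef) (h𝒟 : IsOpen 𝒟) (hb𝒟 : ContDiffOn ℝ 1 b 𝒟)
    (hφ : ContDiffOn ℝ 3 φ 𝒟) (hHJ : ∀ z ∈ 𝒟, hamiltonian b D φ z = 0)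
    {y : EuclideanSpace ℝ (Fin n)} (hy : y ∈ 𝒟)
    (hcrit : partials φ y = 0) (k l : Fin n) :
    (∑ i, b y i * thirdPartial φ y i k l)
      = (-(hessian φ y * jacobian b y) - (jacobian b y).transpose * hessian φ y
        - (2 : ℝ) • (hessian φ y * D * hessian φ y)) k l := by
  have hφ2 : ContDiffOn ℝ 2 φ 𝒟 := hφ.of_le (by norm_num)
  have hP := fun i => hasDerivAt_line_partials h𝒟 hφ2 hy i l
  have hb := fun i => hasDerivAt_line_field h𝒟 hb𝒟 hy i l
  have hH : ∀ i, HasDerivAt (fun s : ℝ => hessian φ (y + s • EuclideanSpace.single l 1) k i)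
      (thirdPartial φ y l k i) 0 := fun i =>
    hasDerivAt_line (differentiableAt_hessian h𝒟 hφ hy k i) (EuclideanSpace.single l 1)
  -- Since b is only C¹, its Jacobian is merely continuous. Its factor ∂ᵢφ vanishes at the critical
  -- point, so the product still has a derivative.
  have hA : ∀ i, ContinuousAt
      (fun s : ℝ => jacobian b (y + s • EuclideanSpace.single l 1) i k) 0 := fun i => by
    have hline : Continuous fun s : ℝ => y + s • EuclideanSpace.single l (1 : ℝ) := by fun_prop
    refine ContinuousAt.comp (f := fun s : ℝ => y + s • EuclideanSpace.single l (1 : ℝ))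
      (g := fun w => jacobian b w i k) ?_ hline.continuousAt
    exact (continuousOn_jacobian h𝒟 hb𝒟 i k).continuousAt (h𝒟.mem_nhds (by simpa using hy))
  have hd := ((HasDerivAt.fun_sum (u := Finset.univ) fun i _ => (hH i).mul (hb i)).add
    (HasDerivAt.fun_sum (u := Finset.univ) fun i _ =>
      hasDerivAt_mul_of_eq_zero (hP i) (by simp [hcrit]) (hA i))).add
    ((HasDerivAt.fun_sum (u := Finset.univ) fun i _ => (hH i).mul
      (HasDerivAt.fun_sum (u := Finset.univ) fun j _ => (hP j).const_mul (D i j))).const_mul 2)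
  have h0 := deriv_eq_zero_of_eventually_eq_zero hd (by
    filter_upwards [eventually_line_mem h𝒟 hy (EuclideanSpace.single l 1)] with s hs
    exact gradient_hamiltonJacobi hD h𝒟 hb𝒟 hφ2 hHJ hs k)
  simp only [zero_smul, add_zero, hcrit, Pi.zero_apply, mul_zero, Finset.sum_const_zero, zero_add,
    Finset.sum_add_distrib] at h0
  -- Full symmetry of the third derivatives turns the derivative in direction l, contracted with b,
  -- into the derivative along b.
  have e1 : ∑ i, b y i * thirdPartial φ y i k l = ∑ i, thirdPartial φ y l k i * b y i :=
    Finset.sum_congr rfl fun i _ => by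
      rw [thirdPartial_swap_left h𝒟 hφ hy i k l, thirdPartial_swap_right h𝒟 hφ hy k i l,
        thirdPartial_swap_left h𝒟 hφ hy k l i, mul_comm]
  have e2 : ((jacobian b y).transpose * hessian φ y) k l = ∑ i, hessian φ y l i * jacobian b y i k := by
    rw [Matrix.mul_apply]
    refine Finset.sum_congr rfl fun i _ => ?_
    rw [Matrix.transpose_apply, mul_comm, hessian_symm h𝒟 hφ2 hy i l]
  have e3 : (hessian φ y * D * hessian φ y) k l
      = ∑ i, hessian φ y k i * ∑ j, D i j * hessian φ y l j := by
    rw [Matrix.mul_assoc, Matrix.mul_apply]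
    refine Finset.sum_congr rfl fun i _ => ?_
    rw [Matrix.mul_apply]
    congr 1
    exact Finset.sum_congr rfl fun j _ => by rw [hessian_symm h𝒟 hφ2 hy j l]
  simp only [Matrix.sub_apply, Matrix.neg_apply, Matrix.smul_apply, smul_eq_mul, e2, e3]
  rw [e1, Matrix.mul_apply]
  linarith

theorem hasDerivAt_hessian_along (h𝒟 : IsOpen 𝒟) (hφ : ContDiffOn ℝ 3 φ 𝒟)
    {x : ℝ → EuclideanSpace ℝ (Fin n)} {t : ℝ}
    (hxt : x t ∈ 𝒟) (hx : HasDerivAt x (b (x t)) t) (k l : Fin n) :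
    HasDerivAt (fun s => hessian φ (x s) k l) (∑ i, b (x t) i * thirdPartial φ (x t) i k l) t := by
  have h := (differentiableAt_hessian h𝒟 hφ hxt k l).hasFDerivAt.comp_hasDerivAt t hx
  rw [clm_apply_eq_sum] at h
  exact h

/-- The Hessian annihilates the tangent vector of a curve of critical points. -/
theorem hessian_mulVec_eq_zero (h𝒟 : IsOpen 𝒟) (hφ : ContDiffOn ℝ 2 φ 𝒟)
    {p : ℝ → EuclideanSpace ℝ (Fin n)} {t : ℝ}
    (hp𝒟 : p t ∈ 𝒟) (hp : HasDerivAt p (b (p t)) t) (hcrit : ∀ s, partials φ (p s) = 0) :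
    (hessian φ (p t)).mulVec (b (p t)).ofLp = 0 := by
  ext i
  have h := (differentiableAt_partials h𝒟 hφ hp𝒟 i).hasFDerivAt.comp_hasDerivAt t hp
  have h0 : (fun w => partials φ w i) ∘ p = fun _ => 0 := by
    ext s; simp [hcrit]
  rw [h0] at h
  have h1 := h.unique (hasDerivAt_const t (0 : ℝ))
  rw [clm_apply_eq_sum] at h1
  rw [Matrix.mulVec, dotProduct, Pi.zero_apply, ← h1]
  refine Finset.sum_congr rfl fun j _ => ?_
  rw [fderiv_partials_single h𝒟 hφ hp𝒟, hessian_symm h𝒟 hφ hp𝒟, smul_eq_mul, mul_comm]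

end Derivatives

/-! ### Positivity of the Hessian transversally to the cycle -/

section Nondegeneracy

variable {n : ℕ} {b : EuclideanSpace ℝ (Fin n) → EuclideanSpace ℝ (Fin n)}
  {D : Matrix (Fin n) (Fin n) ℝ} {Γ 𝒟 : Set (EuclideanSpace ℝ (Fin n))}
  {φ : EuclideanSpace ℝ (Fin n) → ℝ}

/-- Near a point `y` of a cycle, the chords from `y` are almost tangent. -/
theorem eventually_abs_inner_chord_le {p : ℝ → EuclideanSpace ℝ (Fin n)} {T : ℝ} (hT : 0 < T)
    (hper : Function.Periodic p T) (hp : ∀ t, HasDerivAt p (b (p t)) t)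
    {y w : EuclideanSpace ℝ (Fin n)} (hb : b y ≠ 0)
    (hw : inner ℝ (b y) w = 0) {e : ℝ} (he : 0 < e) :
    ∀ᶠ q in 𝓝 y, q ∈ range p → |inner ℝ (q - y) w| ≤ e * ‖q - y‖ := by
  have hpc : Continuous p := continuous_iff_continuousAt.2 fun t => (hp t).continuousAt
  -- A bound near each time t extends to a whole period by compactness. Each time at which the orbit
  -- visits y is treated separately, so no injectivity of p is needed.
  have key : ∀ᶠ q in 𝓝 y, ∀ t ∈ Icc 0 (0 + T), q = p t → |inner ℝ (q - y) w| ≤ e * ‖q - y‖ := by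
    refine isCompact_Icc.eventually_forall_of_forall_eventually fun t _ => ?_
    by_cases hpt : p t = y
    · have hbn : 0 < ‖b y‖ := norm_pos_iff.2 hb
      -- The second entry absorbs the linearization error in the inner product with w, the first
      -- keeps the chord at least ‖b y‖/2 times the elapsed time. Together they give e'‖w‖ ≤ e(‖b y‖
      -- - e').
      set e' := min (‖b y‖ / 2) (e * ‖b y‖ / (2 * (‖w‖ + 1))) with he'
      have he'0 : 0 < e' := by positivity
      have h1 := (hasDerivAt_iff_isLittleO.1 (hp t)).def he'0
      rw [hpt] at h1
      have h2 : ∀ᶠ z : EuclideanSpace ℝ (Fin n) × ℝ in 𝓝 (y, t), ‖p z.2 - y - (z.2 - t) • b y‖ ≤ e' * ‖z.2 - t‖ :=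
        (continuous_snd.tendsto (y, t)).eventually h1
      filter_upwards [h2] with z hz hzp
      rw [hzp]
      set d := p z.2 - y with hd
      have e1 : inner ℝ d w = inner ℝ (d - (z.2 - t) • b y) w := by
        rw [inner_sub_left d ((z.2 - t) • b y) w, inner_smul_left, hw]; simp
      have e2 : |inner ℝ d w| ≤ e' * ‖z.2 - t‖ * ‖w‖ := by
        rw [e1]
        exact (abs_real_inner_le_norm _ _).trans (mul_le_mul_of_nonneg_right hz (norm_nonneg _))
      have e3 : (‖b y‖ - e') * ‖z.2 - t‖ ≤ ‖d‖ := by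
        have h3 : ‖(z.2 - t) • b y‖ ≤ ‖d‖ + ‖d - (z.2 - t) • b y‖ := by
          have := norm_sub_le d (d - (z.2 - t) • b y)
          rwa [sub_sub_cancel] at this
        rw [norm_smul] at h3
        nlinarith
      have e4 : e' ≤ ‖b y‖ / 2 := min_le_left _ _
      have e5 : e' * (2 * (‖w‖ + 1)) ≤ e * ‖b y‖ := by
        rw [← le_div_iff₀ (by positivity)]
        exact min_le_right _ _
      have e6 : e' * ‖w‖ ≤ e * (‖b y‖ - e') := by nlinarith [norm_nonneg w]
      calc |inner ℝ d w| ≤ (e' * ‖w‖) * ‖z.2 - t‖ := by linarith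
        _ ≤ (e * (‖b y‖ - e')) * ‖z.2 - t‖ := by gcongr
        _ = e * ((‖b y‖ - e') * ‖z.2 - t‖) := by ring
        _ ≤ e * ‖d‖ := by gcongr
    · have h1 : Tendsto (fun z : EuclideanSpace ℝ (Fin n) × ℝ => z.1 - p z.2) (𝓝 (y, t)) (𝓝 (y - p t)) := by
        have : Continuous fun z : EuclideanSpace ℝ (Fin n) × ℝ => z.1 - p z.2 := by fun_prop
        exact this.tendsto (y, t)
      filter_upwards [h1.eventually_ne (sub_ne_zero.2 (Ne.symm hpt))] with z hz hzp
      exact absurd (sub_eq_zero.2 hzp) hz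
  filter_upwards [key] with q hq hqp
  rw [← hper.image_Icc hT 0] at hqp
  obtain ⟨t, ht, rfl⟩ := hqp
  exact hq t ht rfl

/-- A second-order upper bound along a ray from a critical zero of `φ`. -/
theorem eventually_le_mul_sq (h𝒟 : IsOpen 𝒟) (hφ : ContDiffOn ℝ 2 φ 𝒟)
    {y : EuclideanSpace ℝ (Fin n)} (hy : y ∈ 𝒟)
    (h0 : φ y = 0) (hcrit : partials φ y = 0) {w : EuclideanSpace ℝ (Fin n)}
    (hw : w.ofLp ⬝ᵥ (hessian φ y).mulVec w.ofLp ≤ 0) {e : ℝ} (he : 0 < e) :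
    ∀ᶠ h in 𝓝[>] (0 : ℝ), φ (y + h • w) ≤ e * h ^ 2 := by
  have hline : ∀ h : ℝ, HasDerivAt (fun s : ℝ => y + s • w) w h := fun h => by
    simpa using ((hasDerivAt_id h).smul_const w).const_add y
  have hdφ : ∀ h : ℝ, y + h • w ∈ 𝒟 →
      HasDerivAt (fun s : ℝ => φ (y + s • w)) (fderiv ℝ φ (y + h • w) w) h := fun h hh =>
    ((hφ.contDiffAt (h𝒟.mem_nhds hh)).differentiableAt two_ne_zero).hasFDerivAt.comp_hasDerivAt h
      (hline h)
  have hcrit' : fderiv ℝ φ y w = 0 := by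
    rw [fderiv_eq_partials_dotProduct, hcrit, zero_dotProduct]
  have hd2 : HasDerivAt (fun s : ℝ => fderiv ℝ φ (y + s • w) w)
      (w.ofLp ⬝ᵥ (hessian φ y).mulVec w.ofLp) 0 := by
    have h1 := HasDerivAt.fun_sum (u := Finset.univ) fun i _ =>
      (hasDerivAt_line (differentiableAt_partials h𝒟 hφ hy i) w).mul_const (w i)
    have h2 : ∑ i, fderiv ℝ (fun z => partials φ z i) y w * w i
        = w.ofLp ⬝ᵥ (hessian φ y).mulVec w.ofLp := by
      rw [dotProduct]
      refine Finset.sum_congr rfl fun i _ => ?_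
      rw [mul_comm, clm_apply_eq_sum, Matrix.mulVec, dotProduct]
      congr 1
      refine Finset.sum_congr rfl fun j _ => ?_
      rw [fderiv_partials_single h𝒟 hφ hy, hessian_symm h𝒟 hφ hy, smul_eq_mul, mul_comm]
    rw [h2] at h1
    refine h1.congr_of_eventuallyEq (Eventually.of_forall fun s => ?_)
    simp only [fderiv_eq_partials_dotProduct, dotProduct]
  have h1 : ∀ᶠ s in 𝓝[>] (0 : ℝ), fderiv ℝ φ (y + s • w) w ≤ e * s := by
    have h2 := hd2.tendsto_slope_zero_right.eventually_lt_const (hw.trans_lt he)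
    filter_upwards [h2, self_mem_nhdsWithin] with s hs hs0
    simp only [zero_add, zero_smul, add_zero, hcrit', sub_zero, smul_eq_mul] at hs
    rw [inv_mul_lt_iff₀ hs0] at hs
    linarith
  have h2 : ∀ᶠ s in 𝓝[>] (0 : ℝ), y + s • w ∈ 𝒟 :=
    (eventually_line_mem h𝒟 hy w).filter_mono nhdsWithin_le_nhds
  obtain ⟨r, hr, hr'⟩ := mem_nhdsGT_iff_exists_Ioo_subset.1 (h1.and h2)
  filter_upwards [Ioo_mem_nhdsGT hr] with h hh
  have hin : ∀ s ∈ Icc 0 h, y + s • w ∈ 𝒟 := fun s hs => by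
    rcases hs.1.eq_or_lt with rfl | hs0
    · simpa using hy
    · exact (hr' ⟨hs0, hs.2.trans_lt hh.2⟩).2
  -- The slope along the ray is at most e s ≤ e h, so the mean value inequality gives e h². The
  -- missing factor 1/2 is irrelevant.
  have h3 := (convex_Icc 0 h).image_sub_le_mul_sub_of_deriv_le (C := e * h)
    (f := fun s : ℝ => φ (y + s • w))
    (fun s hs => (hdφ s (hin s hs)).continuousAt.continuousWithinAt)
    (fun s hs => (hdφ s (hin s (interior_subset hs))).differentiableAt.differentiableWithinAt)
    (fun s hs => by
      rw [interior_Icc] at hs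
      rw [(hdφ s (hin s ⟨hs.1.le, hs.2.le⟩)).deriv]
      exact (hr' ⟨hs.1, hs.2.trans hh.2⟩).1.trans (by gcongr; exact hs.2.le))
    0 ⟨le_rfl, hh.1.le⟩ h ⟨hh.1.le, le_rfl⟩ hh.1.le
  simp only [zero_smul, add_zero, h0, sub_zero] at h3
  linarith

/-- The Hessian of the quasipotential is positive in all directions not tangent to the cycle. -/
theorem exists_eq_smul_of_hessian_nonpos (h𝒟 : IsOpen 𝒟) (hφ : ContDiffOn ℝ 2 φ 𝒟)
    {p : ℝ → EuclideanSpace ℝ (Fin n)} {T M ρ : ℝ} (hT : 0 < T) (hper : Function.Periodic p T)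
    (hp : ∀ t, HasDerivAt p (b (p t)) t) (hp𝒟 : range p ⊆ 𝒟) (hφ0 : ∀ y ∈ range p, φ y = 0)
    (hcrit : ∀ y ∈ range p, partials φ y = 0) (hb0 : ∀ y ∈ range p, b y ≠ 0) (hM : 0 < M)
    (hρ : 0 < ρ) (hlow : ∀ y ∈ 𝒟, min (Metric.infDist y (range p)) ρ ^ 2 ≤ M * φ y)
    {y : EuclideanSpace ℝ (Fin n)} (hy : y ∈ range p)
    (hsymm : (hessian φ y).transpose = hessian φ y)
    (hHb : (hessian φ y).mulVec (b y).ofLp = 0) {v : EuclideanSpace ℝ (Fin n)}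
    (hv : v.ofLp ⬝ᵥ (hessian φ y).mulVec v.ofLp ≤ 0) : ∃ c : ℝ, v = c • b y := by
  have hpc : Continuous p := continuous_iff_continuousAt.2 fun t => (hp t).continuousAt
  have hcomp : IsCompact (range p) := by
    rw [← hper.image_Icc hT 0]
    exact isCompact_Icc.image hpc
  have hbn : inner ℝ (b y) (b y) ≠ 0 := inner_self_ne_zero.2 (hb0 y hy)
  -- w is the component of v normal to the cycle. Removing the tangential part leaves the quadratic
  -- form unchanged because the Hessian annihilates b(y).
  set c : ℝ := inner ℝ (b y) v / inner ℝ (b y) (b y) with hc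
  set w : EuclideanSpace ℝ (Fin n) := v - c • b y with hw
  have hbw : inner ℝ (b y) w = 0 := by
    rw [hw, inner_sub_right, inner_smul_right, hc, div_mul_cancel₀ _ hbn, sub_self]
  have hHw : w.ofLp ⬝ᵥ (hessian φ y).mulVec w.ofLp ≤ 0 := by
    have e1 : (hessian φ y).mulVec w.ofLp = (hessian φ y).mulVec v.ofLp := by
      rw [hw, WithLp.ofLp_sub, WithLp.ofLp_smul, Matrix.mulVec_sub, Matrix.mulVec_smul, hHb,
        smul_zero, sub_zero]
    have e2 : (b y).ofLp ⬝ᵥ (hessian φ y).mulVec v.ofLp = 0 := by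
      rw [← hsymm, Matrix.dotProduct_transpose_mulVec, hHb, dotProduct_zero]
    rw [e1, hw, WithLp.ofLp_sub, WithLp.ofLp_smul, sub_dotProduct, smul_dotProduct, e2, smul_zero,
      sub_zero]
    exact hv
  refine ⟨c, sub_eq_zero.1 ?_⟩
  by_contra hw0
  have hwn : 0 < ‖w‖ := norm_pos_iff.2 hw0
  -- The contradiction below reads 12 h η² ≤ 5 h η² with this choice.
  set η := ‖w‖ / 4 with hη
  have hη0 : 0 < η := by positivity
  have h1 := eventually_le_mul_sq h𝒟 hφ (hp𝒟 hy) (hφ0 y hy) (hcrit y hy) hHw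
    (e := η ^ 2 / M) (by positivity)
  have h2 : ∀ᶠ h in 𝓝[>] (0 : ℝ), y + h • w ∈ 𝒟 :=
    (eventually_line_mem h𝒟 (hp𝒟 hy) w).filter_mono nhdsWithin_le_nhds
  -- Below ρ the minimum in the growth estimate must be the distance itself.
  have h3 : ∀ᶠ h in 𝓝[>] (0 : ℝ), η * h < ρ := by
    have : Tendsto (fun h : ℝ => η * h) (𝓝 0) (𝓝 0) := by
      simpa using (continuous_const_mul η).tendsto 0
    exact (this.eventually_lt_const hρ).filter_mono nhdsWithin_le_nhds
  obtain ⟨r, hr, hball⟩ := Metric.eventually_nhds_iff.1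
    (eventually_abs_inner_chord_le hT hper hp (hb0 y hy) hbw hη0)
  have h4 : ∀ᶠ h in 𝓝[>] (0 : ℝ), h * (‖w‖ + η) < r := by
    have : Tendsto (fun h : ℝ => h * (‖w‖ + η)) (𝓝 0) (𝓝 0) := by
      simpa using (continuous_mul_const (‖w‖ + η)).tendsto 0
    exact (this.eventually_lt_const hr).filter_mono nhdsWithin_le_nhds
  obtain ⟨h, hh1, hh2, hh3, hh4, hh0⟩ :=
    (h1.and (h2.and (h3.and (h4.and self_mem_nhdsWithin)))).exists
  have h5 := hlow _ hh2
  have h6 : min (Metric.infDist (y + h • w) (range p)) ρ ^ 2 ≤ (η * h) ^ 2 := by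
    refine h5.trans ((mul_le_mul_of_nonneg_left hh1 hM.le).trans_eq ?_)
    field_simp
  have h7 : Metric.infDist (y + h • w) (range p) ≤ η * h := by
    by_contra! hlt
    exact h6.not_gt (pow_lt_pow_left₀ (lt_min hlt hh3) (by positivity) two_ne_zero)
  -- The nearest point q lies within ηh of y + hw, so the chord q - y has a large component along w.
  -- Yet chords of the cycle near y are almost tangent, hence almost normal to w.
  obtain ⟨q, hq, hqd⟩ := hcomp.exists_infDist_eq_dist (range_nonempty p) (y + h • w)
  rw [hqd, dist_eq_norm] at h7
  have e1 : q - y = h • w - (y + h • w - q) := by abel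
  have hn : ‖q - y‖ ≤ h * (‖w‖ + η) := by
    rw [e1]
    refine (norm_sub_le _ _).trans ?_
    rw [norm_smul, Real.norm_of_nonneg hh0.le]
    linarith
  have h8 := hball (y := q) (by rw [dist_eq_norm]; linarith) hq
  have h9 : h * ‖w‖ ^ 2 - η * h * ‖w‖ ≤ inner ℝ (q - y) w := by
    rw [e1, inner_sub_left, inner_smul_left, real_inner_self_eq_norm_sq]
    have := (real_inner_le_norm (y + h • w - q) w).trans
      (mul_le_mul_of_nonneg_right h7 (norm_nonneg w))
    simp only [conj_trivial]
    linarith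
  have h10 : h * ‖w‖ ^ 2 - η * h * ‖w‖ ≤ η * (h * (‖w‖ + η)) :=
    h9.trans ((le_abs_self _).trans (h8.trans (by gcongr)))
  have h11 : ‖w‖ = 4 * η := by rw [hη]; ring
  rw [h11] at h10
  nlinarith [mul_pos hh0 (mul_pos hη0 hη0)]

end Nondegeneracy

/-! ### The generator applied to exp(φ/ε)χ -/

section Generator

variable {n : ℕ} {b : EuclideanSpace ℝ (Fin n) → EuclideanSpace ℝ (Fin n)}
  {D : Matrix (Fin n) (Fin n) ℝ} {𝒟 : Set (EuclideanSpace ℝ (Fin n))}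
  {φ χ : EuclideanSpace ℝ (Fin n) → ℝ}

/-- The vector field `b + 2 D ∇φ`. -/
noncomputable def fluctuationField (b : EuclideanSpace ℝ (Fin n) → EuclideanSpace ℝ (Fin n))
    (D : Matrix (Fin n) (Fin n) ℝ) (φ : EuclideanSpace ℝ (Fin n) → ℝ)
        (z : EuclideanSpace ℝ (Fin n)) :
    EuclideanSpace ℝ (Fin n) :=
  b z + WithLp.toLp 2 ((2 : ℝ) • D.mulVec (partials φ z))

theorem fluctuationField_apply (z : EuclideanSpace ℝ (Fin n)) (i : Fin n) :
    fluctuationField b D φ z i = b z i + 2 * ∑ j, D i j * partials φ z j := rfl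

theorem contDiffOn_exp_mul {ε : ℝ} {k : WithTop ℕ∞} (hφ : ContDiffOn ℝ k φ 𝒟)
    (hχ : ContDiff ℝ k χ) : ContDiffOn ℝ k (fun z => Real.exp (φ z / ε) * χ z) 𝒟 :=
  (hφ.div_const ε).exp.mul hχ.contDiffOn

theorem partials_exp_mul {ε : ℝ} {z : EuclideanSpace ℝ (Fin n)} (hφ : DifferentiableAt ℝ φ z)
    (hχ : DifferentiableAt ℝ χ z) (i : Fin n) :
    partials (fun z => Real.exp (φ z / ε) * χ z) z i
      = Real.exp (φ z / ε) * (partials χ z i + χ z * partials φ z i / ε) := by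
  have h1 := (((hφ.hasFDerivAt.mul_const ε⁻¹).exp).mul hχ.hasFDerivAt).fderiv
  have h2 : fderiv ℝ (fun z => Real.exp (φ z / ε) * χ z) z
      = fderiv ℝ ((fun z => Real.exp (φ z * ε⁻¹)) * χ) z := rfl
  rw [partials, h2, h1]
  simp only [partials, _root_.add_apply, _root_.smul_apply, smul_eq_mul]
  ring_nf

theorem hessian_exp_mul {ε : ℝ} (h𝒟 : IsOpen 𝒟) (hφ : ContDiffOn ℝ 2 φ 𝒟) (hχ : ContDiff ℝ 2 χ)
    {z : EuclideanSpace ℝ (Fin n)} (hz : z ∈ 𝒟) (k i : Fin n) :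
    hessian (fun z => Real.exp (φ z / ε) * χ z) z k i = Real.exp (φ z / ε) *
      (partials φ z k / ε * (partials χ z i + χ z * partials φ z i / ε) + hessian χ z k i
        + partials χ z k * partials φ z i / ε + χ z * hessian φ z k i / ε) := by
  have hφ1 : ∀ w ∈ 𝒟, DifferentiableAt ℝ φ w := fun w hw =>
    (hφ.contDiffAt (h𝒟.mem_nhds hw)).differentiableAt two_ne_zero
  have hχ1 : ∀ w, DifferentiableAt ℝ χ w := hχ.differentiable two_ne_zero
  have hline := hasDerivAt_line_partials h𝒟 (contDiffOn_exp_mul (ε := ε) hφ hχ) hz i k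
  have hE : HasDerivAt (fun s : ℝ => Real.exp (φ (z + s • EuclideanSpace.single k 1) / ε))
      (Real.exp (φ z / ε) * (partials φ z k / ε)) 0 := by
    simpa [partials] using
      ((hasDerivAt_line (hφ1 z hz) (EuclideanSpace.single k 1)).div_const ε).exp
  have hχl : HasDerivAt (fun s : ℝ => χ (z + s • EuclideanSpace.single k 1)) (partials χ z k) 0 :=
    hasDerivAt_line (hχ1 z) _
  have hd := hE.mul ((hasDerivAt_line_partials h𝒟 hχ.contDiffOn hz i k).add
    ((hχl.mul (hasDerivAt_line_partials h𝒟 hφ hz i k)).div_const ε))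
  rw [hline.unique (hd.congr_of_eventuallyEq (by
    filter_upwards [eventually_line_mem h𝒟 hz (EuclideanSpace.single k 1)] with s hs
    exact partials_exp_mul (hφ1 _ hs) (hχ1 _) i))]
  simp only [zero_smul, add_zero, Pi.add_apply, Pi.mul_apply]
  ring

/-- Conjugating the generator by exp(φ/ε) yields a single singular term, χ/ε times the Hamiltonian,
which vanishes. The cross terms in ∇χ and ∇φ double the gradient drift to b + 2D∇φ. -/
theorem fderiv_exp_mul_add_frobenius (hD : D.PosDef) {ε : ℝ} (hε : ε ≠ 0) (h𝒟 : IsOpen 𝒟)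
    (hφ : ContDiffOn ℝ 2 φ 𝒟) (hχ : ContDiff ℝ 2 χ) {z : EuclideanSpace ℝ (Fin n)} (hz : z ∈ 𝒟)
    (hHJ : hamiltonian b D φ z = 0) :
    fderiv ℝ (fun z => Real.exp (φ z / ε) * χ z) z (b z)
        + ε * frobenius D (hessian (fun z => Real.exp (φ z / ε) * χ z) z)
      = Real.exp (φ z / ε) * (fderiv ℝ χ z (fluctuationField b D φ z)
        + χ z * frobenius D (hessian φ z) + ε * frobenius D (hessian χ z)) := by
  have hsymm : ∀ i j, D i j = D j i := fun i j => congrFun (congrFun (isSymm_of_posDef hD) j) i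
  set E := Real.exp (φ z / ε)
  set P := partials φ z
  set X := partials χ z
  have hψ : ∀ i, partials (fun z => Real.exp (φ z / ε) * χ z) z i = E * (X i + χ z * P i / ε) :=
    partials_exp_mul ((hφ.contDiffAt (h𝒟.mem_nhds hz)).differentiableAt two_ne_zero)
      (hχ.differentiable two_ne_zero z)
  have e1 : fderiv ℝ (fun z => Real.exp (φ z / ε) * χ z) z (b z)
      = E * (∑ i, X i * b z i + χ z / ε * ∑ i, P i * b z i) := by
    rw [fderiv_eq_partials_dotProduct, dotProduct]
    simp only [hψ, Finset.mul_sum, ← Finset.sum_add_distrib]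
    refine Finset.sum_congr rfl fun i _ => ?_
    ring
  have e2 : frobenius D (hessian (fun z => Real.exp (φ z / ε) * χ z) z)
      = E * ((∑ i, ∑ j, D i j * (P i * X j)) / ε + χ z / ε ^ 2 * (∑ i, ∑ j, D i j * (P i * P j))
        + frobenius D (hessian χ z) + (∑ i, ∑ j, D i j * (X i * P j)) / ε
        + χ z / ε * frobenius D (hessian φ z)) := by
    simp only [frobenius, hessian_exp_mul h𝒟 hφ hχ hz, Finset.mul_sum, Finset.sum_div,
      ← Finset.sum_add_distrib]
    refine Finset.sum_congr rfl fun i _ => Finset.sum_congr rfl fun j _ => ?_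
    simp only [E, P, X]
    field_simp
  have e3 : ∑ i, ∑ j, D i j * (P i * X j) = ∑ i, ∑ j, D i j * (X i * P j) := by
    rw [Finset.sum_comm]
    refine Finset.sum_congr rfl fun i _ => Finset.sum_congr rfl fun j _ => ?_
    rw [hsymm j i]; ring
  have e4 : fderiv ℝ χ z (fluctuationField b D φ z)
      = ∑ i, X i * b z i + 2 * ∑ i, ∑ j, D i j * (X i * P j) := by
    rw [fderiv_eq_partials_dotProduct, dotProduct]
    simp only [fluctuationField_apply, Finset.mul_sum, mul_add, Finset.sum_add_distrib]
    congr 1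
    refine Finset.sum_congr rfl fun i _ => Finset.sum_congr rfl fun j _ => ?_
    ring
  have e5 : (∑ i, P i * b z i) + ∑ i, ∑ j, D i j * (P i * P j) = 0 := by
    rw [hamiltonian, fderiv_eq_partials_dotProduct, dotProduct, dotProduct] at hHJ
    rw [← hHJ]
    congr 1
    refine Finset.sum_congr rfl fun i _ => ?_
    rw [Matrix.mulVec, dotProduct, Finset.mul_sum]
    refine Finset.sum_congr rfl fun j _ => ?_
    ring
  have e6 : ∑ i, ∑ j, D i j * (P i * P j) = -∑ i, P i * b z i := by linarith
  rw [e1, e2, e3, e4, e6]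
  field_simp
  ring

theorem fderiv_eq_zero_of_eventuallyEq {z : EuclideanSpace ℝ (Fin n)} (h : χ =ᶠ[𝓝 z] 0) :
    fderiv ℝ χ z = 0 := by
  rw [h.fderiv_eq]
  exact fderiv_const_apply 0

theorem hessian_eq_zero_of_eventuallyEq {z : EuclideanSpace ℝ (Fin n)}
    (h : χ =ᶠ[𝓝 z] 0) : hessian χ z = 0 := by
  have h1 : fderiv ℝ χ =ᶠ[𝓝 z] fun _ => 0 := by
    filter_upwards [h.eventually_nhds] with w hw
    exact fderiv_eq_zero_of_eventuallyEq hw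
  ext i j
  simp only [hessian, Matrix.of_apply, h1.fderiv_eq]
  simp

theorem frobenius_zero_right : frobenius D 0 = 0 := by simp [frobenius]

theorem continuous_frobenius_hessian (hχ : ContDiff ℝ 2 χ) :
    Continuous fun z => frobenius D (hessian χ z) := by
  have h1 : Continuous (fderiv ℝ (fderiv ℝ χ)) :=
    (hχ.fderiv_right (m := 1) (by norm_num)).continuous_fderiv one_ne_zero
  unfold frobenius
  refine continuous_finsetSum _ fun i _ => continuous_finsetSum _ fun j _ =>
    continuous_const.mul ?_
  exact (h1.clm_apply continuous_const).clm_apply continuous_const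

theorem continuousOn_frobenius_hessian (h𝒟 : IsOpen 𝒟) (hφ : ContDiffOn ℝ 2 φ 𝒟) :
    ContinuousOn (fun z => frobenius D (hessian φ z)) 𝒟 := by
  have h1 : ContinuousOn (fderiv ℝ (fderiv ℝ φ)) 𝒟 :=
    (hφ.fderiv_of_isOpen (m := 1) h𝒟 (by norm_num)).continuousOn_fderiv_of_isOpen h𝒟 le_rfl
  unfold frobenius
  refine continuousOn_finsetSum _ fun i _ => continuousOn_finsetSum _ fun j _ =>
    continuousOn_const.mul ?_
  exact (h1.clm_apply continuousOn_const).clm_apply continuousOn_const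

theorem continuousOn_fluctuationField (h𝒟 : IsOpen 𝒟) (hb : Continuous b)
    (hφ : ContDiffOn ℝ 1 φ 𝒟) : ContinuousOn (fluctuationField b D φ) 𝒟 := by
  have h1 : Continuous fun p : Fin n → ℝ => WithLp.toLp 2 ((2 : ℝ) • D.mulVec p) := by
    unfold Matrix.mulVec dotProduct; fun_prop
  exact hb.continuousOn.add (h1.comp_continuousOn (continuousOn_partials h𝒟 hφ))

end Generator

/-! ### The transport equation for the prefactor -/

section Transport

variable {n : ℕ} {b : EuclideanSpace ℝ (Fin n) → EuclideanSpace ℝ (Fin n)}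
  {D : Matrix (Fin n) (Fin n) ℝ} {𝒟 : Set (EuclideanSpace ℝ (Fin n))}
  {φ χ ω : EuclideanSpace ℝ (Fin n) → ℝ}

theorem contDiff_of_tsupport_subset {k : WithTop ℕ∞} {f : EuclideanSpace ℝ (Fin n) → ℝ}
    (h𝒟 : IsOpen 𝒟)
    (hf : ContDiffOn ℝ k f 𝒟) (hs : tsupport f ⊆ 𝒟) : ContDiff ℝ k f := by
  refine contDiff_iff_contDiffAt.2 fun z => ?_
  by_cases hz : z ∈ tsupport f
  · exact hf.contDiffAt (h𝒟.mem_nhds (hs hz))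
  · exact contDiffAt_const.congr_of_eventuallyEq (notMem_tsupport_iff_eventuallyEq.1 hz)

theorem integrable_mul_of_tsupport_subset {f g : EuclideanSpace ℝ (Fin n) → ℝ} (h𝒟 : IsOpen 𝒟)
    (hf : ContinuousOn f 𝒟)
    (hg : Continuous g) (hgc : HasCompactSupport g) (hs : tsupport g ⊆ 𝒟) :
    Integrable (fun z => f z * g z) := by
  refine Continuous.integrable_of_hasCompactSupport ?_ hgc.mul_left
  refine continuous_of_tsupport fun z hz => ?_
  exact (hf.continuousAt (h𝒟.mem_nhds (hs (tsupport_mul_subset_right hz)))).mul hg.continuousAt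

/-- The leading order of the stationary equation, in weak form. -/
theorem integral_prefactor_mul_eq_zero (hD : D.PosDef) (h𝒟 : IsOpen 𝒟) (hb : Continuous b)
    (hφ : ContDiffOn ℝ 2 φ 𝒟) (hHJ : ∀ z ∈ 𝒟, hamiltonian b D φ z = 0) (hω : ContinuousOn ω 𝒟)
    {ρ : ℝ → EuclideanSpace ℝ (Fin n) → ℝ} {a : ℝ → ℝ} (hW : IsStationaryWKB b D 𝒟 φ ω ρ a)
    (hχ : ContDiff ℝ 2 χ)
    (hχc : HasCompactSupport χ) (hχ𝒟 : tsupport χ ⊆ 𝒟) :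
    ∫ z, ω z * (fderiv ℝ χ z (fluctuationField b D φ z) + χ z * frobenius D (hessian φ z)) = 0 := by
  set K := tsupport χ with hKdef
  have hK : IsCompact K := hχc
  set G : EuclideanSpace ℝ (Fin n) → ℝ := fun z =>
    fderiv ℝ χ z (fluctuationField b D φ z) + χ z * frobenius D (hessian φ z) with hG
  set F : EuclideanSpace ℝ (Fin n) → ℝ := fun z => frobenius D (hessian χ z) with hF
  have hGc : ContinuousOn G 𝒟 :=
    ((hχ.continuous_fderiv two_ne_zero).continuousOn.clm_apply
      (continuousOn_fluctuationField h𝒟 hb (hφ.of_le (by norm_num)))).add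
      (hχ.continuous.continuousOn.mul (continuousOn_frobenius_hessian h𝒟 hφ))
  have hG0 : ∀ z ∉ K, G z = 0 := fun z hz => by
    have h1 := notMem_tsupport_iff_eventuallyEq.1 hz
    have h2 := fderiv_eq_zero_of_eventuallyEq h1
    simp [hG, h2, h1.self_of_nhds]
  obtain ⟨Gm, hGm⟩ := hK.exists_bound_of_continuousOn (hGc.mono hχ𝒟)
  obtain ⟨Fm, hFm⟩ := hK.exists_bound_of_continuousOn
    (continuous_frobenius_hessian (D := D) hχ).continuousOn
  obtain ⟨W, hW'⟩ := hK.exists_bound_of_continuousOn (hω.mono hχ𝒟)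
  obtain ⟨ε₁, hε₁, hinv⟩ := hW.invariant
  obtain ⟨C, ε₂, hε₂, hexp⟩ := hW.expansion K hχ𝒟 hK
  have hωG : Integrable fun z => ω z * G z := by
    refine Continuous.integrable_of_hasCompactSupport (continuous_of_tsupport fun z hz => ?_)
      (HasCompactSupport.intro hK fun z hz => by rw [hG0 z hz, mul_zero])
    have hz𝒟 : z ∈ 𝒟 := hχ𝒟 (closure_minimal (fun w hw => by
      by_contra hwK
      exact hw (by simp [hG0 w hwK])) hK.isClosed hz)
    exact (hω.mul hGc).continuousAt (h𝒟.mem_nhds hz𝒟)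
  -- The constants come from |eʳ - 1| ≤ 2|C|ε and eʳ ≤ 3, which hold when |r| ≤ |C|ε ≤ 1.
  set B := W * (2 * |C|) * Gm + W * 3 * Fm with hB
  have hbound : ∀ ε, 0 < ε → ε < ε₁ → ε < ε₂ → |C| * ε ≤ 1 →
      ‖∫ z, ω z * G z‖ ≤ ε * (B * volume.real K) := fun ε hε h1 h2 h3 => by
    obtain ⟨ha, hρ⟩ := hinv ε hε h1
    -- This test function cancels the exponentially small factor of the density, so the integrand
    -- has a limit of order one.
    set ψ : EuclideanSpace ℝ (Fin n) → ℝ := fun z => Real.exp (φ z / ε) * χ z with hψ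
    set Lψ : EuclideanSpace ℝ (Fin n) → ℝ := fun z => fderiv ℝ ψ z (b z) + ε * frobenius D (hessian ψ z) with hLψ
    have hψs : tsupport ψ ⊆ K := tsupport_mul_subset_right
    have hψ2 : ContDiff ℝ 2 ψ :=
      contDiff_of_tsupport_subset h𝒟 (contDiffOn_exp_mul hφ hχ) (hψs.trans hχ𝒟)
    have hψc : HasCompactSupport ψ := hχc.mul_left
    have hstat := hρ.stationary ψ hψ2 hψc
    have hLψ0 : ∀ z ∉ K, Lψ z = 0 := fun z hz => by
      have h1 := notMem_tsupport_iff_eventuallyEq.1 (fun h => hz (hψs h))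
      have h2 := fderiv_eq_zero_of_eventuallyEq h1
      simp [hLψ, h2, hessian_eq_zero_of_eventuallyEq h1, frobenius_zero_right]
    have hLψc : Continuous Lψ :=
      ((hψ2.continuous_fderiv two_ne_zero).clm_apply hb).add
        (continuous_const.mul (continuous_frobenius_hessian hψ2))
    obtain ⟨Lm, hLm⟩ := hK.exists_bound_of_continuousOn hLψc.continuousOn
    have hρL : Integrable fun z => ρ ε z * Lψ z :=
      hρ.integrable.mul_bdd (c := max Lm 0) hLψc.aestronglyMeasurable
        (Eventually.of_forall fun z => by
          by_cases hz : z ∈ K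
          · exact (hLm z hz).trans (le_max_left _ _)
          · rw [hLψ0 z hz, norm_zero]; exact le_max_right _ _)
    -- The subtracted term integrates to 0 by stationarity. The difference is O(ε) uniformly on K
    -- and vanishes off K.
    set q : EuclideanSpace ℝ (Fin n) → ℝ := fun z => ω z * G z - (a ε)⁻¹ * (ρ ε z * Lψ z) with hq
    have hqint : ∫ z, q z = ∫ z, ω z * G z := by
      rw [hq, integral_sub hωG (hρL.const_mul _), integral_const_mul]
      have : ∫ z, ρ ε z * Lψ z = 0 := hstat
      rw [this, mul_zero, sub_zero]
    have hq0 : ∀ z ∉ K, q z = 0 := fun z hz => by simp [hq, hG0 z hz, hLψ0 z hz]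
    have hqK : ∀ z ∈ K, ‖q z‖ ≤ ε * B := fun z hz => by
      obtain ⟨r, hr, hρz⟩ := hexp ε hε h2 z hz
      have hωz := hW.prefactor_pos z (hχ𝒟 hz)
      have e1 : Lψ z = Real.exp (φ z / ε) * (G z + ε * F z) :=
        fderiv_exp_mul_add_frobenius hD hε.ne' h𝒟 hφ hχ (hχ𝒟 hz) (hHJ z (hχ𝒟 hz))
      have e2 : (a ε)⁻¹ * (ρ ε z * Lψ z) = ω z * Real.exp r * (G z + ε * F z) := by
        rw [hρz, e1, Real.exp_add, Real.exp_add, Real.exp_log hωz]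
        have e3 : Real.exp (-φ z / ε) * Real.exp (φ z / ε) = 1 := by
          rw [← Real.exp_add, ← Real.exp_zero]; congr 1; ring
        calc _ = ((a ε)⁻¹ * a ε) * (Real.exp (-φ z / ε) * Real.exp (φ z / ε))
              * (ω z * Real.exp r * (G z + ε * F z)) := by ring
          _ = _ := by rw [e3, inv_mul_cancel₀ ha.ne', one_mul, one_mul]
      have hr1 : |r| ≤ |C| * ε := hr.trans (mul_le_mul_of_nonneg_right (le_abs_self C) hε.le)
      have hr2 := Real.abs_exp_sub_one_le (hr1.trans h3)
      have hr3 : Real.exp r ≤ 3 := by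
        have := (abs_le.1 hr2).2
        linarith
      have hr4 : |Real.exp r - 1| ≤ 2 * |C| * ε := by linarith
      have e3 : q z = -(ω z * (Real.exp r - 1) * G z) - ε * (ω z * Real.exp r * F z) := by
        simp only [hq, e2]; ring
      rw [e3]
      have hWz := hW' z hz
      have hGz := hGm z hz
      have hFz := hFm z hz
      have hW0 : 0 ≤ W := (norm_nonneg _).trans hWz
      calc _ ≤ ‖-(ω z * (Real.exp r - 1) * G z)‖ + ‖ε * (ω z * Real.exp r * F z)‖ := norm_sub_le _ _
        _ = ‖ω z‖ * |Real.exp r - 1| * ‖G z‖ + ε * (‖ω z‖ * Real.exp r * ‖F z‖) := by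
            rw [norm_neg]
            simp only [norm_mul, Real.norm_eq_abs, Real.abs_exp, abs_of_pos hε]
        _ ≤ W * (2 * |C| * ε) * Gm + ε * (W * 3 * Fm) := by gcongr
        _ = ε * B := by rw [hB]; ring
    rw [← hqint, ← setIntegral_eq_integral_of_forall_compl_eq_zero hq0]
    refine (norm_setIntegral_le_of_norm_le_const hK.measure_lt_top hqK).trans_eq ?_
    ring
  have hlim : Tendsto (fun ε : ℝ => ε * (B * volume.real K)) (𝓝[>] 0) (𝓝 0) := by
    have : Tendsto (fun ε : ℝ => ε * (B * volume.real K)) (𝓝 0) (𝓝 0) := by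
      simpa using (continuous_mul_const (B * volume.real K)).tendsto 0
    exact this.mono_left nhdsWithin_le_nhds
  have hC : ∀ᶠ ε in 𝓝[>] (0 : ℝ), |C| * ε ≤ 1 := by
    have : Tendsto (fun ε : ℝ => |C| * ε) (𝓝 0) (𝓝 0) := by
      simpa using (continuous_const_mul |C|).tendsto 0
    exact ((this.eventually_lt_const one_pos).mono fun _ h => h.le).filter_mono nhdsWithin_le_nhds
  refine norm_le_zero_iff.1 (ge_of_tendsto hlim ?_)
  filter_upwards [Ioo_mem_nhdsGT hε₁, Ioo_mem_nhdsGT hε₂, hC] with ε h1 h2 h3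
  exact hbound ε h1.1 h1.2 h2.2 h3

/-- The divergence of `b + 2 D ∇φ`. -/
theorem fderiv_fluctuationField_apply (h𝒟 : IsOpen 𝒟) (hb𝒟 : ContDiffOn ℝ 1 b 𝒟)
    (hφ : ContDiffOn ℝ 2 φ 𝒟) {z : EuclideanSpace ℝ (Fin n)} (hz : z ∈ 𝒟) (i : Fin n) :
    fderiv ℝ (fun w => fluctuationField b D φ w i) z (EuclideanSpace.single i 1)
      = jacobian b z i i + 2 * ∑ j, D i j * hessian φ z i j := by
  simp only [fluctuationField_apply]
  have h := hasDerivAt_line (z := z)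
    (f := fun w => b w i + 2 * ∑ j, D i j * partials φ w j)
    ((differentiableAt_apply h𝒟 hb𝒟 hz i).add ((DifferentiableAt.fun_sum fun j _ =>
      (differentiableAt_partials h𝒟 hφ hz j).const_mul (D i j)).const_mul 2))
    (EuclideanSpace.single i 1)
  exact h.unique ((hasDerivAt_line_field h𝒟 hb𝒟 hz i i).add
    ((HasDerivAt.fun_sum fun j _ => (hasDerivAt_line_partials h𝒟 hφ hz j i).const_mul
      (D i j)).const_mul 2))

theorem contDiffOn_fluctuationField_apply (h𝒟 : IsOpen 𝒟) (hb𝒟 : ContDiffOn ℝ 1 b 𝒟)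
    (hφ : ContDiffOn ℝ 2 φ 𝒟) (i : Fin n) :
    ContDiffOn ℝ 1 (fun w => fluctuationField b D φ w i) 𝒟 := by
  have h1 : ContDiffOn ℝ 1 (fun w => b w i) 𝒟 :=
    (EuclideanSpace.proj i : EuclideanSpace ℝ (Fin n) →L[ℝ] ℝ).contDiff.comp_contDiffOn hb𝒟
  simp only [fluctuationField_apply]
  exact h1.add (contDiffOn_const.mul (ContDiffOn.sum fun j _ =>
    contDiffOn_const.mul (contDiffOn_partials (m := 1) h𝒟 hφ (by norm_num) j)))

/-- The transport equation for the prefactor. -/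
theorem transport_equation (hD : D.PosDef) (h𝒟 : IsOpen 𝒟) (hb : Continuous b)
    (hb𝒟 : ContDiffOn ℝ 1 b 𝒟) (hφ : ContDiffOn ℝ 2 φ 𝒟)
    (hHJ : ∀ z ∈ 𝒟, hamiltonian b D φ z = 0) (hω : ContDiffOn ℝ 1 ω 𝒟)
    {ρ : ℝ → EuclideanSpace ℝ (Fin n) → ℝ} {a : ℝ → ℝ} (hW : IsStationaryWKB b D 𝒟 φ ω ρ a)
    {y : EuclideanSpace ℝ (Fin n)} (hy : y ∈ 𝒟) :
    fderiv ℝ ω y (fluctuationField b D φ y)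
      = -(ω y * (divergence b y + frobenius D (hessian φ y))) := by
  set J : Fin n → EuclideanSpace ℝ (Fin n) → ℝ := fun i z => ω z * fluctuationField b D φ z i with hJ
  have hJ1 : ∀ i, ContDiffOn ℝ 1 (J i) 𝒟 := fun i =>
    -- The residual R defined next is the strong form of the transport equation, with the weak
    -- derivative moved onto the flux J = ω(b + 2D∇φ).
    hω.mul (contDiffOn_fluctuationField_apply h𝒟 hb𝒟 hφ i)
  set R : EuclideanSpace ℝ (Fin n) → ℝ := fun z => ω z * frobenius D (hessian φ z)
    - ∑ i, fderiv ℝ (J i) z (EuclideanSpace.single i 1) with hR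
  have hJ' : ∀ i, ContinuousOn (fun z => fderiv ℝ (J i) z (EuclideanSpace.single i 1)) 𝒟 :=
    fun i => ((hJ1 i).continuousOn_fderiv_of_isOpen h𝒟 le_rfl).clm_apply continuousOn_const
  have hωH : ContinuousOn (fun z => ω z * frobenius D (hessian φ z)) 𝒟 :=
    hω.continuousOn.mul (continuousOn_frobenius_hessian h𝒟 hφ)
  have hRc : ContinuousOn R 𝒟 := hωH.sub (continuousOn_finsetSum _ fun i _ => hJ' i)
  have hweak : ∀ χ : EuclideanSpace ℝ (Fin n) → ℝ, ContDiff ℝ (⊤ : ℕ∞) χ → HasCompactSupport χ → tsupport χ ⊆ 𝒟 →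
      ∫ z, χ z • R z = 0 := fun χ hχ hχc hχ𝒟 => by
    have hχ2 : ContDiff ℝ 2 χ := contDiff_infty.1 hχ 2
    have h0 := integral_prefactor_mul_eq_zero hD h𝒟 hb hφ hHJ hω.continuousOn hW hχ2 hχc hχ𝒟
    have hχ1c : ∀ i : Fin n, Continuous fun z => fderiv ℝ χ z (EuclideanSpace.single i 1) :=
      fun i => (hχ2.continuous_fderiv two_ne_zero).clm_apply continuous_const
    have hχ1s : ∀ i : Fin n, HasCompactSupport fun z => fderiv ℝ χ z (EuclideanSpace.single i 1) :=
      fun i => hχc.fderiv_apply ℝ _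
    have hχ1t : ∀ i : Fin n, tsupport (fun z => fderiv ℝ χ z (EuclideanSpace.single i 1)) ⊆ 𝒟 :=
      fun i => (tsupport_fderiv_apply_subset ℝ _).trans hχ𝒟
    have hint1 : ∀ i, Integrable fun z => fderiv ℝ (J i) z (EuclideanSpace.single i 1) * χ z :=
      fun i => integrable_mul_of_tsupport_subset h𝒟 (hJ' i) hχ.continuous hχc hχ𝒟
    have hint2 : ∀ i, Integrable fun z => J i z * fderiv ℝ χ z (EuclideanSpace.single i 1) :=
      fun i => integrable_mul_of_tsupport_subset h𝒟 (hJ1 i).continuousOn (hχ1c i) (hχ1s i) (hχ1t i)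
    have hint3 : Integrable fun z => (ω z * frobenius D (hessian φ z)) * χ z :=
      integrable_mul_of_tsupport_subset h𝒟 hωH hχ.continuous hχc hχ𝒟
    have hparts : ∀ i, ∫ z, J i z * fderiv ℝ χ z (EuclideanSpace.single i 1)
        = -∫ z, fderiv ℝ (J i) z (EuclideanSpace.single i 1) * χ z := fun i =>
      integral_mul_fderiv_eq_neg_fderiv_mul_of_integrable (hint1 i) (hint2 i)
        (integrable_mul_of_tsupport_subset h𝒟 (hJ1 i).continuousOn hχ.continuous hχc hχ𝒟)
        (fun z hz => ((hJ1 i).contDiffAt (h𝒟.mem_nhds (hχ𝒟 hz))).differentiableAt one_ne_zero)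
        (fun z _ => hχ2.differentiable two_ne_zero z)
    have e1 : ∀ z, ω z * (fderiv ℝ χ z (fluctuationField b D φ z)
        + χ z * frobenius D (hessian φ z))
        = (∑ i, J i z * fderiv ℝ χ z (EuclideanSpace.single i 1))
          + (ω z * frobenius D (hessian φ z)) * χ z := fun z => by
      rw [clm_apply_eq_sum, mul_add, Finset.mul_sum]
      congr 1
      · exact Finset.sum_congr rfl fun i _ => by simp only [hJ, smul_eq_mul]; ring
      · ring
    have e2 : ∀ z, χ z • R z = (ω z * frobenius D (hessian φ z)) * χ z
        - ∑ i, fderiv ℝ (J i) z (EuclideanSpace.single i 1) * χ z := fun z => by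
      rw [smul_eq_mul, hR, mul_sub, Finset.mul_sum, mul_comm]
      congr 1
      exact Finset.sum_congr rfl fun i _ => mul_comm _ _
    simp only [e1] at h0
    rw [integral_add (integrable_finsetSum _ fun i _ => hint2 i) hint3,
      integral_finsetSum _ fun i _ => hint2 i] at h0
    simp only [e2]
    rw [integral_sub hint3 (integrable_finsetSum _ fun i _ => hint1 i),
      integral_finsetSum _ fun i _ => hint1 i]
    simp only [hparts, Finset.sum_neg_distrib] at h0
    linarith
  -- The fundamental lemma of the calculus of variations gives R = 0 almost everywhere on 𝒟.
  -- Continuity upgrades this to every point of 𝒟.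
  have hae := h𝒟.ae_eq_zero_of_integral_contDiff_smul_eq_zero
    (hRc.locallyIntegrableOn (μ := volume) h𝒟.measurableSet) hweak
  have hR0 : EqOn R (fun _ => 0) 𝒟 := Measure.eqOn_open_of_ae_eq
    ((ae_restrict_iff' h𝒟.measurableSet).2 hae) h𝒟 hRc continuousOn_const
  have hRy : R y = 0 := hR0 hy
  have hωd : DifferentiableAt ℝ ω y :=
    (hω.contDiffAt (h𝒟.mem_nhds hy)).differentiableAt one_ne_zero
  have hJd : ∀ i, fderiv ℝ (J i) y (EuclideanSpace.single i 1)
      = ω y * (jacobian b y i i + 2 * ∑ j, D i j * hessian φ y i j)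
        + fluctuationField b D φ y i * fderiv ℝ ω y (EuclideanSpace.single i 1) := fun i => by
    have h1 := ((contDiffOn_fluctuationField_apply (D := D) h𝒟 hb𝒟 hφ i).contDiffAt
      (h𝒟.mem_nhds hy)).differentiableAt one_ne_zero
    rw [hJ, (hωd.hasFDerivAt.fun_mul h1.hasFDerivAt).fderiv]
    simp only [_root_.add_apply, _root_.smul_apply, smul_eq_mul,
      fderiv_fluctuationField_apply h𝒟 hb𝒟 hφ hy]
  -- The divergence of b + 2D∇φ contains D : ∇∇φ twice. The zeroth-order term of R cancels one copy.
  have e3 : ∑ i, fderiv ℝ (J i) y (EuclideanSpace.single i 1)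
      = ω y * (divergence b y + 2 * frobenius D (hessian φ y))
        + fderiv ℝ ω y (fluctuationField b D φ y) := by
    rw [clm_apply_eq_sum (fderiv ℝ ω y)]
    simp only [hJd, Finset.sum_add_distrib, ← Finset.mul_sum, smul_eq_mul]
    rfl
  rw [hR] at hRy
  simp only [e3] at hRy
  linarith

theorem gradient_ofLp_eq_partials (z : EuclideanSpace ℝ (Fin n)) :
    (gradient φ z).ofLp = partials φ z := by
  ext i
  have h := InnerProductSpace.toDual_symm_apply (𝕜 := ℝ) (x := EuclideanSpace.single i (1 : ℝ))
    (y := fderiv ℝ φ z)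
  rw [EuclideanSpace.inner_single_right] at h
  simpa [gradient, partials] using h

theorem divergence_circulation (h𝒟 : IsOpen 𝒟) (hb𝒟 : ContDiffOn ℝ 1 b 𝒟)
    (hφ : ContDiffOn ℝ 2 φ 𝒟) {z : EuclideanSpace ℝ (Fin n)} (hz : z ∈ 𝒟) :
    divergence (circulation b D φ) z = divergence b z + frobenius D (hessian φ z) := by
  have happ : ∀ i, (fun w => circulation b D φ w i)
      = fun w => b w i + ∑ j, D i j * partials φ w j := fun i => by
    ext w
    simp only [circulation, gradient_ofLp_eq_partials]
    rfl
  have hd : ∀ i, DifferentiableAt ℝ (fun w => circulation b D φ w i) z := fun i => by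
    rw [happ]
    exact (differentiableAt_apply h𝒟 hb𝒟 hz i).add (DifferentiableAt.fun_sum fun j _ =>
      (differentiableAt_partials h𝒟 hφ hz j).const_mul (D i j))
  have hD' : DifferentiableAt ℝ (circulation b D φ) z := differentiableAt_euclidean.2 hd
  have hcomp : ∀ i, fderiv ℝ (circulation b D φ) z (EuclideanSpace.single i 1) i
      = jacobian b z i i + ∑ j, D i j * hessian φ z i j := fun i => by
    have h1 : fderiv ℝ (fun w => circulation b D φ w i) z
        = (EuclideanSpace.proj i : EuclideanSpace ℝ (Fin n) →L[ℝ] ℝ).comp (fderiv ℝ (circulation b D φ) z) :=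
      ((EuclideanSpace.proj i : EuclideanSpace ℝ (Fin n) →L[ℝ] ℝ).hasFDerivAt.comp z hD'.hasFDerivAt).fderiv
    have h2 := hasDerivAt_line (hd i) (EuclideanSpace.single i 1)
    rw [h1] at h2
    refine h2.unique ?_
    have h3 : (fun s : ℝ => circulation b D φ (z + s • EuclideanSpace.single i 1) i)
        = fun s => b (z + s • EuclideanSpace.single i 1) i
          + ∑ j, D i j * partials φ (z + s • EuclideanSpace.single i 1) j :=
      funext fun s => congrFun (happ i) _
    rw [h3]
    exact (hasDerivAt_line_field h𝒟 hb𝒟 hz i i).add (HasDerivAt.fun_sum fun j _ =>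
      (hasDerivAt_line_partials h𝒟 hφ hz j i).const_mul (D i j))
  simp only [divergence, hcomp, Finset.sum_add_distrib]
  rfl

end Transport

/-! ### Householder reflections and orthonormal frames -/

section Frames

variable {N : ℕ}

/-- The Householder reflection along `w` (the identity if `w = 0`). -/
noncomputable def householder (w : Fin N → ℝ) : Matrix (Fin N) (Fin N) ℝ :=
  1 - (2 / (w ⬝ᵥ w)) • Matrix.vecMulVec w w

theorem householder_transpose_mul_self (w : Fin N → ℝ) :
    (householder w).transpose * householder w = 1 := by
  have h1 : (householder w).transpose = householder w := by
    simp [householder, Matrix.transpose_vecMulVec]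
  have h2 : Matrix.vecMulVec w w * Matrix.vecMulVec w w = (w ⬝ᵥ w) • Matrix.vecMulVec w w := by
    rw [Matrix.vecMulVec_mul_vecMulVec, Matrix.vecMulVec_smul]
  -- For w = 0 division by zero returns 0 and the identity is trivial.
  have h3 : 2 / (w ⬝ᵥ w) * (2 / (w ⬝ᵥ w) * (w ⬝ᵥ w)) = 2 / (w ⬝ᵥ w) + 2 / (w ⬝ᵥ w) := by
    by_cases h : w ⬝ᵥ w = 0
    · simp [h]
    · field_simp; norm_num
  rw [h1, householder]
  simp only [sub_mul, mul_sub, one_mul, mul_one, smul_mul_assoc, mul_smul_comm, h2, smul_smul]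
  rw [smul_sub, smul_smul, h3, add_smul]
  abel

/-- Vectors of equal length are exchanged by the reflection in their bisecting hyperplane. If they
coincide, the matrix is the identity. -/
theorem householder_sub_mulVec {a c : Fin N → ℝ} (h : a ⬝ᵥ a = c ⬝ᵥ c) :
    (householder (a - c)).mulVec a = c := by
  have h1 : (a - c) ⬝ᵥ (a - c) = 2 * ((a - c) ⬝ᵥ a) := by
    simp only [sub_dotProduct, dotProduct_sub, dotProduct_comm c a]
    linarith
  simp only [householder, Matrix.sub_mulVec, Matrix.one_mulVec, Matrix.smul_mulVec,
    Matrix.vecMulVec_mulVec]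
  by_cases h0 : (a - c) ⬝ᵥ (a - c) = 0
  · have : a - c = 0 := dotProduct_self_eq_zero.1 h0
    rw [this, sub_eq_zero.1 this]; simp
  · have h2 : (a - c) ⬝ᵥ a ≠ 0 := fun h => h0 (by rw [h1, h, mul_zero])
    ext i
    simp only [Pi.sub_apply, Pi.smul_apply, smul_eq_mul, h1, MulOpposite.smul_eq_mul_unop,
      MulOpposite.unop_op]
    field_simp
    ring

/-- The condition w t ≠ 0 is why the frame construction needs one fixed unit vector that the tangent
direction never meets. -/
theorem differentiableAt_householder {w : ℝ → Fin N → ℝ} {t : ℝ} (hw0 : w t ≠ 0)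
    (hw : ∀ i, DifferentiableAt ℝ (fun s => w s i) t) (i j : Fin N) :
    DifferentiableAt ℝ (fun s => householder (w s) i j) t := by
  have h1 : DifferentiableAt ℝ (fun s => w s ⬝ᵥ w s) t :=
    DifferentiableAt.fun_sum fun k _ => (hw k).mul (hw k)
  have h2 : w t ⬝ᵥ w t ≠ 0 := fun h => hw0 (dotProduct_self_eq_zero.1 h)
  have h3 : (fun s => householder (w s) i j)
      = fun s => (1 : Matrix (Fin N) (Fin N) ℝ) i j - 2 / (w s ⬝ᵥ w s) * (w s i * w s j) := by
    ext s
    simp [householder, Matrix.vecMulVec_apply]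
  rw [h3]
  exact (differentiableAt_const _).sub (((differentiableAt_const _).div h1 h2).mul
    ((hw i).mul (hw j)))

variable {m : ℕ}

theorem dotProduct_ofLp_self_of_norm_one {u : EuclideanSpace ℝ (Fin (m + 1))}
    (hu : ‖u‖ = 1) : u.ofLp ⬝ᵥ u.ofLp = 1 := by
  have := EuclideanSpace.real_norm_sq_eq u
  rw [hu] at this
  simpa [dotProduct, sq] using this.symm

/-- A differentiable curve of unit vectors, which spans a two-parameter cone of class `C¹`, extends
to a differentiable curve of orthogonal matrices that depend only on the unit vector. -/
theorem exists_orthogonal_extension {u β : ℝ → EuclideanSpace ℝ (Fin (m + 1))} (hu : ∀ t, ‖u t‖ = 1)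
    (hd : ∀ t i, DifferentiableAt ℝ (fun s => u s i) t) (hβ : ContDiff ℝ 1 β)
    (huβ : ∀ t, ∃ c : ℝ, u t = c • β t) :
    ∃ Q : ℝ → Matrix (Fin (m + 1)) (Fin (m + 1)) ℝ, (∀ t, (Q t).transpose * Q t = 1) ∧
      (∀ t i, Q t i 0 = u t i) ∧ (∀ t i j, DifferentiableAt ℝ (fun s => Q s i j) t) ∧
      ∀ s t, u s = u t → Q s = Q t := by
  have huu := fun t => dotProduct_ofLp_self_of_norm_one (hu t)
  match m with
  | 0 =>
    refine ⟨fun t => Matrix.of fun i _ => u t i, fun t => ?_, fun t i => rfl, fun t i j => hd t i,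
      fun s t h => by simp only [h]⟩
    ext i j
    fin_cases i; fin_cases j
    have := huu t
    simpa [Matrix.mul_apply, dotProduct] using this
  -- In the plane the tangent directions may fill the whole circle, so no vector can be avoided. The
  -- rotation by a right angle supplies the second column instead.
  | 1 =>
    refine ⟨fun t => !![u t 0, -u t 1; u t 1, u t 0], fun t => ?_, fun t i => ?_, fun t i j => ?_,
      fun s t h => by simp only [h]⟩
    · have h1 : u t 0 * u t 0 + u t 1 * u t 1 = 1 := by
        have := huu t
        simpa [dotProduct, Fin.sum_univ_two] using this
      ext i j
      fin_cases i <;> fin_cases j <;> simp [Matrix.mul_apply, Fin.sum_univ_two] <;> linarith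
    · fin_cases i <;> simp
    · fin_cases i <;> fin_cases j
      · simpa using hd t 0
      · simpa using (hd t 1)
      · simpa using hd t 1
      · simpa using hd t 0
  | k + 2 =>
    have hf : ContDiff ℝ 1 fun q : ℝ × ℝ => q.1 • β q.2 :=
      contDiff_fst.smul (hβ.comp contDiff_snd)
    -- In dimension at least 3 the C¹ image of ℝ² has dense complement. A vector outside the cone
    -- over β, once normalized, differs from every u t.
    obtain ⟨a₀, ha₀⟩ := (hf.dense_compl_range_of_finrank_lt_finrank (by simp)).nonempty
    have ha₀0 : a₀ ≠ 0 := fun h => ha₀ ⟨(0, 0), by simp [h]⟩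
    have hn : ‖a₀‖ ≠ 0 := norm_ne_zero_iff.2 ha₀0
    set a := ‖a₀‖⁻¹ • a₀ with ha
    have ha1 : ‖a‖ = 1 := by rw [ha, norm_smul, norm_inv, norm_norm, inv_mul_cancel₀ hn]
    have hau : ∀ t, a ≠ u t := fun t h => by
      obtain ⟨c, hc⟩ := huβ t
      refine ha₀ ⟨(‖a₀‖ * c, t), ?_⟩
      simp only
      rw [mul_smul, ← hc, ← h, ha, smul_inv_smul₀ hn]
    set e : EuclideanSpace ℝ (Fin (k + 2 + 1)) := EuclideanSpace.single 0 1 with he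
    have he1 : ‖e‖ = 1 := by simp [he]
    -- A fixed reflection carries e to a, and a second one, never degenerate, carries a to u t.
    have hcol : ∀ t, (householder (a.ofLp - (u t).ofLp) * householder (e.ofLp - a.ofLp)).mulVec e.ofLp
        = (u t).ofLp := fun t => by
      rw [← Matrix.mulVec_mulVec, householder_sub_mulVec, householder_sub_mulVec]
      · rw [huu, dotProduct_ofLp_self_of_norm_one ha1]
      · rw [dotProduct_ofLp_self_of_norm_one he1, dotProduct_ofLp_self_of_norm_one ha1]
    refine ⟨fun t => householder (a.ofLp - (u t).ofLp) * householder (e.ofLp - a.ofLp), fun t => ?_,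
      fun t i => ?_, fun t i j => ?_, fun s t h => by simp only [h]⟩
    · rw [Matrix.transpose_mul, Matrix.mul_assoc, ← Matrix.mul_assoc (householder _).transpose
        (householder (a.ofLp - (u t).ofLp)), householder_transpose_mul_self, Matrix.one_mul,
        householder_transpose_mul_self]
    · rw [← hcol t]
      simp [he]
    · simp only [Matrix.mul_apply]
      refine DifferentiableAt.fun_sum fun l _ => DifferentiableAt.mul_const ?_ _
      refine differentiableAt_householder (w := fun s => a.ofLp - (u s).ofLp) ?_ ?_ i l
      · intro h
        exact hau t (WithLp.ofLp_injective 2 (sub_eq_zero.1 h))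
      · exact fun i => (differentiableAt_const _).sub (hd t i)

end Frames

/-! ### Restriction of matrices to the normal hyperplane -/

section NormalHyperplane

variable {m : ℕ}

/-- The only summand lost by deletion has index 0, and it carries the vanishing factor G i 0. -/
theorem mul_submatrix_succ_of_col_zero {G X : Matrix (Fin (m + 1)) (Fin (m + 1)) ℝ}
    (hG : ∀ i, G i 0 = 0) :
    (G * X).submatrix Fin.succ Fin.succ
      = G.submatrix Fin.succ Fin.succ * X.submatrix Fin.succ Fin.succ := by
  ext i j
  simp [Matrix.mul_apply, Fin.sum_univ_succ, hG]

theorem mul_submatrix_succ_of_row_zero {G X : Matrix (Fin (m + 1)) (Fin (m + 1)) ℝ}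
    (hG : ∀ j, G 0 j = 0) :
    (X * G).submatrix Fin.succ Fin.succ
      = X.submatrix Fin.succ Fin.succ * G.submatrix Fin.succ Fin.succ := by
  ext i j
  simp [Matrix.mul_apply, Fin.sum_univ_succ, hG]

theorem hasDerivAt_mul_apply {N : ℕ} {A B : ℝ → Matrix (Fin N) (Fin N) ℝ}
    {A' B' : Matrix (Fin N) (Fin N) ℝ} {t : ℝ}
    (hA : ∀ i j, HasDerivAt (fun s => A s i j) (A' i j) t)
    (hB : ∀ i j, HasDerivAt (fun s => B s i j) (B' i j) t) (i j : Fin N) :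
    HasDerivAt (fun s => (A s * B s) i j) ((A' * B t + A t * B') i j) t := by
  simp only [Matrix.mul_apply, Matrix.add_apply, ← Finset.sum_add_distrib]
  exact HasDerivAt.fun_sum fun k _ => (hA i k).mul (hB k j)

theorem dotProduct_normalPart (Q M : Matrix (Fin (m + 1)) (Fin (m + 1)) ℝ) (w : Fin m → ℝ) :
    w ⬝ᵥ (normalPart Q M).mulVec w
      = Q.mulVec (Fin.cons 0 w) ⬝ᵥ M.mulVec (Q.mulVec (Fin.cons 0 w)) := by
  have h1 : Q.mulVec (Fin.cons 0 w) ⬝ᵥ M.mulVec (Q.mulVec (Fin.cons 0 w))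
      = (Fin.cons 0 w : Fin (m + 1) → ℝ) ⬝ᵥ (Q.transpose * M * Q).mulVec (Fin.cons 0 w) := by
    rw [← Matrix.mulVec_mulVec, ← Matrix.mulVec_mulVec, Matrix.dotProduct_transpose_mulVec,
      dotProduct_comm]
  rw [h1]
  simp [dotProduct, Matrix.mulVec, normalPart, Fin.sum_univ_succ]

variable {Q M : Matrix (Fin (m + 1)) (Fin (m + 1)) ℝ}

theorem normalPart_isHermitian (hM : M.transpose = M) : (normalPart Q M).IsHermitian := by
  rw [Matrix.IsHermitian, Matrix.conjTranspose_eq_transpose_of_trivial, normalPart,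
    Matrix.transpose_submatrix]
  simp [Matrix.transpose_mul, hM, Matrix.mul_assoc]

theorem transpose_mulVec_mulVec_cons (hQ : Q.transpose * Q = 1) (w : Fin m → ℝ) :
    Q.transpose.mulVec (Q.mulVec (Fin.cons 0 w)) = Fin.cons 0 w := by
  rw [Matrix.mulVec_mulVec, hQ, Matrix.one_mulVec]

theorem normalPart_posDef (hM : M.transpose = M) (h : ∀ w : Fin m → ℝ, w ≠ 0 →
    0 < Q.mulVec (Fin.cons 0 w) ⬝ᵥ M.mulVec (Q.mulVec (Fin.cons 0 w))) :
    (normalPart Q M).PosDef :=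
  Matrix.PosDef.of_dotProduct_mulVec_pos (normalPart_isHermitian hM) fun w hw => by
    rw [star_trivial, dotProduct_normalPart]
    exact h w hw

theorem normalPart_posDef_of_posDef (hQ : Q.transpose * Q = 1) (hM : M.PosDef) :
    (normalPart Q M).PosDef := by
  refine normalPart_posDef (isSymm_of_posDef hM) fun w hw => ?_
  have h := hM.dotProduct_mulVec_pos (x := Q.mulVec (Fin.cons 0 w)) fun h0 => hw ?_
  · simpa using h
  · have h1 := transpose_mulVec_mulVec_cons hQ w
    rw [h0, Matrix.mulVec_zero] at h1
    ext i
    simpa using (congrFun h1 i.succ).symm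

theorem conj_mul_col_zero {v : Fin (m + 1) → ℝ} {c : ℝ} (hv : ∀ i, Q i 0 = v i / c)
    (hM : M.mulVec v = 0) (i : Fin (m + 1)) : (Q.transpose * M * Q) i 0 = 0 := by
  have h1 : ∀ k, (M * Q) k 0 = 0 := fun k => by
    have h2 := congrFun hM k
    simp only [Matrix.mulVec, dotProduct, Pi.zero_apply] at h2
    simp only [Matrix.mul_apply, hv, mul_div_assoc', ← Finset.sum_div, h2, zero_div]
  rw [Matrix.mul_assoc, Matrix.mul_apply]
  simp [h1]

theorem conj_mul_row_zero {v : Fin (m + 1) → ℝ} {c : ℝ} (hv : ∀ i, Q i 0 = v i / c)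
    (hM : M.mulVec v = 0) (hsymm : M.transpose = M) (j : Fin (m + 1)) :
    (Q.transpose * M * Q) 0 j = 0 := by
  have h1 : (Q.transpose * M * Q).transpose = Q.transpose * M * Q := by
    simp [Matrix.transpose_mul, hsymm, Matrix.mul_assoc]
  rw [← h1, Matrix.transpose_apply, conj_mul_col_zero hv hM]

/-- The Riccati equation in a moving frame, restricted to the normal hyperplane. -/
theorem hasDerivAt_normalPart {Q K : ℝ → Matrix (Fin (m + 1)) (Fin (m + 1)) ℝ}
    {Q' A D : Matrix (Fin (m + 1)) (Fin (m + 1)) ℝ} {t : ℝ} (hQ : (Q t).transpose * Q t = 1)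
    (hQ' : ∀ i j, HasDerivAt (fun s => Q s i j) (Q' i j) t)
    (hK : ∀ i j, HasDerivAt (fun s => K s i j)
      ((-(K t * A) - A.transpose * K t - (2 : ℝ) • (K t * D * K t)) i j) t)
    (hcol : ∀ i, ((Q t).transpose * K t * Q t) i 0 = 0)
    (hrow : ∀ j, ((Q t).transpose * K t * Q t) 0 j = 0) (i j : Fin m) :
    HasDerivAt (fun s => normalPart (Q s) (K s) i j)
      ((-(normalPart (Q t) (K t) * (normalPart (Q t) A - frameRotation (Q t) Q'))
        - (normalPart (Q t) A - frameRotation (Q t) Q').transpose * normalPart (Q t) (K t)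
        - (2 : ℝ) • (normalPart (Q t) (K t) * normalPart (Q t) D * normalPart (Q t) (K t))) i j)
      t := by
  have hQQ : Q t * (Q t).transpose = 1 := mul_eq_one_comm.1 hQ
  have hd := hasDerivAt_mul_apply (hasDerivAt_mul_apply (A := fun s => (Q s).transpose)
    (A' := Q'.transpose) (fun i j => hQ' j i) hK) hQ' i.succ j.succ
  refine hd.congr_deriv ?_
  set R := Q t with hR
  set G := R.transpose * K t * R with hG
  set S := R.transpose * Q' with hS
  set Ah := R.transpose * A * R with hAh
  set Dh := R.transpose * D * R with hDh
  -- The full Riccati equation in the frame: writing Q' = QS turns the derivative of the frame into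
  -- SᵀG + GS, which shifts A to A - S. The tangential index is deleted only afterwards.
  have e1 : (Q'.transpose * K t
      + R.transpose * (-(K t * A) - A.transpose * K t - (2 : ℝ) • (K t * D * K t))) * R
      + R.transpose * K t * Q'
      = -(G * (Ah - S)) - (Ah - S).transpose * G - (2 : ℝ) • (G * Dh * G) := by
    have c1 : R * S = Q' := by rw [hS, ← Matrix.mul_assoc, hQQ, Matrix.one_mul]
    have c2 : S.transpose * R.transpose = Q'.transpose := by rw [← Matrix.transpose_mul, c1]
    have c3 : ∀ X : Matrix (Fin (m + 1)) (Fin (m + 1)) ℝ, R * (R.transpose * X) = X := fun X => by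
      rw [← Matrix.mul_assoc, hQQ, Matrix.one_mul]
    have c4 : Ah.transpose = R.transpose * A.transpose * R := by
      simp [hAh, Matrix.transpose_mul, Matrix.mul_assoc]
    have d1 : G * S = R.transpose * K t * Q' := by rw [hG, Matrix.mul_assoc, c1]
    have d2 : S.transpose * G = Q'.transpose * K t * R := by
      rw [hG, ← c2]; simp only [Matrix.mul_assoc]
    have d3 : G * Ah = R.transpose * (K t * A) * R := by
      simp only [hG, hAh, Matrix.mul_assoc, c3]
    have d4 : Ah.transpose * G = R.transpose * (A.transpose * K t) * R := by
      simp only [c4, hG, Matrix.mul_assoc, c3]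
    have d5 : G * Dh * G = R.transpose * (K t * D * K t) * R := by
      simp only [hG, hDh, Matrix.mul_assoc, c3]
    rw [Matrix.transpose_sub, Matrix.mul_sub G Ah S, Matrix.sub_mul Ah.transpose S.transpose G, d1, d2, d3, d4, d5]
    simp only [Matrix.add_mul, Matrix.mul_sub, Matrix.sub_mul, Matrix.mul_neg, Matrix.neg_mul,
      Matrix.mul_smul, Matrix.smul_mul]
    abel
  rw [e1]
  have f1 := congrFun (congrFun (mul_submatrix_succ_of_col_zero (X := Ah - S) hcol) i) j
  have f2 := congrFun (congrFun
    (mul_submatrix_succ_of_row_zero (X := (Ah - S).transpose) hrow) i) j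
  have f3 := congrFun (congrFun (mul_submatrix_succ_of_row_zero (X := G * Dh) hrow) i) j
  rw [mul_submatrix_succ_of_col_zero hcol] at f3
  simp only [Matrix.submatrix_apply] at f1 f2 f3
  simp only [Matrix.sub_apply, Matrix.neg_apply, Matrix.smul_apply]
  rw [f1, f2, f3]
  rfl

end NormalHyperplane

/-! ### Consequences along the cycle -/

section StableCycle

variable {n : ℕ} {b : EuclideanSpace ℝ (Fin n) → EuclideanSpace ℝ (Fin n)}
  {D : Matrix (Fin n) (Fin n) ℝ} {Γ 𝒟 : Set (EuclideanSpace ℝ (Fin n))}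
  {φ : EuclideanSpace ℝ (Fin n) → ℝ}

theorem partials_eq_zero_of_mem (h𝒟 : IsOpen 𝒟) (hΓ𝒟 : Γ ⊆ 𝒟) (hb : Continuous b)
    (hΓ : IsPeriodicOrbit b Γ) (hφ : ∀ y ∈ 𝒟, φ y = rateFunction b D Γ y)
    {y : EuclideanSpace ℝ (Fin n)} (hy : y ∈ Γ) :
    partials φ y = 0 := by
  ext i
  simp [partials, fderiv_eq_zero_of_mem h𝒟 hΓ𝒟 hb hΓ hφ hy]

theorem hessian_mulVec_eq_zero_of_mem (h𝒟 : IsOpen 𝒟) (hΓ𝒟 : Γ ⊆ 𝒟) (hb : Continuous b)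
    (hΓ : IsPeriodicOrbit b Γ) (hφ : ∀ y ∈ 𝒟, φ y = rateFunction b D Γ y)
    (hφ𝒟 : ContDiffOn ℝ 2 φ 𝒟) {y : EuclideanSpace ℝ (Fin n)} (hy : y ∈ Γ) :
    (hessian φ y).mulVec (b y).ofLp = 0 := by
  have hcrit := fun z (hz : z ∈ Γ) => partials_eq_zero_of_mem h𝒟 hΓ𝒟 hb hΓ hφ hz
  obtain ⟨p, T, -, hp, -, -, rfl⟩ := hΓ
  obtain ⟨t, rfl⟩ := hy
  exact hessian_mulVec_eq_zero h𝒟 hφ𝒟 (hΓ𝒟 (mem_range_self t))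
    ((hp t (mem_univ t)).hasDerivAt univ_mem) fun s => hcrit _ (mem_range_self s)

/-- On a stable limit cycle, the Hessian of the rate function is positive definite modulo the
tangent direction. -/
theorem exists_eq_smul_of_hessian_nonpos_of_mem (hD : D.PosDef) (h𝒟 : IsOpen 𝒟) (hΓ𝒟 : Γ ⊆ 𝒟)
    (hb : Continuous b) (hb𝒟 : ContDiffOn ℝ 1 b 𝒟) (hΓ : IsStableLimitCycle b Γ)
    (hφ : ∀ y ∈ 𝒟, φ y = rateFunction b D Γ y) (hφ𝒟 : ContDiffOn ℝ 2 φ 𝒟)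
    {y : EuclideanSpace ℝ (Fin n)} (hy : y ∈ Γ)
    {v : EuclideanSpace ℝ (Fin n)}
    (hv : v.ofLp ⬝ᵥ (hessian φ y).mulVec v.ofLp ≤ 0) : ∃ c : ℝ, v = c • b y := by
  have hcrit := fun z (hz : z ∈ Γ) => partials_eq_zero_of_mem h𝒟 hΓ𝒟 hb hΓ.orbit hφ hz
  have hHb := hessian_mulVec_eq_zero_of_mem h𝒟 hΓ𝒟 hb hΓ.orbit hφ hφ𝒟 hy
  have hb0 := fun z (hz : z ∈ Γ) => ne_zero_of_mem_periodicOrbit h𝒟 hΓ𝒟 hb𝒟 hΓ.orbit hz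
  have hφ0 : ∀ z ∈ Γ, φ z = 0 := fun z hz => by
    rw [hφ z (hΓ𝒟 hz), rateFunction_eq_zero_of_mem hb hΓ.orbit hz]
  obtain ⟨M, ρ, hM, hρ, hlow⟩ := exists_min_infDist_sq_le_rateFunction hD h𝒟 hΓ𝒟 hb hb𝒟 hΓ
  obtain ⟨p, T, hT, hp, hper, -, rfl⟩ := hΓ.orbit
  exact exists_eq_smul_of_hessian_nonpos h𝒟 hφ𝒟 hT hper
    (fun t => (hp t (mem_univ t)).hasDerivAt univ_mem) hΓ𝒟 hφ0 hcrit hb0 hM hρ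
    (fun z hz => by rw [hφ z hz]; exact hlow z) hy
    (Matrix.ext fun i j => hessian_symm h𝒟 hφ𝒟 (hΓ𝒟 hy) j i) hHb hv

/-- At a critical point of φ the transport direction b + 2D∇φ is the velocity of the trajectory, so
the transport PDE becomes an ODE for log ω. -/
theorem hasDerivAt_log_prefactor (hD : D.PosDef) (h𝒟 : IsOpen 𝒟) (hb : Continuous b)
    (hb𝒟 : ContDiffOn ℝ 1 b 𝒟) (hφ : ContDiffOn ℝ 2 φ 𝒟)
    (hHJ : ∀ z ∈ 𝒟, hamiltonian b D φ z = 0) {ω : EuclideanSpace ℝ (Fin n) → ℝ}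
    (hω : ContDiffOn ℝ 1 ω 𝒟)
    {ρ : ℝ → EuclideanSpace ℝ (Fin n) → ℝ} {a : ℝ → ℝ} (hW : IsStationaryWKB b D 𝒟 φ ω ρ a)
    {x : ℝ → EuclideanSpace ℝ (Fin n)} {t : ℝ}
    (hxt : x t ∈ 𝒟) (hx : HasDerivAt x (b (x t)) t) (hcrit : partials φ (x t) = 0) :
    HasDerivAt (fun s => Real.log (ω (x s)))
      (-(divergence b (x t)) - frobenius D (hessian φ (x t))) t := by
  have hpos := hW.prefactor_pos _ hxt
  have h1 := (((hω.contDiffAt (h𝒟.mem_nhds hxt)).differentiableAt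
    one_ne_zero).hasFDerivAt.comp_hasDerivAt t hx).log hpos.ne'
  have h2 : fluctuationField b D φ (x t) = b (x t) := by
    ext i
    simp [fluctuationField_apply, hcrit]
  refine h1.congr_deriv ?_
  rw [← h2, transport_equation hD h𝒟 hb hb𝒟 hφ hHJ hω hW hxt]
  simp only [Function.comp_apply]
  field_simp
  ring

end StableCycle

/-! ### Moving frames along the cycle -/

section MovingFrame

variable {m : ℕ} {b : EuclideanSpace ℝ (Fin (m + 1)) → EuclideanSpace ℝ (Fin (m + 1))}
  {x p : ℝ → EuclideanSpace ℝ (Fin (m + 1))} {Q Q' : ℝ → Matrix (Fin (m + 1)) (Fin (m + 1)) ℝ}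
  {𝒟 : Set (EuclideanSpace ℝ (Fin (m + 1)))}

/-- Along a solution that never meets an equilibrium there is a moving frame that depends only on
the direction of the velocity. -/
theorem exists_isMovingFrame (h𝒟 : IsOpen 𝒟) (hb𝒟 : ContDiffOn ℝ 1 b 𝒟) (hp𝒟 : ∀ t, p t ∈ 𝒟)
    (hp : ∀ t, HasDerivAt p (b (p t)) t) (hb0 : ∀ t, b (p t) ≠ 0)
    (hxp : ∀ t, 0 ≤ t → x t = p t) :
    ∃ Q Q', IsMovingFrame b x Q Q' ∧ ∀ s t, p s = p t → Q s = Q t := by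
  have hpd : Differentiable ℝ p := fun t => (hp t).differentiableAt
  have hpderiv : deriv p = b ∘ p := funext fun t => (hp t).deriv
  -- p is C¹ because p' = b ∘ p is continuous. Then b ∘ p is C¹, as the dimension argument for the
  -- frame requires.
  have hp1 : ContDiff ℝ 1 p := by
    rw [contDiff_one_iff_deriv, hpderiv]
    exact ⟨hpd, hb𝒟.continuousOn.comp_continuous hpd.continuous hp𝒟⟩
  have hβ : ContDiff ℝ 1 (fun t => b (p t)) := contDiff_iff_contDiffAt.2 fun t =>
    (hb𝒟.contDiffAt (h𝒟.mem_nhds (hp𝒟 t))).comp t hp1.contDiffAt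
  have hn : ∀ t, ‖b (p t)‖ ≠ 0 := fun t => norm_ne_zero_iff.2 (hb0 t)
  have hu : Differentiable ℝ fun t => ‖b (p t)‖⁻¹ • b (p t) := fun t =>
    (((hβ.differentiable one_ne_zero t).norm ℝ (hb0 t)).inv (hn t)).smul
      (hβ.differentiable one_ne_zero t)
  obtain ⟨Q, hQ, hQ0, hQd, hQu⟩ := exists_orthogonal_extension
    (u := fun t => ‖b (p t)‖⁻¹ • b (p t)) (β := fun t => b (p t))
    (fun t => by rw [norm_smul, norm_inv, norm_norm, inv_mul_cancel₀ (hn t)])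
    (fun t i => differentiableAt_euclidean.1 (hu t) i) hβ fun t => ⟨_, rfl⟩
  refine ⟨Q, fun t => Matrix.of fun i j => deriv (fun s => Q s i j) t, ⟨fun t _ => hQ t,
    fun t ht i => ?_, fun t _ i j => (hQd t i j).hasDerivAt⟩, fun s t h => hQu s t (by simp only [h])⟩
  rw [hQ0, hxp t ht]
  simp [div_eq_inv_mul]

theorem IsMovingFrame.deriv_add_period (hQ : IsMovingFrame b x Q Q') {T : ℝ} (hT : 0 < T)
    (hper : ∀ t, 0 ≤ t → Q (t + T) = Q t) {t : ℝ} (ht : 0 < t) : Q' (t + T) = Q' t := by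
  ext i j
  have h1 := (hQ.hasDeriv (t + T) (add_pos ht hT) i j).comp_add_const t T
  refine h1.unique ((hQ.hasDeriv t ht i j).congr_of_eventuallyEq ?_)
  filter_upwards [lt_mem_nhds ht] with s hs
  rw [hper s hs.le]

/-- If the form is nonpositive at the vector with frame coordinates (0, w), that vector is tangent.
Its coordinates then vanish beyond the first, so w = 0. -/
theorem IsMovingFrame.normalPart_posDef {M : Matrix (Fin (m + 1)) (Fin (m + 1)) ℝ}
    (hQ : IsMovingFrame b x Q Q') {t : ℝ} (ht : 0 ≤ t) (hM : M.transpose = M)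
    (h : ∀ v : EuclideanSpace ℝ (Fin (m + 1)), v.ofLp ⬝ᵥ M.mulVec v.ofLp ≤ 0 →
      ∃ c : ℝ, v = c • b (x t)) : (normalPart (Q t) M).PosDef := by
  refine LimitCycle.normalPart_posDef hM fun w hw => ?_
  by_contra hneg
  obtain ⟨c, hc⟩ := h (WithLp.toLp 2 ((Q t).mulVec (Fin.cons 0 w))) (not_lt.1 hneg)
  refine hw ?_
  have h1 := transpose_mulVec_mulVec_cons (hQ.orthonormal t ht) w
  have h2 : (Q t).mulVec (Fin.cons 0 w)
      = (Q t).mulVec (Pi.single 0 (c * ‖b (x t)‖)) := by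
    have h3 := congrArg WithLp.ofLp hc
    simp only at h3
    rw [h3]
    ext i
    simp only [Matrix.mulVec_single, WithLp.ofLp_smul, Pi.smul_apply, Matrix.col_apply,
      MulOpposite.smul_eq_mul_unop, MulOpposite.unop_op, smul_eq_mul, hQ.tangent t ht]
    by_cases hb : ‖b (x t)‖ = 0
    · simp [norm_eq_zero.1 hb]
    · field_simp
  rw [h2, Matrix.mulVec_mulVec, hQ.orthonormal t ht, Matrix.one_mulVec] at h1
  ext i
  simpa using (congrFun h1 i.succ).symm

end MovingFrame

end LimitCycle

/-! ### The main theorem -/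

theorem mainTheorem3 {m : ℕ}
    (b : EuclideanSpace ℝ (Fin (m + 1)) → EuclideanSpace ℝ (Fin (m + 1)))
    (D : Matrix (Fin (m + 1)) (Fin (m + 1)) ℝ) (hD : D.PosDef)
    (Γ 𝒟 : Set (EuclideanSpace ℝ (Fin (m + 1))))
    (h𝒟 : IsOpen 𝒟) (hΓ𝒟 : Γ ⊆ 𝒟)
    (hb : Continuous b) (hb𝒟 : ContDiffOn ℝ 1 b 𝒟)
    (hΓ : LimitCycle.IsStableLimitCycle b Γ)
    (φ : EuclideanSpace ℝ (Fin (m + 1)) → ℝ)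
    (hφ : ∀ y ∈ 𝒟, φ y = LimitCycle.rateFunction b D Γ y) (hφ𝒟 : ContDiffOn ℝ 3 φ 𝒟)
    (x : ℝ → EuclideanSpace ℝ (Fin (m + 1))) (hx0 : x 0 ∈ Γ)
    (hx : LimitCycle.IsTrajectoryOn b x (Set.Ici 0)) :
    -- the Riccati equation for the curvature along the cycle
    (∀ t, 0 < t → ∀ i j, HasDerivAt (fun s => LimitCycle.hessian φ (x s) i j)
      ((-(LimitCycle.hessian φ (x t) * LimitCycle.jacobian b (x t))
        - (LimitCycle.jacobian b (x t)).transpose * LimitCycle.hessian φ (x t)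
        - (2 : ℝ) • (LimitCycle.hessian φ (x t) * D * LimitCycle.hessian φ (x t))) i j) t) ∧
    -- the equation for the prefactor
    (∀ (ω : EuclideanSpace ℝ (Fin (m + 1)) → ℝ)
      (ρ : ℝ → EuclideanSpace ℝ (Fin (m + 1)) → ℝ) (a : ℝ → ℝ),
      ContDiffOn ℝ 1 ω 𝒟 → LimitCycle.IsStationaryWKB b D 𝒟 φ ω ρ a →
      ∀ t, 0 < t →
        HasDerivAt (fun s => Real.log (ω (x s)))
          (-(LimitCycle.divergence b (x t))
            - LimitCycle.frobenius D (LimitCycle.hessian φ (x t))) t ∧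
        -(LimitCycle.divergence b (x t)) - LimitCycle.frobenius D (LimitCycle.hessian φ (x t))
          = -(LimitCycle.divergence (LimitCycle.circulation b D φ) (x t))) ∧
    -- zero is a simple eigenvalue with tangent eigenvector; the other eigenvalues are positive
    -- with eigenvectors normal to the cycle
    (∀ t, 0 ≤ t →
      (LimitCycle.hessian φ (x t)).IsSymm ∧
      b (x t) ≠ 0 ∧
      (∀ v : EuclideanSpace ℝ (Fin (m + 1)),
        Matrix.mulVec (LimitCycle.hessian φ (x t)) v.ofLp = 0 ↔ ∃ c : ℝ, v = c • b (x t)) ∧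
      (∀ (μ : ℝ) (v : EuclideanSpace ℝ (Fin (m + 1))), v ≠ 0 →
        Matrix.mulVec (LimitCycle.hessian φ (x t)) v.ofLp = μ • v.ofLp → μ ≠ 0 →
          0 < μ ∧ inner ℝ v (b (x t)) = 0)) ∧
    -- reduction to a periodic Riccati equation on the normal hyperplane
    (∃ T, 0 < T ∧ ∀ t, 0 ≤ t → x (t + T) = x t) ∧
    (∀ T, 0 < T → (∀ t, 0 ≤ t → x (t + T) = x t) →
      ∃ Q Q', LimitCycle.IsMovingFrame b x Q Q' ∧ ∀ t, 0 ≤ t → Q (t + T) = Q t) ∧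
    (∀ Q Q', LimitCycle.IsMovingFrame b x Q Q' →
      (∀ t, 0 ≤ t →
        (∀ i, ((Q t).transpose * LimitCycle.hessian φ (x t) * Q t) i 0 = 0) ∧
        (∀ j, ((Q t).transpose * LimitCycle.hessian φ (x t) * Q t) 0 j = 0) ∧
        (LimitCycle.normalPart (Q t) (LimitCycle.hessian φ (x t))).PosDef ∧
        (LimitCycle.normalPart (Q t) D).PosDef) ∧
      (∀ t, 0 < t → ∀ i j,
        HasDerivAt (fun s => LimitCycle.normalPart (Q s) (LimitCycle.hessian φ (x s)) i j)
          ((-(LimitCycle.normalPart (Q t) (LimitCycle.hessian φ (x t)) *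
                (LimitCycle.normalPart (Q t) (LimitCycle.jacobian b (x t))
                  - LimitCycle.frameRotation (Q t) (Q' t)))
            - (LimitCycle.normalPart (Q t) (LimitCycle.jacobian b (x t))
                  - LimitCycle.frameRotation (Q t) (Q' t)).transpose *
                LimitCycle.normalPart (Q t) (LimitCycle.hessian φ (x t))
            - (2 : ℝ) • (LimitCycle.normalPart (Q t) (LimitCycle.hessian φ (x t)) *
                LimitCycle.normalPart (Q t) D *
                LimitCycle.normalPart (Q t) (LimitCycle.hessian φ (x t)))) i j) t) ∧
      (∀ T, 0 < T → (∀ t, 0 ≤ t → x (t + T) = x t) → (∀ t, 0 ≤ t → Q (t + T) = Q t) →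
        ∀ t, 0 < t →
          LimitCycle.normalPart (Q (t + T)) (LimitCycle.hessian φ (x (t + T))) =
            LimitCycle.normalPart (Q t) (LimitCycle.hessian φ (x t)) ∧
          LimitCycle.normalPart (Q (t + T)) (LimitCycle.jacobian b (x (t + T)))
              - LimitCycle.frameRotation (Q (t + T)) (Q' (t + T)) =
            LimitCycle.normalPart (Q t) (LimitCycle.jacobian b (x t))
              - LimitCycle.frameRotation (Q t) (Q' t) ∧
          LimitCycle.normalPart (Q (t + T)) D = LimitCycle.normalPart (Q t) D)) := by
  have hφ2 : ContDiffOn ℝ 2 φ 𝒟 := hφ𝒟.of_le (by norm_num)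
  have hxΓ : ∀ t, 0 ≤ t → x t ∈ Γ := fun t ht =>
    LimitCycle.trajectory_mem_of_isStable hΓ hx0 hx ht
  have hx𝒟 : ∀ t, 0 ≤ t → x t ∈ 𝒟 := fun t ht => hΓ𝒟 (hxΓ t ht)
  have hxd : ∀ t, 0 < t → HasDerivAt x (b (x t)) t := fun t ht =>
    (hx t ht.le).hasDerivAt (Ici_mem_nhds ht)
  have hcrit : ∀ t, 0 ≤ t → LimitCycle.partials φ (x t) = 0 := fun t ht =>
    LimitCycle.partials_eq_zero_of_mem h𝒟 hΓ𝒟 hb hΓ.orbit hφ (hxΓ t ht)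
  have hHJ : ∀ z ∈ 𝒟, LimitCycle.hamiltonian b D φ z = 0 := fun z hz =>
    LimitCycle.hamiltonian_eq_zero hD h𝒟 hΓ𝒟 hb hΓ.orbit hΓ.orbit.isCompact.isClosed hφ
      (hφ𝒟.of_le (by norm_num)) hz
  have hsymm : ∀ t, 0 ≤ t → (LimitCycle.hessian φ (x t)).transpose = LimitCycle.hessian φ (x t) :=
    fun t ht => Matrix.ext fun i j => LimitCycle.hessian_symm h𝒟 hφ2 (hx𝒟 t ht) j i
  have hHb : ∀ t, 0 ≤ t → (LimitCycle.hessian φ (x t)).mulVec (b (x t)).ofLp = 0 := fun t ht =>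
    LimitCycle.hessian_mulVec_eq_zero_of_mem h𝒟 hΓ𝒟 hb hΓ.orbit hφ hφ2 (hxΓ t ht)
  have hker : ∀ t, 0 ≤ t → ∀ v : EuclideanSpace ℝ (Fin (m + 1)),
      v.ofLp ⬝ᵥ (LimitCycle.hessian φ (x t)).mulVec v.ofLp ≤ 0 → ∃ c : ℝ, v = c • b (x t) :=
    fun t ht v hv => LimitCycle.exists_eq_smul_of_hessian_nonpos_of_mem hD h𝒟 hΓ𝒟 hb hb𝒟 hΓ hφ hφ2
      (hxΓ t ht) hv
  have hHsmul : ∀ t, 0 ≤ t → ∀ (c : ℝ) (v : EuclideanSpace ℝ (Fin (m + 1))), v = c • b (x t) →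
      (LimitCycle.hessian φ (x t)).mulVec v.ofLp = 0 := fun t ht c v hv => by
    rw [hv, WithLp.ofLp_smul, Matrix.mulVec_smul, hHb t ht, smul_zero]
  have hriccati : ∀ t, 0 < t → ∀ i j, HasDerivAt (fun s => LimitCycle.hessian φ (x s) i j)
      ((-(LimitCycle.hessian φ (x t) * LimitCycle.jacobian b (x t))
        - (LimitCycle.jacobian b (x t)).transpose * LimitCycle.hessian φ (x t)
        - (2 : ℝ) • (LimitCycle.hessian φ (x t) * D * LimitCycle.hessian φ (x t))) i j) t :=
    fun t ht i j =>
      (LimitCycle.hasDerivAt_hessian_along h𝒟 hφ𝒟 (hx𝒟 t ht.le) (hxd t ht) i j).congr_deriv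
        (LimitCycle.hessian_hamiltonJacobi hD h𝒟 hb𝒟 hφ𝒟 hHJ (hx𝒟 t ht.le) (hcrit t ht.le) i j)
  obtain ⟨p, T₀, hT₀, hp, hper, hΓp, hxp⟩ :=
    LimitCycle.exists_periodic_extension h𝒟 hΓ𝒟 hb𝒟 hΓ hx0 hx
  have hpΓ : ∀ t, p t ∈ Γ := fun t => hΓp ▸ Set.mem_range_self t
  refine ⟨hriccati, fun ω ρ a hω hW t ht => ⟨?_, ?_⟩, fun t ht => ⟨hsymm t ht, ?_, fun v => ?_,
    fun μ v hv0 hv hμ => ?_⟩, ⟨T₀, hT₀, fun t ht => ?_⟩, fun T hT hxT => ?_, fun Q Q' hQ =>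
    ⟨fun t ht => ?_, fun t ht i j => ?_, fun T hT hxT hQT t ht => ?_⟩⟩
  · exact LimitCycle.hasDerivAt_log_prefactor hD h𝒟 hb hb𝒟 hφ2 hHJ hω hW (hx𝒟 t ht.le) (hxd t ht)
      (hcrit t ht.le)
  · rw [LimitCycle.divergence_circulation h𝒟 hb𝒟 hφ2 (hx𝒟 t ht.le)]
    ring
  · exact LimitCycle.ne_zero_of_mem_periodicOrbit h𝒟 hΓ𝒟 hb𝒟 hΓ.orbit (hxΓ t ht)
  · exact ⟨fun hv => hker t ht v (by rw [hv, dotProduct_zero]), fun ⟨c, hc⟩ => hHsmul t ht c v hc⟩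
  · constructor
    · have hvv : 0 ≤ v.ofLp ⬝ᵥ v.ofLp := Finset.sum_nonneg fun i _ => mul_self_nonneg (v i)
      by_contra hneg
      -- A negative eigenvalue makes the quadratic form nonpositive at v. Then v is tangent and lies
      -- in the kernel, against μ ≠ 0.
      obtain ⟨c, hc⟩ := hker t ht v (by
        rw [hv, dotProduct_smul, smul_eq_mul]
        exact mul_nonpos_of_nonpos_of_nonneg (not_lt.1 hneg) hvv)
      have h0 := hHsmul t ht c v hc
      rw [hv, smul_eq_zero] at h0
      exact h0.elim hμ (mt (WithLp.ofLp_eq_zero 2).1 hv0)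
    -- Symmetry moves the Hessian onto b, which it annihilates, so μ⟨b, v⟩ = 0.
    · have h1 : (b (x t)).ofLp ⬝ᵥ (LimitCycle.hessian φ (x t)).mulVec v.ofLp = 0 := by
        rw [Matrix.dotProduct_mulVec, ← Matrix.mulVec_transpose, hsymm t ht, hHb t ht,
          zero_dotProduct]
      rw [hv, dotProduct_smul, smul_eq_mul] at h1
      rw [EuclideanSpace.inner_eq_star_dotProduct, star_trivial]
      exact (mul_eq_zero.1 h1).resolve_left hμ
  · rw [hxp t ht, hxp (t + T₀) (by positivity), hper t]
  · obtain ⟨Q, Q', hQ, hQp⟩ := LimitCycle.exists_isMovingFrame h𝒟 hb𝒟 (fun t => hΓ𝒟 (hpΓ t)) hp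
      (fun t => LimitCycle.ne_zero_of_mem_periodicOrbit h𝒟 hΓ𝒟 hb𝒟 hΓ.orbit (hpΓ t)) hxp
    -- The frame depends only on the point p t, so it has every period T of x, not only the period
    -- T₀ of the extension.
    refine ⟨Q, Q', hQ, fun t ht => hQp _ _ ?_⟩
    rw [← hxp t ht, ← hxp (t + T) (by positivity), hxT t ht]
  · exact ⟨fun i => LimitCycle.conj_mul_col_zero (hQ.tangent t ht) (hHb t ht) i,
      fun j => LimitCycle.conj_mul_row_zero (hQ.tangent t ht) (hHb t ht) (hsymm t ht) j,
      hQ.normalPart_posDef ht (hsymm t ht) (hker t ht),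
      LimitCycle.normalPart_posDef_of_posDef (hQ.orthonormal t ht) hD⟩
  · exact LimitCycle.hasDerivAt_normalPart (K := fun s => LimitCycle.hessian φ (x s))
      (hQ.orthonormal t ht.le) (hQ.hasDeriv t ht) (hriccati t ht)
      (LimitCycle.conj_mul_col_zero (hQ.tangent t ht.le) (hHb t ht.le))
      (LimitCycle.conj_mul_row_zero (hQ.tangent t ht.le) (hHb t ht.le) (hsymm t ht.le)) i j
  · rw [hxT t ht.le, hQT t ht.le, hQ.deriv_add_period hT hQT ht]
    exact ⟨rfl, rfl, rfl⟩
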